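/- Let $X$ be a connected, locally finite simple graph with at least two vertices, and let $G=\operatorname{Aut}X$. Suppose that $X$ is $G$-finite, i.e. $G\backslash X$ is finite. For a subgraph $A$ of $X$ let $\delta A$ be the set of vertices of $A$ that are incident with an edge of $X$ not in $A$, and let $A^*$ be the subgraph with vertex set $(VX\setminus VA)\cup\delta A$ and edge set $EX\setminus EA$. Call $A$ a *1-separation* if $\delta A$ consists of one vertex, and this vertex is incident with an edge of $A$. Call $A$ a *2-separation* if $\delta A$ consists of two vertices, each of them is incident with an edge of $A$, and $A$ is neither a single edge (with its ends) nor obtained from $X$ by removing a single edge and no vertices. Let $\mathcal B_2X$ be the set of all 1- and 2-separations. Then there is a subset $\mathcal E\subseteq\mathcal B_2X$ that is $G$-invariant, closed under $A\mapsto A^*$, and consists of finitely many $G$-orbits, such that (i) for all $A,B\in\mathcal E$ at least one of $A\subseteq B$, $A\subseteq B^*$, $A^*\subseteq B$, $A^*\subseteq B^*$ holds; (ii) for all $A,B\in\mathcal E$ with $A\subseteq B$ there are only finitely many $C\in\mathcal E$ with $A\subseteq C\subseteq B$; and such that the following holds. For $A,B\in\mathcal E$ write $A\sim B$ if $A=B$,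 or if $A\subsetneq B^*$ and there is no $C\in\mathcal E$ with $A\subsetneq C\subsetneq B^*$. Let $T$ be the graph whose vertices are the sets $\{B\in\mathcal E: A\sim B\}$ with $A\in\mathcal E$ (if $\mathcal E=\emptyset$, then $T$ has the single vertex $\emptyset$), two distinct vertices $v,w$ being adjacent if there is an $A\in\mathcal E$ with $A\in v$, $A^*\in w$ or $A\in w$, $A^*\in v$. 1. $T$ is a tree, and $G$ acts on $T$ by automorphisms via $gv=\{gA: A\in v\}$. 2. The oriented edges of $T$ are in bijection with the elements of $\mathcal E$, with $A\in\mathcal E$ corresponding to an oriented edge from a vertex containing $A$ to a vertex containing $A^*$. For each $A\in\mathcal E$ we have $A\cup A^*=X$, and $A\cap A^*$ has no edges and exactly one or two vertices. 3. For a vertex $v$ of $T$ let $Z_v$ be the graph obtained from $\bigcap_{A\in v}A^*$ (which means $X$ if $v=\emptyset$) by joining, for each $A\in v$ such that $\delta A$ has two elements, these two vertices by an edge if they are not already joined. The stabilizer $G_v$ of $v$ acts on $Z_v$ by restriction, and one of the following holds: (a) there is a cut-point $c$ of $X$ such that $\delta A=\{c\}$ for all $A\in v$, and $c$ is the only vertex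 of $\bigcap_{A\in v}A^*$; (b) $Z_v$ is a finite cycle, of length at least $3$; (c) $Z_v$ is 3-connected, some subdivision of $Z_v$ is isomorphic to a subgraph of $X$, and $Z_v$ is planar if $X$ is planar. Here a graph is *3-connected* if it has at least two vertices and removing at most two vertices never disconnects it (so complete graphs on 2, 3 or 4 vertices are 3-connected). A graph is *planar* if it can be drawn in the plane, its vertices being distinct points and its edges simple arcs, so that an arc contains no vertices but its ends and two distinct arcs meet only in vertices. -/

import Mathlib

namespace TutteTree

/-- The set of vertices of a subgraph `A` of `X` that are incident with an edge of `X` which is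
not in `A`; this is the boundary of `A`, and its hinge if it has two elements. -/
def hinge {V : Type*} {X : SimpleGraph V} (A : X.Subgraph) : Set V :=
  {w | w ∈ A.verts ∧ ∃ z, X.Adj w z ∧ ¬ A.Adj w z}

/-- The opposite subgraph `A*`: its vertices are the vertices outside `A` and those in the boundary
of `A`, its edges are the edges of `X` that are not in `A`. -/
def opp {V : Type*} {X : SimpleGraph V} (A : X.Subgraph) : X.Subgraph where
  verts := A.vertsᶜ ∪ hinge A
  Adj x y := X.Adj x y ∧ ¬ A.Adj x y
  adj_sub h := h.1
  edge_vert := by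
    intro x y h
    by_cases hx : x ∈ A.verts
    · exact Or.inr ⟨hx, y, h⟩
    · exact Or.inl hx
  symm := ⟨fun x y h => ⟨h.1.symm, fun h2 => h.2 h2.symm⟩⟩

/-- Subgraphs with a single boundary vertex, some but not all of whose edges lie in `A`. -/
def IsOneSeparation {V : Type*} {X : SimpleGraph V} (A : X.Subgraph) : Prop :=
  ∃ u, hinge A = {u} ∧ ∃ z, A.Adj u z

/-- Subgraphs with exactly two boundary vertices, such that some but not all of the edges at each of
these lie in `A`; moreover `A` is not a single edge, nor `X` with a single edge removed. -/
def IsTwoSeparation {V : Type*} {X : SimpleGraph V} (A : X.Subgraph) : Prop :=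
  (∃ u v, u ≠ v ∧ hinge A = {u, v} ∧ (∃ z, A.Adj u z) ∧ (∃ z, A.Adj v z)) ∧
  ∀ a b (h : X.Adj a b),
    A ≠ X.subgraphOfAdj h ∧ A ≠ (⊤ : X.Subgraph).deleteEdges {s(a, b)}

/-- The set of all 1-separations and 2-separations of `X`. -/
def separations {V : Type*} (X : SimpleGraph V) : Set X.Subgraph :=
  {A | IsOneSeparation A ∨ IsTwoSeparation A}

/-- The translate `gA` of a subgraph `A` by an automorphism `g`. -/
def translate {V : Type*} {X : SimpleGraph V} (g : X ≃g X) (A : X.Subgraph) : X.Subgraph :=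
  A.map g.toHom

/-- `X` is finite modulo its automorphism group: finitely many orbits of vertices. For a locally
finite graph there are then also only finitely many orbits of edges. -/
def IsAutFinite {V : Type*} (X : SimpleGraph V) : Prop :=
  ∃ F : Set V, F.Finite ∧ ∀ v, ∃ w ∈ F, ∃ g : X ≃g X, g w = v

/-- The vertex `c` is a cut-point of `X`: its removal disconnects the graph. -/
def IsCutPoint {V : Type*} (X : SimpleGraph V) (c : V) : Prop :=
  ¬ (X.induce ({c}ᶜ : Set V)).Preconnected

/-- `A` and `B`, regarded as oriented edges, have the same initial vertex: `A = B`, or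
`A ⊂ B*` and no element of the family lies strictly between. -/
def SameOrigin {V : Type*} {X : SimpleGraph V} (E : Set X.Subgraph) (A B : X.Subgraph) : Prop :=
  A = B ∨ (A < opp B ∧ ∀ C ∈ E, ¬ (A < C ∧ C < opp B))

/-- The vertices of the structure tree of a family `E` are the classes of `SameOrigin`, each vertex
being identified with the set of oriented edges that start there. If `E` is empty, then
the tree has a single vertex, at which no edge starts. -/
def IsNode {V : Type*} {X : SimpleGraph V} (E v : Set X.Subgraph) : Prop :=
  (E = ∅ ∧ v = ∅) ∨ ∃ A ∈ E, v = {B | B ∈ E ∧ SameOrigin E A B}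

/-- The type of vertices of the structure tree. -/
abbrev Node {V : Type*} {X : SimpleGraph V} (E : Set X.Subgraph) : Type _ :=
  {v : Set X.Subgraph // IsNode E v}

/-- The structure tree `T(E)`: the oriented edge `A` goes from the class of `A` to the class
of `A*`. -/
def structureTree {V : Type*} {X : SimpleGraph V} (E : Set X.Subgraph) :
    SimpleGraph (Node E) :=
  SimpleGraph.fromRel fun v w => ∃ A ∈ v.1, opp A ∈ w.1

/-- The intersection of the subgraphs `A*`, for `A` in `v` (all of `X` if `v` is empty). -/
def core {V : Type*} {X : SimpleGraph V} (v : Set X.Subgraph) : X.Subgraph :=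
  sInf (opp '' v)

/-- The graph associated with `v`: the intersection of the `A*`, for `A` in `v`, together with a
virtual edge joining the two vertices of the hinge of `A`, for each `A` in `v` whose boundary has
two elements (no new edge if these vertices are already joined). -/
def vertexGraph {V : Type*} {X : SimpleGraph V} (v : Set X.Subgraph) :
    SimpleGraph (core v).verts :=
  (core v).coe ⊔ SimpleGraph.fromRel fun a b => ∃ A ∈ v, hinge A = {(a : V), (b : V)}

/-- `v` corresponds to the cut-point `c`: all edges at `v` have boundary `{c}`, and the
intersection of the subgraphs `A*`, for `A` in `v`, has `c` as its only vertex. -/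
def IsCutPointNode {V : Type*} {X : SimpleGraph V} (v : Set X.Subgraph) (c : V) : Prop :=
  IsCutPoint X c ∧ (∀ A ∈ v, hinge A = {c}) ∧ (core v).verts = {c}

/-- A finite cycle, of length at least three. -/
def IsCycleGraph {W : Type*} (Z : SimpleGraph W) : Prop :=
  ∃ n, 3 ≤ n ∧ Nonempty (Z ≃g SimpleGraph.cycleGraph n)

/-- 3-connected: at least two vertices, and removing at most two vertices never disconnects the
graph. A graph on two, three or four vertices is 3-connected in this sense if and only if
it is complete. -/
def IsThreeConnected {W : Type*} (Z : SimpleGraph W) : Prop :=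
  Nontrivial W ∧ ∀ S : Set W, S.encard ≤ 2 → (Z.induce Sᶜ).Preconnected

/-- Some subgraph of `X` is (isomorphic to) a subdivision of `Z`: vertices of `Z` are represented by
distinct vertices of `X`, and edges of `Z` by paths of `X` joining the representatives of their ends
that pass through no other representative and meet each other only in representatives. -/
def HasSubdivisionIn {W V : Type*} (Z : SimpleGraph W) (X : SimpleGraph V) : Prop :=
  ∃ (f : W → V) (p : ∀ a b, Z.Adj a b → X.Walk (f a) (f b)),
    Function.Injective f ∧
    (∀ a b h, (p a b h).IsPath) ∧
    (∀ a b (h : Z.Adj a b), p b a h.symm = (p a b h).reverse) ∧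
    (∀ a b h c, f c ∈ (p a b h).support → c = a ∨ c = b) ∧
    (∀ a b h c d h', s(a, b) ≠ s(c, d) →
      ∀ x, x ∈ (p a b h).support → x ∈ (p c d h').support → x ∈ Set.range f)

/-- Planar: the graph can be drawn in the plane with distinct points as vertices and simple arcs as
edges, so that an arc contains no vertices except its ends, and distinct arcs meet only in
vertices. -/
def IsPlanar {W : Type*} (Z : SimpleGraph W) : Prop :=
  ∃ (pt : W → EuclideanSpace ℝ (Fin 2)) (arc : Sym2 W → Set (EuclideanSpace ℝ (Fin 2))),
    Function.Injective pt ∧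
    (∀ a b, Z.Adj a b → ∃ γ : Path (pt a) (pt b),
      Function.Injective γ ∧ Set.range γ = arc s(a, b)) ∧
    (∀ e ∈ Z.edgeSet, ∀ w, pt w ∈ arc e → w ∈ e) ∧
    (∀ e ∈ Z.edgeSet, ∀ e' ∈ Z.edgeSet, e ≠ e' → arc e ∩ arc e' ⊆ Set.range pt)

end TutteTree

/-! A subgraph without isolated vertices is determined by its edges, so separations are handled as
sets of edges: `opp` becomes complementation, and the boundary of a set consists of the vertices
that meet both sides. A nested family that is closed under complementation and has finite intervals
is the set of oriented edges of a tree; this is the content of `IsTreeSet`. What remains is to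
choose such a family canonically, so that it is invariant, and richly enough, so that the pieces
left at the nodes cannot be cut further except when they are cycles.

Crossed separations are discarded. The family contains the sets with one boundary vertex that no
other such set crosses. It also contains, for each block `Y`, extensions to `X` of the nontrivial
subsets with two boundary vertices that no other such subset of `Y` crosses. To extend `F ⊆ Y` one
must decide where the rest of `X`, which hangs on `Y` at single vertices, is to go. Only at the two
boundary vertices is there a choice. There the hanging part goes to the side that contains more
uncrossed sets with that vertex in their boundary. In case of a tie both answers are equally
canonical, so the extension taking all ties and the one taking none are both kept; complementation
interchanges the two kinds. A strictly larger `F` wins every vertex where the smaller one wins or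
ties (`notLight_subset_heavy`), hence the extensions are nested (`fam_nested`). Local finiteness
leaves finitely many members at each vertex, whence finite intervals and finitely many orbits.

At a node, the members that start there are disjoint, and every member of the family has the torso
`Z` on one side, up to its boundary. If `Z` has at least two vertices, it lies in one block and no
single vertex separates it. A separation of `Z` by two vertices `u`, `v` lifts to a subset of the
block with boundary `{u, v}`, which must be crossed, since otherwise the family would already
separate the torso. In a two-connected set two crossing sets either have the same boundary or
separate each other's boundary vertices (`TwoConn.cases`). In the first case the bridges at `{u, v}`
are uncrossed, and one of them gives a forbidden member. So every separation of order two of `Z` is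
crossed by another one, and this forces `Z` to be a cycle (`isCycleGraph_of_isSep`). If no such
separation exists, `Z` is 3-connected.

Each virtual edge can be replaced by a path inside a member of the family that carries it. These
members are disjoint, so `X` contains a subdivision of `Z`, and a drawing of `X` yields one of `Z`.
-/

namespace TutteTree
-- Sets of edges, their boundaries, and the subgraphs they form
section EdgeSets
variable {V : Type*} {X : SimpleGraph V}

/-- The vertices incident with an edge in `F`. -/
def vset (F : Set (Sym2 V)) : Set V := {x | ∃ e ∈ F, x ∈ e}

/-- The boundary of the set of edges `F`, relative to the set of edges `Y`. -/
def bd (Y F : Set (Sym2 V)) : Set V := vset F ∩ vset (Y \ F)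

/-- The subgraph formed by a set of edges. -/
def ofEdges (X : SimpleGraph V) (F : Set (Sym2 V)) : X.Subgraph where
  verts := {x | ∃ y, X.Adj x y ∧ s(x, y) ∈ F}
  Adj x y := X.Adj x y ∧ s(x, y) ∈ F
  adj_sub h := h.1
  edge_vert h := ⟨_, h⟩
  symm := ⟨fun x y h => ⟨h.1.symm, by rw [Sym2.eq_swap]; exact h.2⟩⟩

theorem vset_mono {F F' : Set (Sym2 V)} (h : F ⊆ F') : vset F ⊆ vset F' :=
  fun _ ⟨e, he, hx⟩ => ⟨e, h he, hx⟩

theorem vset_union {F F' : Set (Sym2 V)} : vset (F ∪ F') = vset F ∪ vset F' := by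
  ext x
  simp only [vset, Set.mem_ofPred_eq, Set.mem_union]
  constructor
  · rintro ⟨e, h | h, hx⟩
    · exact Or.inl ⟨e, h, hx⟩
    · exact Or.inr ⟨e, h, hx⟩
  · rintro (⟨e, h, hx⟩ | ⟨e, h, hx⟩)
    · exact ⟨e, Or.inl h, hx⟩
    · exact ⟨e, Or.inr h, hx⟩

theorem mem_vset_of_adj {F : Set (Sym2 V)} {x y : V} (h : s(x, y) ∈ F) : x ∈ vset F :=
  ⟨_, h, by simp⟩

theorem mem_vset_iff {F : Set (Sym2 V)} {x : V} : x ∈ vset F ↔ ∃ y, s(x, y) ∈ F := by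
  constructor
  · rintro ⟨e, he, hx⟩
    obtain ⟨y, rfl⟩ := Sym2.mem_iff_exists.1 hx
    exact ⟨y, he⟩
  · rintro ⟨y, hy⟩
    exact mem_vset_of_adj hy

theorem sdiff_sdiff_of_subset {Y F : Set (Sym2 V)} (h : F ⊆ Y) : Y \ (Y \ F) = F := by
  rw [Set.sdiff_sdiff_cancel_left h]

theorem bd_sdiff {Y F : Set (Sym2 V)} (h : F ⊆ Y) : bd Y (Y \ F) = bd Y F := by
  rw [bd, bd, sdiff_sdiff_of_subset h, Set.inter_comm]

theorem vset_nonempty {F : Set (Sym2 V)} (h : F.Nonempty) : (vset F).Nonempty := by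
  obtain ⟨e, he⟩ := h
  induction e with
  | h x y => exact ⟨x, mem_vset_of_adj he⟩

/-- A vertex off the boundary sees only one side. Most arguments below propagate membership along
walks by this local rule. -/
theorem mem_bd_or {Y F : Set (Sym2 V)} {x : V} (h : x ∈ vset F) (h' : x ∉ bd Y F)
    {e : Sym2 V} (he : e ∈ Y) (hx : x ∈ e) : e ∈ F := by
  by_contra hF
  exact h' ⟨h, e, ⟨he, hF⟩, hx⟩

variable {F F' : Set (Sym2 V)}

theorem ofEdges_verts (hF : F ⊆ X.edgeSet) : (ofEdges X F).verts = vset F := by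
  ext x
  rw [mem_vset_iff]
  exact ⟨fun ⟨y, h⟩ => ⟨y, h.2⟩, fun ⟨y, h⟩ => ⟨y, hF h, h⟩⟩

theorem ofEdges_adj (hF : F ⊆ X.edgeSet) {x y : V} : (ofEdges X F).Adj x y ↔ s(x, y) ∈ F :=
  ⟨fun h => h.2, fun h => ⟨hF h, h⟩⟩

theorem ofEdges_edgeSet (hF : F ⊆ X.edgeSet) : (ofEdges X F).edgeSet = F := by
  ext e
  induction e with
  | h x y => rw [SimpleGraph.Subgraph.mem_edgeSet, ofEdges_adj hF]

theorem ofEdges_le (hF : F ⊆ X.edgeSet) (hF' : F' ⊆ X.edgeSet) :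
    ofEdges X F ≤ ofEdges X F' ↔ F ⊆ F' := by
  constructor
  · intro h e
    induction e with
    | h x y => exact fun he => ((ofEdges_adj hF').1 (h.2 ((ofEdges_adj hF).2 he)))
  · intro h
    refine ⟨?_, fun x y hxy => ⟨hxy.1, h hxy.2⟩⟩
    rw [ofEdges_verts hF, ofEdges_verts hF']
    exact vset_mono h

theorem ofEdges_injOn : Set.InjOn (ofEdges X) {F | F ⊆ X.edgeSet} := by
  intro F hF F' hF' h
  rw [← ofEdges_edgeSet hF, h, ofEdges_edgeSet hF']

theorem hinge_ofEdges (hF : F ⊆ X.edgeSet) : hinge (ofEdges X F) = bd X.edgeSet F := by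
  ext x
  rw [bd, Set.mem_inter_iff, mem_vset_iff (F := X.edgeSet \ F), hinge, Set.mem_ofPred_eq,
    ofEdges_verts hF]
  refine and_congr_right fun _ => exists_congr fun z => ?_
  rw [ofEdges_adj hF]
  rfl

/-- An isolated vertex of `X` would belong to the opposite subgraph without meeting any edge, hence
the hypothesis that edges cover all vertices. -/
theorem opp_ofEdges (hX : vset X.edgeSet = Set.univ) (hF : F ⊆ X.edgeSet) :
    opp (ofEdges X F) = ofEdges X (X.edgeSet \ F) := by
  have h : X.edgeSet \ F ⊆ X.edgeSet := Set.sdiff_subset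
  ext x y
  · rw [ofEdges_verts h]
    change (x ∈ (ofEdges X F).vertsᶜ ∪ hinge (ofEdges X F)) ↔ _
    rw [hinge_ofEdges hF, ofEdges_verts hF]
    constructor
    · rintro (h1 | h1)
      · have : x ∈ vset X.edgeSet := hX ▸ Set.mem_univ x
        obtain ⟨e, he, hx⟩ := this
        exact ⟨e, ⟨he, fun h2 => h1 ⟨e, h2, hx⟩⟩, hx⟩
      · exact h1.2
    · intro h1
      by_cases h2 : x ∈ vset F
      · exact Or.inr ⟨h2, h1⟩
      · exact Or.inl h2
  · rw [ofEdges_adj h]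
    change X.Adj x y ∧ ¬ (ofEdges X F).Adj x y ↔ _
    rw [ofEdges_adj hF]
    rfl

theorem translate_ofEdges (g : X ≃g X) (hF : F ⊆ X.edgeSet) :
    translate g (ofEdges X F) = ofEdges X (Sym2.map g '' F) := by
  have h : Sym2.map g '' F ⊆ X.edgeSet := by
    rintro _ ⟨e, he, rfl⟩
    have := hF he
    induction e with
    | h x y => exact g.map_adj_iff.2 this
  ext x y
  · rw [ofEdges_verts h, translate, SimpleGraph.Subgraph.map_verts, ofEdges_verts hF]
    constructor
    · rintro ⟨z, ⟨e, he, hz⟩, rfl⟩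
      exact ⟨_, ⟨e, he, rfl⟩, Sym2.mem_map.2 ⟨z, hz, rfl⟩⟩
    · rintro ⟨_, ⟨e, he, rfl⟩, hx⟩
      obtain ⟨z, hz, rfl⟩ := Sym2.mem_map.1 hx
      exact ⟨z, ⟨e, he, hz⟩, rfl⟩
  · rw [ofEdges_adj h, translate, SimpleGraph.Subgraph.map_adj]
    constructor
    · rintro ⟨a, b, hab, rfl, rfl⟩
      exact ⟨s(a, b), hab.2, by simp⟩
    · rintro ⟨e, he, h2⟩
      induction e with
      | h a b =>
        rw [Sym2.map_mk, Sym2.eq_iff] at h2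
        rcases h2 with ⟨rfl, rfl⟩ | ⟨rfl, rfl⟩
        · exact ⟨a, b, ⟨hF he, he⟩, rfl, rfl⟩
        · exact ⟨b, a, ⟨(hF he).symm, by rwa [Sym2.eq_swap]⟩, rfl, rfl⟩

theorem vset_edgeSet [Nontrivial V] (hX : X.Connected) : vset X.edgeSet = Set.univ := by
  refine Set.eq_univ_of_forall fun x => mem_vset_iff.2 ?_
  obtain ⟨y, hy⟩ := exists_ne x
  obtain ⟨p⟩ := hX.preconnected x y
  cases p with
  | nil => exact absurd rfl hy
  | cons h _ => exact ⟨_, h⟩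

/-- A walk starting in `F` that avoids the boundary of `F` stays in `F`. -/
theorem mem_vset_of_walk {x y : V} (p : X.Walk x y) (hx : x ∈ vset F)
    (hp : ∀ z ∈ p.support, z ≠ y → z ∉ bd X.edgeSet F) : y ∈ vset F := by
  induction p with
  | nil => exact hx
  | @cons a b c hab p ih =>
    -- The last vertex may lie on the boundary, so nothing is known about a vertex equal to it; but
    -- then there is nothing left to prove.
    by_cases hac : a = c
    · exact hac ▸ hx
    · have h1 := mem_bd_or hx (hp a (by simp) hac) (e := s(a, b)) hab (by simp)
      exact ih ⟨_, h1, by simp⟩ fun z hz => hp z (by simp [hz])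

theorem bd_nonempty (hX : X.Connected) (h1 : F.Nonempty)
    (h2 : (X.edgeSet \ F).Nonempty) : (bd X.edgeSet F).Nonempty := by
  obtain ⟨x, hx⟩ := vset_nonempty h1
  obtain ⟨y, hy⟩ := vset_nonempty h2
  obtain ⟨p⟩ := hX.preconnected x y
  by_contra h
  rw [Set.not_nonempty_iff_eq_empty] at h
  have := mem_vset_of_walk p hx (by simp [h])
  exact (h ▸ (⟨this, hy⟩ : y ∈ bd X.edgeSet F) : y ∈ (∅ : Set V))

end EdgeSets
end TutteTree

/-! ### The tree of a nested family with finite intervals -/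

namespace TutteTree

/-- A nested family of subgraphs with an order-reversing involution `opp` and finite intervals. -/
structure IsTreeSet {V : Type*} {X : SimpleGraph V} (E : Set X.Subgraph) : Prop where
  opp_mem : ∀ {A}, A ∈ E → opp A ∈ E
  opp_opp : ∀ {A}, A ∈ E → opp (opp A) = A
  anti : ∀ {A B}, A ∈ E → B ∈ E → A ≤ B → opp B ≤ opp A
  nested : ∀ {A B}, A ∈ E → B ∈ E → A ≤ B ∨ A ≤ opp B ∨ opp A ≤ B ∨ opp A ≤ opp B
  not_le_opp : ∀ {A B}, A ∈ E → B ∈ E → A ≤ B → ¬ A ≤ opp B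
  finite_interval : ∀ {A B}, A ∈ E → B ∈ E → A ≤ B → {C | C ∈ E ∧ A ≤ C ∧ C ≤ B}.Finite

namespace IsTreeSet

variable {V : Type*} {X : SimpleGraph V} {E : Set X.Subgraph} {A B C D : X.Subgraph}

theorem le_opp_comm (h : IsTreeSet E) (hA : A ∈ E) (hB : B ∈ E) (hAB : A ≤ opp B) :
    B ≤ opp A := by
  simpa [h.opp_opp hB] using h.anti hA (h.opp_mem hB) hAB

theorem opp_le_comm (h : IsTreeSet E) (hA : A ∈ E) (hB : B ∈ E) (hAB : opp A ≤ B) :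
    opp B ≤ A := by
  simpa [h.opp_opp hA] using h.anti (h.opp_mem hA) hB hAB

theorem lt_opp_comm (h : IsTreeSet E) (hA : A ∈ E) (hB : B ∈ E) (hAB : A < opp B) :
    B < opp A := by
  refine lt_of_le_of_ne (h.le_opp_comm hA hB hAB.le) ?_
  rintro rfl
  rw [h.opp_opp hA] at hAB
  exact lt_irrefl _ hAB

theorem opp_lt_comm (h : IsTreeSet E) (hA : A ∈ E) (hB : B ∈ E) (hAB : opp A < B) :
    opp B < A := by
  refine lt_of_le_of_ne (h.opp_le_comm hA hB hAB.le) ?_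
  rintro rfl
  rw [h.opp_opp hB] at hAB
  exact lt_irrefl _ hAB

theorem ne_opp (h : IsTreeSet E) (hA : A ∈ E) : A ≠ opp A := fun he =>
  h.not_le_opp hA hA le_rfl he.le

theorem not_le_of_sameOrigin (h : IsTreeSet E) (hA : A ∈ E) (hB : B ∈ E)
    (hAB : SameOrigin E A B) (hle : A ≤ B) : A = B := by
  rcases hAB with hAB | ⟨hAB, -⟩
  · exact hAB
  · exact absurd hAB.le (h.not_le_opp hA hB hle)

theorem sameOrigin_symm (h : IsTreeSet E) (hA : A ∈ E) (hB : B ∈ E)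
    (hAB : SameOrigin E A B) : SameOrigin E B A := by
  rcases hAB with rfl | ⟨hlt, hno⟩
  · exact Or.inl rfl
  · refine Or.inr ⟨h.lt_opp_comm hA hB hlt, fun C hC hBC => hno (opp C) (h.opp_mem hC) ⟨?_, ?_⟩⟩
    · exact h.lt_opp_comm hC hA hBC.2
    · have := h.opp_mem hC
      refine h.lt_opp_comm hB this ?_
      rw [h.opp_opp hC]
      exact hBC.1

/-- Of the four ways in which `A` and `C` can be nested, three contradict that nothing lies between
`A` and `opp B` or between `B` and `opp C`, or that no element lies below both another element and
its opposite. An element strictly between `A` and `opp C` is excluded in the same way by comparing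
it with `B`. -/
theorem sameOrigin_trans (h : IsTreeSet E) (hA : A ∈ E) (hB : B ∈ E) (hC : C ∈ E)
    (hAB : SameOrigin E A B) (hBC : SameOrigin E B C) : SameOrigin E A C := by
  have hCB := h.sameOrigin_symm hB hC hBC
  have hBA := h.sameOrigin_symm hA hB hAB
  by_cases hAC : A = C
  · exact Or.inl hAC
  rcases hAB with rfl | ⟨h1, n1⟩
  · exact hBC
  rcases hBC with rfl | ⟨h2, n2⟩
  · exact Or.inr ⟨h1, n1⟩
  rcases hBA with rfl | ⟨h1', n1'⟩
  · exact absurd h1.le (h.not_le_opp hA hA le_rfl)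
  rcases hCB with rfl | ⟨h2', n2'⟩
  · exact absurd h2.le (h.not_le_opp hB hB le_rfl)
  have hle : A ≤ opp C := by
    rcases h.nested hA hC with h3 | h3 | h3 | h3
    · exact absurd ⟨lt_of_le_of_ne h3 hAC, h2'⟩ (n1 C hC)
    · exact h3
    · have h4 := h.opp_le_comm hA hC h3
      have h5 : B < A := h2.trans_le h4
      exact absurd h1'.le (h.not_le_opp hB hA h5.le)
    · have h4 : C ≤ A := by
        have := h.anti (h.opp_mem hA) (h.opp_mem hC) h3
        rwa [h.opp_opp hA, h.opp_opp hC] at this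
      exact absurd ⟨lt_of_le_of_ne h4 (Ne.symm hAC), h1⟩ (n2' A hA)
  refine Or.inr ⟨lt_of_le_of_ne hle ?_, ?_⟩
  · rintro rfl
    exact h.not_le_opp hB (h.opp_mem hC) h2.le h1'.le
  · rintro D hD ⟨hAD, hDC⟩
    rcases h.nested hD hB with h3 | h3 | h3 | h3
    · exact h.not_le_opp hA hB (hAD.le.trans h3) h1.le
    · have h4 : D = opp B := by
        by_contra hne
        exact n1 D hD ⟨hAD, lt_of_le_of_ne h3 hne⟩
      subst h4
      have h5 := h.opp_lt_comm hB (h.opp_mem hC) hDC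
      rw [h.opp_opp hC] at h5
      exact h.not_le_opp hC hB h5.le h2'.le
    · have h4 := h.opp_le_comm hD hB h3
      have h5 := h.opp_lt_comm hB (h.opp_mem hC) (h4.trans_lt hDC)
      rw [h.opp_opp hC] at h5
      exact h.not_le_opp hC hB h5.le h2'.le
    · have h4 : B ≤ D := by
        have := h.anti (h.opp_mem hD) (h.opp_mem hB) h3
        rwa [h.opp_opp hD, h.opp_opp hB] at this
      have h5 : B = D := by
        by_contra hne
        exact n2 D hD ⟨lt_of_le_of_ne h4 hne, hDC⟩
      subst h5
      exact h.not_le_opp hA hB hAD.le h1.le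

/-- The class of `A`. -/
def cls (E : Set X.Subgraph) (A : X.Subgraph) : Set X.Subgraph := {B | B ∈ E ∧ SameOrigin E A B}

theorem mem_cls (hA : A ∈ E) : A ∈ cls E A := ⟨hA, Or.inl rfl⟩

theorem cls_eq (h : IsTreeSet E) (hA : A ∈ E) (hB : B ∈ cls E A) : cls E B = cls E A := by
  ext C
  constructor
  · rintro ⟨hC, h2⟩
    exact ⟨hC, h.sameOrigin_trans hA hB.1 hC hB.2 h2⟩
  · rintro ⟨hC, h2⟩
    exact ⟨hC, h.sameOrigin_trans hB.1 hA hC (h.sameOrigin_symm hA hB.1 hB.2) h2⟩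

theorem subset_of_isNode {v : Set X.Subgraph} (hv : IsNode E v) : v ⊆ E := by
  rcases hv with ⟨-, rfl⟩ | ⟨A, hA, rfl⟩
  · simp
  · exact fun B hB => hB.1

theorem eq_cls (h : IsTreeSet E) {v : Set X.Subgraph} (hv : IsNode E v) (hA : A ∈ v) :
    v = cls E A := by
  rcases hv with ⟨-, rfl⟩ | ⟨B, hB, rfl⟩
  · simp at hA
  · exact (h.cls_eq hB hA).symm

/-- The node at which `A` starts. -/
def node (hA : A ∈ E) : Node E := ⟨cls E A, Or.inr ⟨A, hA, rfl⟩⟩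

theorem eq_node (h : IsTreeSet E) (v : Node E) (hA : A ∈ v.1) :
    v = node (subset_of_isNode v.2 hA) := Subtype.ext (h.eq_cls v.2 hA)

theorem opp_notMem_cls (h : IsTreeSet E) (hA : A ∈ E) : opp A ∉ cls E A := by
  rintro ⟨h1, h2⟩
  have := h.not_le_of_sameOrigin hA h1 h2
  rcases h2 with h2 | ⟨h2, -⟩
  · exact h.ne_opp hA h2
  · rw [h.opp_opp hA] at h2
    exact lt_irrefl _ h2

theorem adj_node (h : IsTreeSet E) (hA : A ∈ E) :
    (structureTree E).Adj (node hA) (node (h.opp_mem hA)) := by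
  refine ⟨fun he => ?_, Or.inl ⟨A, mem_cls hA, mem_cls (h.opp_mem hA)⟩⟩
  have : opp A ∈ cls E A := by
    rw [show cls E A = cls E (opp A) from congrArg Subtype.val he]
    exact mem_cls (h.opp_mem hA)
  exact h.opp_notMem_cls hA this

theorem exists_of_adj (h : IsTreeSet E) {v w : Node E} (hvw : (structureTree E).Adj v w) :
    ∃ A, A ∈ E ∧ A ∈ v.1 ∧ opp A ∈ w.1 := by
  obtain ⟨-, ⟨A, h1, h2⟩ | ⟨A, h1, h2⟩⟩ := hvw
  · exact ⟨A, subset_of_isNode v.2 h1, h1, h2⟩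
  · have hA := subset_of_isNode w.2 h1
    exact ⟨opp A, h.opp_mem hA, h2, by rwa [h.opp_opp hA]⟩

/-- The tree has no parallel edges: two of them would satisfy both `A < opp B` and `opp B < A`. -/
theorem eq_of_mem_cls (h : IsTreeSet E) (hA : A ∈ E) (hB : B ∈ E) (h1 : B ∈ cls E A)
    (h2 : opp B ∈ cls E (opp A)) : A = B := by
  rcases h1.2 with h3 | ⟨h3, -⟩
  · exact h3
  rcases h2.2 with h4 | ⟨h4, -⟩
  · rw [← h.opp_opp hA, h4, h.opp_opp hB]
  · rw [h.opp_opp hB] at h4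
    have := h.opp_lt_comm hA hB h4
    exact absurd (h3.trans this) (lt_irrefl _)

theorem exists_cover (h : IsTreeSet E) (hA : A ∈ E) (hB : B ∈ E) (hAB : A < B) :
    ∃ C ∈ E, A < C ∧ C ≤ B ∧ ∀ D ∈ E, ¬ (A < D ∧ D < C) := by
  have hf : {C | C ∈ E ∧ A < C ∧ C ≤ B}.Finite :=
    (h.finite_interval hA hB hAB.le).subset fun C hC => ⟨hC.1, hC.2.1.le, hC.2.2⟩
  obtain ⟨C, hC⟩ := hf.exists_minimal ⟨B, hB, hAB, le_rfl⟩
  refine ⟨C, hC.1.1, hC.1.2.1, hC.1.2.2, fun D hD hlt => ?_⟩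
  exact hlt.2.not_ge (hC.2 ⟨hD, hlt.1, hlt.2.le.trans hC.1.2.2⟩ hlt.2.le)

/-- If `B` covers `A`, then the oriented edge `B` ends where `A` starts. So the order decreases
along directed paths of the tree. -/
theorem opp_mem_cls_of_cover (h : IsTreeSet E) (hB : B ∈ E) (hAB : A < B)
    (hno : ∀ D ∈ E, ¬ (A < D ∧ D < B)) : opp B ∈ cls E A :=
  ⟨h.opp_mem hB, Or.inr ⟨by rwa [h.opp_opp hB], by rwa [h.opp_opp hB]⟩⟩

/-- Every edge points towards or away from every node. -/
theorem position (h : IsTreeSet E) {v : Set X.Subgraph} (hv : IsNode E v) (hB : B ∈ E) :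
    ∃ A ∈ v, B ≤ A ∨ opp B ≤ A := by
  obtain ⟨rfl, -⟩ | ⟨D, hD, rfl⟩ := hv
  · simp at hB
  change ∃ A ∈ cls E D, _
  -- After replacing `B` or swapping it with its opposite one may assume `D ≤ B`. If `C ≤ B` covers
  -- `D`, then `opp C` starts at the node and lies above `opp B`.
  have key : ∀ B ∈ E, D ≤ B → ∃ A ∈ cls E D, B ≤ A ∨ opp B ≤ A := by
    intro B hB hDB
    rcases hDB.eq_or_lt with rfl | hlt
    · exact ⟨D, mem_cls hD, Or.inl le_rfl⟩
    · obtain ⟨C, hC, h1, h2, h3⟩ := h.exists_cover hD hB hlt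
      exact ⟨opp C, h.opp_mem_cls_of_cover hC h1 h3, Or.inr (h.anti hC hB h2)⟩
  rcases h.nested hB hD with h1 | h1 | h1 | h1
  · exact ⟨D, mem_cls hD, Or.inl h1⟩
  · obtain ⟨A, hA, h2⟩ := key (opp B) (h.opp_mem hB) (h.le_opp_comm hB hD h1)
    rw [h.opp_opp hB] at h2
    exact ⟨A, hA, h2.symm⟩
  · exact ⟨D, mem_cls hD, Or.inr h1⟩
  · refine key B hB ?_
    have := h.anti (h.opp_mem hB) (h.opp_mem hD) h1
    rwa [h.opp_opp hB, h.opp_opp hD] at this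

theorem le_opp_of_mem_node (h : IsTreeSet E) {v : Set X.Subgraph} (hv : IsNode E v)
    (hA : A ∈ v) (hB : B ∈ v) (hne : A ≠ B) : A ≤ opp B := by
  rw [h.eq_cls hv hA] at hB
  rcases hB.2 with h1 | h1
  · exact absurd h1 hne
  · exact h1.1.le

/-- A cover of `A` below `B` is one step in the tree towards `B`, and it shrinks the finite interval
that remains. -/
theorem reachable_of_le (h : IsTreeSet E) (hB : B ∈ E) :
    ∀ A (hA : A ∈ E), A ≤ B → (structureTree E).Reachable (node hA) (node hB) := by
  suffices H : ∀ n A (hA : A ∈ E), A ≤ B → {C | C ∈ E ∧ A ≤ C ∧ C ≤ B}.ncard = n →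
      (structureTree E).Reachable (node hA) (node hB) from
    fun A hA hAB => H _ A hA hAB rfl
  intro n
  induction n using Nat.strong_induction_on with
  | _ n ih =>
    intro A hA hAB hn
    rcases hAB.eq_or_lt with rfl | hlt
    · exact .rfl
    obtain ⟨C, hC, h1, h2, h3⟩ := h.exists_cover hA hB hlt
    have h4 := h.opp_mem_cls_of_cover hC h1 h3
    have h5 : node hA = node (h.opp_mem hC) := h.eq_node (node hA) h4
    rw [h5]
    refine (h.adj_node hC).symm.reachable.trans (ih _ ?_ C hC h2 rfl)
    rw [← hn]
    refine Set.ncard_lt_ncard ?_ (h.finite_interval hA hB hAB)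
    refine ⟨fun D hD => ⟨hD.1, h1.le.trans hD.2.1, hD.2.2⟩, fun hsub => ?_⟩
    exact h1.not_ge (hsub ⟨hA, le_rfl, hAB⟩).2.1

theorem reachable_node (h : IsTreeSet E) (hA : A ∈ E) (hB : B ∈ E) :
    (structureTree E).Reachable (node hA) (node hB) := by
  have hoA := (h.adj_node hA).reachable
  have hoB := (h.adj_node hB).reachable
  rcases h.nested hA hB with h1 | h1 | h1 | h1
  · exact h.reachable_of_le hB A hA h1
  · exact (h.reachable_of_le (h.opp_mem hB) A hA h1).trans hoB.symm
  · exact hoA.trans (h.reachable_of_le hB _ (h.opp_mem hA) h1)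
  · exact hoA.trans ((h.reachable_of_le (h.opp_mem hB) _ (h.opp_mem hA) h1).trans hoB.symm)

theorem preconnected (h : IsTreeSet E) : (structureTree E).Preconnected := by
  rintro ⟨v, hv⟩ ⟨w, hw⟩
  rcases hv with ⟨h0, rfl⟩ | ⟨A, hA, rfl⟩
  · rcases hw with ⟨-, rfl⟩ | ⟨B, hB, rfl⟩
    · exact .rfl
    · simp [h0] at hB
  · rcases hw with ⟨h0, rfl⟩ | ⟨B, hB, rfl⟩
    · simp [h0] at hA
    · exact h.reachable_node hA hB

/-- This is the invariant for acyclicity: the property that some edge starting at the node lies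
above `A` is preserved when any oriented edge other than `A` is traversed. -/
theorem exists_le_opp_of_ne (h : IsTreeSet E) (hA : A ∈ E) (hD : D ∈ E) (h1 : D ≠ A)
    {B : X.Subgraph} (hB : B ∈ cls E D) (hAB : A ≤ B) : ∃ B' ∈ cls E (opp D), A ≤ B' := by
  rcases hB.2 with rfl | ⟨h2, -⟩
  · have hlt := lt_of_le_of_ne hAB (Ne.symm h1)
    have hlt' : opp D < opp A := by
      apply h.lt_opp_comm hA (h.opp_mem hD)
      rwa [h.opp_opp hD]
    obtain ⟨C, hC, h3, h4, h5⟩ := h.exists_cover (h.opp_mem hD) (h.opp_mem hA) hlt'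
    exact ⟨opp C, h.opp_mem_cls_of_cover hC h3 h5, h.le_opp_comm hC hA h4⟩
  · exact ⟨opp D, mem_cls (h.opp_mem hD), hAB.trans (h.lt_opp_comm hD hB.1 h2).le⟩

theorem isAcyclic (h : IsTreeSet E) : (structureTree E).IsAcyclic := by
  rw [SimpleGraph.isAcyclic_iff_forall_adj_isBridge]
  intro v w hvw
  rw [SimpleGraph.isBridge_iff]
  rintro ⟨p⟩
  obtain ⟨A, hA, hv, hw⟩ := h.exists_of_adj hvw
  -- The invariant holds at the origin of `A` and fails at its end, so every walk between them uses
  -- the edge `A`, which is therefore a bridge.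
  have key : ∀ {a b : Node E}
      (_ : ((structureTree E) \ SimpleGraph.fromEdgeSet {s(v, w)}).Walk a b),
      (∃ B ∈ a.1, A ≤ B) → ∃ B ∈ b.1, A ≤ B := by
    intro a b q
    induction q with
    | nil => exact id
    | @cons a b c hab q ih =>
      rintro ⟨B, hB, hAB⟩
      apply ih
      have hab' := SimpleGraph.sdiff_adj _ _ _ _ |>.1 hab
      obtain ⟨D, hD, h1, h2⟩ := h.exists_of_adj hab'.1
      have hne : D ≠ A := by
        rintro rfl
        apply hab'.2
        have e1 : a = v := (h.eq_node a h1).trans (h.eq_node v hv).symm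
        have e2 : b = w := (h.eq_node b h2).trans (h.eq_node w hw).symm
        subst e1 e2
        exact ⟨rfl, hab'.1.ne⟩
      rw [h.eq_cls b.2 h2]
      rw [h.eq_cls a.2 h1] at hB
      exact h.exists_le_opp_of_ne hA hD hne hB hAB
  obtain ⟨B, hB, hAB⟩ := key p ⟨A, hv, le_rfl⟩
  rw [h.eq_cls w.2 hw] at hB
  rcases hB.2 with rfl | ⟨h1, -⟩
  · exact h.not_le_opp hA hA le_rfl hAB
  · have := h.opp_lt_comm hA (h.opp_mem hB.1) h1
    rw [h.opp_opp hB.1] at this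
    exact this.not_ge hAB

theorem isTree (h : IsTreeSet E) : (structureTree E).IsTree := by
  have : Nonempty (Node E) := by
    rcases E.eq_empty_or_nonempty with h0 | ⟨A, hA⟩
    · exact ⟨⟨∅, Or.inl ⟨h0, rfl⟩⟩⟩
    · exact ⟨node hA⟩
  exact { preconnected := h.preconnected, nonempty := this, isAcyclic := h.isAcyclic }

theorem exists_equiv_dart (h : IsTreeSet E) : ∃ Φ : E ≃ (structureTree E).Dart,
    ∀ A : E, A.1 ∈ (Φ A).fst.1 ∧ opp A.1 ∈ (Φ A).snd.1 := by
  let f : E → (structureTree E).Dart := fun A => ⟨(node A.2, node (h.opp_mem A.2)), h.adj_node A.2⟩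
  have hf : Function.Bijective f := by
    constructor
    · intro A B hAB
      have h1 : cls E A.1 = cls E B.1 := congrArg (fun d => d.fst.1) hAB
      have h2 : cls E (opp A.1) = cls E (opp B.1) := congrArg (fun d => d.snd.1) hAB
      refine Subtype.ext (h.eq_of_mem_cls A.2 B.2 ?_ ?_)
      · rw [h1]; exact mem_cls B.2
      · rw [h2]; exact mem_cls (h.opp_mem B.2)
    · rintro ⟨⟨v, w⟩, hvw⟩
      obtain ⟨A, hA, hv, hw⟩ := h.exists_of_adj hvw
      refine ⟨⟨A, hA⟩, ?_⟩
      ext : 1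
      exact Prod.ext (h.eq_node v hv).symm (h.eq_node w hw).symm
  exact ⟨Equiv.ofBijective f hf, fun A => ⟨mem_cls A.2, mem_cls (h.opp_mem A.2)⟩⟩

end IsTreeSet
end TutteTree

/-! ### The action of the automorphism group on the tree and on the vertex graphs -/

namespace TutteTree
section Action
open SimpleGraph
variable {V : Type*} {X : SimpleGraph V} {E v : Set X.Subgraph} {A B : X.Subgraph}

theorem translate_one (A : X.Subgraph) : translate 1 A = A := by
  ext x y <;> simp [translate, Subgraph.map_adj, Relation.Map]

theorem translate_mul (g h : X ≃g X) (A : X.Subgraph) :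
    translate (g * h) A = translate g (translate h A) := by
  ext x y <;> simp [translate, Subgraph.map_adj, Relation.Map]

theorem translate_inv_translate (g : X ≃g X) (A : X.Subgraph) :
    translate g⁻¹ (translate g A) = A := by
  rw [← translate_mul, inv_mul_cancel, translate_one]

theorem translate_translate_inv (g : X ≃g X) (A : X.Subgraph) :
    translate g (translate g⁻¹ A) = A := by
  rw [← translate_mul, mul_inv_cancel, translate_one]

theorem translate_le (g : X ≃g X) : translate g A ≤ translate g B ↔ A ≤ B := by
  have h : ∀ (g : X ≃g X) {A B : X.Subgraph}, A ≤ B → translate g A ≤ translate g B :=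
    fun g _ _ h => Subgraph.map_mono h
  refine ⟨fun h' => ?_, h g⟩
  simpa only [translate_inv_translate] using h g⁻¹ h'

theorem translate_lt (g : X ≃g X) : translate g A < translate g B ↔ A < B := by
  simp only [lt_iff_le_not_ge, translate_le]

theorem mem_translate_verts {g : X ≃g X} {x : V} : g x ∈ (translate g A).verts ↔ x ∈ A.verts := by
  simp [translate]

theorem translate_adj {g : X ≃g X} {x y : V} : (translate g A).Adj (g x) (g y) ↔ A.Adj x y := by
  simp [translate, Subgraph.map_adj, Relation.Map]

theorem mem_hinge_translate {g : X ≃g X} {x : V} : g x ∈ hinge (translate g A) ↔ x ∈ hinge A := by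
  simp only [hinge, Set.mem_ofPred_eq, mem_translate_verts]
  refine and_congr_right fun _ => ⟨fun ⟨z, h1, h2⟩ => ?_, fun ⟨z, h1, h2⟩ => ?_⟩
  · obtain ⟨z, rfl⟩ := g.surjective z
    exact ⟨z, g.map_adj_iff.1 h1, fun h => h2 (translate_adj.2 h)⟩
  · exact ⟨g z, g.map_adj_iff.2 h1, fun h => h2 (translate_adj.1 h)⟩

theorem hinge_translate (g : X ≃g X) : hinge (translate g A) = g '' hinge A := by
  ext x
  obtain ⟨x, rfl⟩ := g.surjective x
  rw [mem_hinge_translate, g.injective.mem_set_image]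

theorem opp_translate (g : X ≃g X) : opp (translate g A) = translate g (opp A) := by
  ext x y
  · obtain ⟨x, rfl⟩ := g.surjective x
    rw [mem_translate_verts]
    simp only [opp, Set.mem_union, Set.mem_compl_iff, mem_translate_verts, mem_hinge_translate]
  · obtain ⟨x, rfl⟩ := g.surjective x
    obtain ⟨y, rfl⟩ := g.surjective y
    rw [translate_adj]
    simp only [opp, translate_adj, g.map_adj_iff]

theorem SameOrigin.translate (hE : ∀ g : X ≃g X, ∀ A ∈ E, translate g A ∈ E) (g : X ≃g X)
    (h : SameOrigin E A B) : SameOrigin E (translate g A) (translate g B) := by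
  rcases h with rfl | ⟨h1, h2⟩
  · exact Or.inl rfl
  · refine Or.inr ⟨by rwa [opp_translate, translate_lt], fun C hC h3 => ?_⟩
    rw [opp_translate, ← translate_translate_inv g C, translate_lt, translate_lt] at h3
    exact h2 _ (hE g⁻¹ C hC) h3

theorem IsNode.translate (hE : ∀ g : X ≃g X, ∀ A ∈ E, translate g A ∈ E) (g : X ≃g X)
    (h : IsNode E v) : IsNode E (translate g '' v) := by
  rcases h with ⟨h1, rfl⟩ | ⟨A, hA, rfl⟩
  · exact Or.inl ⟨h1, by simp⟩
  · refine Or.inr ⟨_, hE g A hA, ?_⟩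
    ext B
    constructor
    · rintro ⟨B, ⟨hB, h⟩, rfl⟩
      exact ⟨hE g B hB, h.translate hE g⟩
    · rintro ⟨hB, h⟩
      have := h.translate hE g⁻¹
      rw [translate_inv_translate] at this
      exact ⟨_, ⟨hE g⁻¹ B hB, this⟩, translate_translate_inv g B⟩

/-- The action of the automorphism group on the nodes. -/
def nodeMap (hE : ∀ g : X ≃g X, ∀ A ∈ E, translate g A ∈ E) (g : X ≃g X) (v : Node E) : Node E :=
  ⟨translate g '' v.1, v.2.translate hE g⟩

theorem nodeMap_one (hE : ∀ g : X ≃g X, ∀ A ∈ E, translate g A ∈ E) (v : Node E) :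
    nodeMap hE 1 v = v :=
  Subtype.ext (by simp [nodeMap, translate_one])

theorem nodeMap_mul (hE : ∀ g : X ≃g X, ∀ A ∈ E, translate g A ∈ E) (g h : X ≃g X) (v : Node E) :
    nodeMap hE (g * h) v = nodeMap hE g (nodeMap hE h v) :=
  Subtype.ext (by simp [nodeMap, translate_mul, Set.image_image])

theorem nodeMap_adj (hE : ∀ g : X ≃g X, ∀ A ∈ E, translate g A ∈ E) (g : X ≃g X) {v w : Node E}
    (h : (structureTree E).Adj v w) :
    (structureTree E).Adj (nodeMap hE g v) (nodeMap hE g w) := by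
  refine ⟨fun he => h.1 ?_, h.2.imp ?_ ?_⟩
  · rw [← nodeMap_one hE v, ← nodeMap_one hE w, ← inv_mul_cancel g, nodeMap_mul, he, nodeMap_mul]
  all_goals
    rintro ⟨A, h1, h2⟩
    exact ⟨translate g A, ⟨A, h1, rfl⟩, by rw [opp_translate]; exact ⟨_, h2, rfl⟩⟩

/-- The action of the automorphism group on the structure tree. -/
def nodeIso (hE : ∀ g : X ≃g X, ∀ A ∈ E, translate g A ∈ E) (g : X ≃g X) :
    structureTree E ≃g structureTree E where
  toFun := nodeMap hE g
  invFun := nodeMap hE g⁻¹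
  left_inv v := by rw [← nodeMap_mul, inv_mul_cancel, nodeMap_one]
  right_inv v := by rw [← nodeMap_mul, mul_inv_cancel, nodeMap_one]
  map_rel_iff' {v w} := by
    refine ⟨fun h => ?_, nodeMap_adj hE g⟩
    have := nodeMap_adj hE g⁻¹ h
    simpa [← nodeMap_mul, nodeMap_one] using this

theorem exists_monoidHom (hE : ∀ g : X ≃g X, ∀ A ∈ E, translate g A ∈ E) :
    ∃ ρ : (X ≃g X) →* (structureTree E ≃g structureTree E),
      ∀ g v, (ρ g v).1 = translate g '' v.1 :=
  ⟨{ toFun := nodeIso hE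
     map_one' := RelIso.ext fun v => nodeMap_one hE v
     map_mul' := fun g h => RelIso.ext fun v => nodeMap_mul hE g h v }, fun _ _ => rfl⟩

theorem mem_core {x : V} : x ∈ (core v).verts ↔ ∀ A ∈ v, x ∈ (opp A).verts := by
  simp [core]

theorem core_adj {x y : V} : (core v).Adj x y ↔ X.Adj x y ∧ ∀ A ∈ v, ¬ A.Adj x y := by
  simp only [core, Subgraph.sInf_adj, Set.forall_mem_image, opp]
  exact ⟨fun h => ⟨h.2, fun A hA => (h.1 hA).2⟩, fun h => ⟨fun A hA => ⟨h.1, h.2 A hA⟩, h.1⟩⟩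

theorem vertexGraph_adj {a b : (core v).verts} : (vertexGraph v).Adj a b ↔
    a ≠ b ∧ ((X.Adj a b ∧ ∀ A ∈ v, ¬ A.Adj a b) ∨ ∃ A ∈ v, hinge A = {(a : V), (b : V)}) := by
  rw [vertexGraph, sup_adj, fromRel_adj, Subgraph.coe_adj, core_adj]
  constructor
  · rintro (h | ⟨hne, h | h⟩)
    · exact ⟨fun he => h.1.ne (congrArg _ he), Or.inl h⟩
    · exact ⟨hne, Or.inr h⟩
    · rw [Set.pair_comm] at h
      exact ⟨hne, Or.inr h⟩
  · rintro ⟨hne, h | h⟩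
    · exact Or.inl h
    · exact Or.inr ⟨hne, Or.inl h⟩

/-- The stabilizer of `v` acts on the graph associated with `v`. -/
theorem exists_vertexGraph_iso {g : X ≃g X} (hg : translate g '' v = v) :
    ∃ ψ : vertexGraph v ≃g vertexGraph v, ∀ z, (ψ z : V) = g (z : V) := by
  have hall : ∀ P : X.Subgraph → Prop, (∀ A ∈ v, P A) ↔ ∀ A ∈ v, P (translate g A) := by
    intro P
    conv_lhs => rw [← hg]
    exact Set.forall_mem_image
  have hex : ∀ P : X.Subgraph → Prop, (∃ A ∈ v, P A) ↔ ∃ A ∈ v, P (translate g A) := by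
    intro P
    conv_lhs => rw [← hg]
    exact Set.exists_mem_image
  have hcore : ∀ x, x ∈ (core v).verts ↔ g x ∈ (core v).verts := by
    intro x
    rw [mem_core, mem_core, hall (fun A => g x ∈ (opp A).verts)]
    simp only [opp_translate, mem_translate_verts]
  refine ⟨⟨g.toEquiv.subtypeEquiv hcore, ?_⟩, fun z => rfl⟩
  intro a b
  rw [vertexGraph_adj, vertexGraph_adj, hall (fun A => ¬ A.Adj _ _),
    hex (fun A => hinge A = _)]
  refine and_congr ((Equiv.injective _).ne_iff) (or_congr ?_ ?_)
  · exact and_congr g.map_adj_iff (forall₂_congr fun A _ => not_congr translate_adj)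
  · refine exists_congr fun A => and_congr_right fun _ => ?_
    rw [hinge_translate]
    change g '' hinge A = {g a, g b} ↔ _
    rw [← Set.image_pair, g.injective.image_injective.eq_iff]

end Action
end TutteTree

/-! ### Graphs in which every separation of order two is crossed are cycles -/

namespace TutteTree
section CycleGraphs
open SimpleGraph
variable {W : Type*} {Z : SimpleGraph W}

/-- The vertex set is the disjoint union of `S`, `C`, `D`, there is no edge between `C` and `D`, and
neither of these is empty. -/
structure IsSep (Z : SimpleGraph W) (S C D : Set W) : Prop where
  cover : ∀ x, x ∈ S ∨ x ∈ C ∨ x ∈ D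
  notMem_left : ∀ {x}, x ∈ S → x ∉ C
  notMem_right : ∀ {x}, x ∈ S → x ∉ D
  disj : ∀ {x}, x ∈ C → x ∉ D
  not_adj : ∀ {x y}, x ∈ C → y ∈ D → ¬ Z.Adj x y
  left_nonempty : C.Nonempty
  right_nonempty : D.Nonempty

theorem IsSep.symm {S C D : Set W} (h : IsSep Z S C D) : IsSep Z S D C where
  cover x := by rcases h.cover x with h | h | h <;> simp [h]
  notMem_left := h.notMem_right
  notMem_right := h.notMem_left
  disj hx hx' := h.disj hx' hx
  not_adj hx hy hxy := h.not_adj hy hx hxy.symm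
  left_nonempty := h.right_nonempty
  right_nonempty := h.left_nonempty

theorem IsSep.mem_of_adj {S C D : Set W} (h : IsSep Z S C D) {x y : W} (hx : x ∈ C)
    (hxy : Z.Adj x y) (hy : y ∉ S) : y ∈ C := by
  rcases h.cover y with h1 | h1 | h1
  · exact absurd h1 hy
  · exact h1
  · exact absurd hxy (h.not_adj hx h1)

theorem IsSep.mem_of_isPath {S C D : Set W} (h : IsSep Z S C D) {x y : W} (p : Z.Walk x y)
    (hp : p.IsPath) (hx : x ∈ C) (hS : ∀ z ∈ p.support, z ∈ S → z = y) :
    ∀ z ∈ p.support, z ≠ y → z ∈ C := by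
  induction p with
  | nil => simp
  | @cons a b c hab p ih =>
    intro z hz hzc
    rw [Walk.support_cons, List.mem_cons] at hz
    rcases hz with rfl | hz
    · exact hx
    by_cases hbc : b = c
    · subst hbc
      have := hp.of_cons
      rw [Walk.isPath_iff_nil, Walk.nil_iff_support_eq] at this
      rw [this, List.mem_singleton] at hz
      exact absurd hz hzc
    · refine ih hp.of_cons (h.mem_of_adj hx hab fun hb => hbc (hS b (by simp) hb)) ?_ z hz hzc
      exact fun z hz => hS z (by simp [hz])

theorem IsSep.exists_mem_support {S C D : Set W} (h : IsSep Z S C D) {x y : W} (p : Z.Walk x y)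
    (hx : x ∈ C) (hy : y ∈ D) : ∃ z ∈ p.support, z ∈ S := by
  by_contra! hno
  induction p with
  | nil => exact h.disj hx hy
  | @cons a b c hab p ih =>
    exact ih (h.mem_of_adj hx hab (hno b (by simp))) hy fun z hz => hno z (by simp [hz])

theorem exists_isSep {S : Set W} (h : ¬ (Z.induce Sᶜ).Preconnected) : ∃ C D, IsSep Z S C D := by
  rw [Preconnected] at h
  push Not at h
  obtain ⟨x, y, hxy⟩ := h
  refine ⟨{z | ∃ h : z ∈ Sᶜ, (Z.induce Sᶜ).Reachable x ⟨z, h⟩},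
    {z | ∃ h : z ∈ Sᶜ, ¬ (Z.induce Sᶜ).Reachable x ⟨z, h⟩}, ?_, ?_, ?_, ?_, ?_, ?_, ?_⟩
  · intro z
    by_cases hz : z ∈ S
    · exact Or.inl hz
    · by_cases hr : (Z.induce Sᶜ).Reachable x ⟨z, hz⟩
      · exact Or.inr (Or.inl ⟨hz, hr⟩)
      · exact Or.inr (Or.inr ⟨hz, hr⟩)
  · exact fun hz ⟨h, _⟩ => h hz
  · exact fun hz ⟨h, _⟩ => h hz
  · exact fun ⟨h1, h2⟩ ⟨_, h4⟩ => h4 h2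
  · rintro a b ⟨h1, h2⟩ ⟨h3, h4⟩ hab
    exact h4 (h2.trans (Adj.reachable (show (Z.induce Sᶜ).Adj ⟨a, h1⟩ ⟨b, h3⟩ from hab)))
  · exact ⟨x, x.2, .rfl⟩
  · exact ⟨y, y.2, hxy⟩

theorem isPath_append {a b c : W} {p : Z.Walk a b} {q : Z.Walk b c} (hp : p.IsPath)
    (hq : q.IsPath) (h : ∀ x ∈ p.support, x ∈ q.support → x = b) : (p.append q).IsPath := by
  rw [Walk.isPath_def, Walk.support_append, List.nodup_append']
  have hq' := hq.support_nodup
  rw [← q.cons_tail_support] at hq'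
  refine ⟨hp.support_nodup, hq'.of_cons, fun x hx hx' => ?_⟩
  have := h x hx (List.mem_of_mem_tail hx')
  subst this
  exact (List.nodup_cons.1 hq').1 hx'

/-- A walk that is a Hamiltonian path together with one further edge. -/
theorem isCycleGraph_of_isPath {a b : W} (p : Z.Walk a b) (hp : p.IsPath)
    (hs : ∀ x, x ∈ p.support) (hba : Z.Adj b a) (hl : 2 ≤ p.length)
    (hE : ∀ x y, Z.Adj x y → s(x, y) ∈ p.edges ∨ s(x, y) = s(b, a)) : IsCycleGraph Z := by
  refine ⟨p.length + 1, by omega, ⟨RelIso.symm ?_⟩⟩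
  let f : Fin (p.length + 1) → W := fun i => p.getVert i
  have hinj : Function.Injective f := fun i j hij =>
    Fin.ext (hp.getVert_injOn (show i.1 ≤ p.length by omega) (show j.1 ≤ p.length by omega) hij)
  have hsurj : Function.Surjective f := by
    intro x
    obtain ⟨n, hn, hn'⟩ := Walk.mem_support_iff_exists_getVert.1 (hs x)
    exact ⟨⟨n, by omega⟩, hn⟩
  refine ⟨Equiv.ofBijective f ⟨hinj, hsurj⟩, ?_⟩
  have h0 : f ⟨0, by omega⟩ = a := p.getVert_zero
  have h1 : f ⟨p.length, by omega⟩ = b := p.getVert_length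
  -- Subtraction in `Fin` wraps around: the difference is also 1 for `0 - p.length`, which accounts
  -- for the closing edge.
  have key : ∀ i j : Fin (p.length + 1), (i - j).val = 1 ↔
      (j.1 + 1 = i.1 ∨ (i.1 = 0 ∧ j.1 = p.length)) := by
    intro i j
    rcases lt_or_ge i j with hij | hij
    · rw [Fin.coe_sub_iff_lt.2 hij]
      have : i.1 < j.1 := hij
      omega
    · rw [Fin.sub_val_of_le hij]
      have : j.1 ≤ i.1 := hij
      omega
  intro i j
  change Z.Adj (f i) (f j) ↔ _
  rw [cycleGraph_adj', key, key]
  constructor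
  · intro hij
    rcases hE _ _ hij with h | h
    · rw [Walk.mk_mem_edges_iff_exists] at h
      obtain ⟨n, hn, h⟩ := h
      have e1 : p.getVert n = f ⟨n, by omega⟩ := rfl
      have e2 : p.getVert (n + 1) = f ⟨n + 1, by omega⟩ := rfl
      rw [e1, e2] at h
      rw [Sym2.eq_iff] at h
      rcases h with ⟨h, h'⟩ | ⟨h, h'⟩
      all_goals
        have h := hinj h
        have h' := hinj h'
        subst h h'
        simp
    · have h : s(f i, f j) = s(f ⟨p.length, by omega⟩, f ⟨0, by omega⟩) := by rw [h, h0, h1]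
      rw [Sym2.eq_iff] at h
      rcases h with ⟨h, h'⟩ | ⟨h, h'⟩
      all_goals
        have h := hinj h
        have h' := hinj h'
        subst h h'
        simp
  · have hadj : ∀ i j : Fin (p.length + 1), (j.1 + 1 = i.1 ∨ (i.1 = 0 ∧ j.1 = p.length)) →
        Z.Adj (f i) (f j) := by
      rintro ⟨i, hi⟩ ⟨j, hj⟩ (h | ⟨h, h'⟩)
      · simp only at h
        subst h
        exact (p.adj_getVert_succ (by omega)).symm
      · simp only at h h'
        subst h h'
        rw [h0, h1]
        exact hba.symm
    rintro (h | h)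
    · exact hadj i j h
    · exact (hadj j i h).symm

/-- Otherwise let `K` be the part of `C` that can be reached from `u` inside `C`. If `K` is
nonempty, then `u` alone separates it from `v`; if `K` is empty, then `v` alone separates `C` from
`D` and `u`. -/
theorem exists_walk_of_isSep (h1 : ∀ S C D, IsSep Z S C D → ∀ c, ¬ S ⊆ {c}) {u v : W}
    {C D : Set W} (huv : u ≠ v) (h : IsSep Z {u, v} C D) :
    ∃ p : Z.Walk u v, ∀ x ∈ p.support, x ∈ C ∨ x = u ∨ x = v := by
  by_contra! hno
  let K : Set W := {x | x ∈ C ∧ ∃ p : Z.Walk u x, ∀ y ∈ p.support, y ∈ C ∨ y = u}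
  have hu : u ∈ ({u, v} : Set W) := by simp
  have hv : v ∈ ({u, v} : Set W) := by simp
  have hvK : ∀ x ∈ K, ¬ Z.Adj x v := by
    rintro x ⟨hx, p, hp⟩ hxv
    obtain ⟨y, hy, h2⟩ := hno (p.concat hxv)
    rw [Walk.support_concat, List.mem_append, List.mem_singleton] at hy
    rcases hy with hy | rfl
    · rcases hp y hy with h3 | h3
      · exact h2.1 h3
      · exact h2.2.1 h3
    · exact h2.2.2 rfl
  by_cases hK : K.Nonempty
  · refine h1 {u} K {x | x ∉ K ∧ x ≠ u} ⟨?_, ?_, ?_, ?_, ?_, hK, ?_⟩ u le_rfl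
    · intro x
      by_cases hx : x ∈ K <;> by_cases hx' : x = u <;> simp [hx, hx']
    · rintro x rfl hx
      exact h.notMem_left hu hx.1
    · rintro x rfl hx
      exact hx.2 rfl
    · exact fun hx hx' => hx'.1 hx
    · intro x y hx hy hxy
      have hyv : y ≠ v := fun hyv => hvK x hx (hyv ▸ hxy)
      obtain ⟨hxC, p, hp⟩ := hx
      have hyC : y ∈ C := h.mem_of_adj hxC hxy (by simp [hy.2, hyv])
      refine hy.1 ⟨hyC, p.concat hxy, fun z hz => ?_⟩
      rw [Walk.support_concat, List.mem_append, List.mem_singleton] at hz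
      rcases hz with hz | rfl
      · exact hp z hz
      · exact Or.inl hyC
    · exact ⟨v, fun hvK => h.notMem_left hv hvK.1, huv.symm⟩
  · refine h1 {v} C (D ∪ {u}) ⟨?_, ?_, ?_, ?_, ?_, h.left_nonempty, ⟨u, by simp⟩⟩ v le_rfl
    · intro x
      rcases h.cover x with (h2 | h2) | h2 | h2 <;> simp_all
    · rintro x rfl
      exact h.notMem_left hv
    · rintro x rfl hx
      rcases hx with hx | hx
      · exact h.notMem_right hv hx
      · exact huv hx.symm
    · rintro x hx (hx' | rfl)
      · exact h.disj hx hx'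
      · exact h.notMem_left hu hx
    · rintro x y hx (hy | rfl) hxy
      · exact h.not_adj hx hy hxy
      · exact hK ⟨x, hx, hxy.symm.toWalk, by simp [hx]⟩

/-- If every separation of order two is crossed by one of order two, then each side of such a
separation is a path. -/
theorem exists_arc (h2 : ∀ u v C D, u ≠ v → IsSep Z {u, v} C D → ∃ w ∈ C, ∃ z ∈ D, ∃ Cu Cv,
      IsSep Z {w, z} Cu Cv ∧ u ∈ Cu ∧ v ∈ Cv) :
    ∀ (n : ℕ) (u v : W) (C : Set W) (p : Z.Walk u v), p.IsPath → p.length = n →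
      (∀ x ∈ p.support, x ∈ C ∨ x = u ∨ x = v) → u ≠ v →
      (C = ∅ ∨ ∃ D, IsSep Z {u, v} C D) →
      ∃ q : Z.Walk u v, q.IsPath ∧ (∀ x, x ∈ q.support ↔ x ∈ C ∨ x = u ∨ x = v) ∧
        ∀ x ∈ q.support, ∀ y ∈ q.support, Z.Adj x y → s(x, y) ∈ q.edges := by
  classical
  intro n
  induction n using Nat.strong_induction_on with
  | _ n ih =>
    intro u v C p hp hn hpC huv hC
    -- With no vertex available besides `u` and `v`, the path `p` shows that these are adjacent, and
    -- that edge is the arc.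
    rcases hC with rfl | ⟨D, hD⟩
    · have huv' : Z.Adj u v := by
        cases p with
        | nil => exact absurd rfl huv
        | @cons _ b _ hab p =>
          rcases hpC b (by simp) with h | rfl | rfl
          · exact absurd h (by simp)
          · exact absurd rfl hab.ne
          · exact hab
      refine ⟨huv'.toWalk, by simp [huv], by simp, ?_⟩
      intro x hx y hy hxy
      have hne := hxy.ne
      simp at hx hy ⊢
      rcases hx with rfl | rfl <;> rcases hy with rfl | rfl <;> simp_all
    -- The crossing separator `{w, z}` has only `w` in common with `p`. It cuts `p` at `w` into two
    -- strictly shorter paths, to which the induction applies.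
    · obtain ⟨w, hw, z, hz, Cu, Cv, hS, hu, hv⟩ := h2 u v C D huv hD
      have hup : u ∈ ({u, v} : Set W) := by simp
      have hvp : v ∈ ({u, v} : Set W) := by simp
      have hwp' : w ∈ ({w, z} : Set W) := by simp
      have hzp' : z ∈ ({w, z} : Set W) := by simp
      have hwu : u ≠ w := by rintro rfl; exact hD.notMem_left hup hw
      have hwv : v ≠ w := by rintro rfl; exact hD.notMem_left hvp hw
      have hzp : z ∉ p.support := by
        intro h
        rcases hpC z h with h | rfl | rfl
        · exact hD.disj h hz
        · exact hD.notMem_right hup hz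
        · exact hD.notMem_right hvp hz
      have hwp : w ∈ p.support := by
        obtain ⟨x, hx, rfl | rfl⟩ := hS.exists_mem_support p hu hv
        · exact hx
        · exact absurd hx hzp
      have hl1 := Walk.length_takeUntil_lt_length hwp hwv.symm
      have hl2 := congrArg Walk.length (p.take_spec hwp)
      rw [Walk.length_append] at hl2
      have hl3 : 0 < (p.takeUntil w hwp).length := by
        rw [Nat.pos_iff_ne_zero]
        intro h0
        exact hwu (Walk.eq_of_length_eq_zero h0)
      have hm1 : ∀ x ∈ (p.takeUntil w hwp).support, x ∈ p.support :=
        fun x hx => p.support_takeUntil_subset_support hwp hx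
      have hm2 : ∀ x ∈ (p.dropUntil w hwp).support, x ∈ p.support :=
        fun x hx => p.support_dropUntil_subset_support hwp hx
      have hside1 := hS.mem_of_isPath (p.takeUntil w hwp) (hp.takeUntil hwp) hu (by
        rintro x hx (rfl | rfl)
        · rfl
        · exact absurd (hm1 _ hx) hzp)
      have hside2 := hS.symm.mem_of_isPath (p.dropUntil w hwp).reverse
        (hp.dropUntil hwp).reverse hv (by
        rintro x hx (rfl | rfl)
        · rfl
        · rw [Walk.support_reverse, List.mem_reverse] at hx
          exact absurd (hm2 _ hx) hzp)
      -- A neighbour of `C ∩ Ca` outside it can only be `a` or `w`: leaving `C` leads to `a` or `b`,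
      -- leaving `Ca` leads to `w` or `z`, while `b` lies in `Cb` and `z` lies in `D`.
      have sub : ∀ {a b : W} {Ca Cb : Set W}, ({a, b} : Set W) = {u, v} →
          IsSep Z {w, z} Ca Cb → a ∈ Ca → b ∈ Cb →
          C ∩ Ca = ∅ ∨ ∃ D', IsSep Z {a, w} (C ∩ Ca) D' := by
        intro a b Ca Cb hab hS ha hb
        rcases Set.eq_empty_or_nonempty (C ∩ Ca) with h0 | h0
        · exact Or.inl h0
        have hap : a ∈ ({u, v} : Set W) := by rw [← hab]; simp
        have hbp : b ∈ ({u, v} : Set W) := by rw [← hab]; simp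
        refine Or.inr ⟨{x | x ∉ C ∩ Ca ∧ x ≠ a ∧ x ≠ w}, ?_, ?_, ?_, ?_, ?_, h0, ?_⟩
        · intro x
          by_cases h3 : x ∈ C ∩ Ca
          · exact Or.inr (Or.inl h3)
          · by_cases h4 : x = a
            · simp [h4]
            by_cases h5 : x = w
            · simp [h5]
            · exact Or.inr (Or.inr ⟨h3, h4, h5⟩)
        · rintro x (rfl | rfl) hx
          · exact hD.notMem_left hap hx.1
          · exact hS.notMem_left hwp' hx.2
        · rintro x (rfl | rfl) hx
          · exact hx.2.1 rfl
          · exact hx.2.2 rfl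
        · exact fun hx hx' => hx'.1 hx
        · intro x y hx hy hxy
          have hyb : y ≠ b := by
            rintro rfl
            exact hS.not_adj hx.2 hb hxy
          have hyC : y ∈ C := by
            refine hD.mem_of_adj hx.1 hxy ?_
            rw [← hab]
            simp [hyb, hy.2.1]
          have hyz : y ≠ z := by
            rintro rfl
            exact hD.disj hyC hz
          exact hy.1 ⟨hyC, hS.mem_of_adj hx.2 hxy (by simp [hyz, hy.2.2])⟩
        · refine ⟨b, fun h => hD.notMem_left hbp h.1, ?_, ?_⟩
          · rintro rfl
            exact hS.disj ha hb
          · rintro rfl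
            exact hD.notMem_left hbp hw
      obtain ⟨q1, hq1, hs1, he1⟩ := ih _ (by omega) u w (C ∩ Cu) (p.takeUntil w hwp)
        (hp.takeUntil hwp) rfl (by
          intro x hx
          by_cases hxw : x = w
          · simp [hxw]
          have hxu := hside1 x hx hxw
          rcases hpC x (hm1 x hx) with h | h | rfl
          · exact Or.inl ⟨h, hxu⟩
          · simp [h]
          · exact absurd hv (hS.disj hxu)) hwu (sub rfl hS hu hv)
      obtain ⟨q2, hq2, hs2, he2⟩ := ih _ (by rw [Walk.length_reverse]; omega) v w (C ∩ Cv)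
        (p.dropUntil w hwp).reverse (hp.dropUntil hwp).reverse rfl (by
          intro x hx
          by_cases hxw : x = w
          · simp [hxw]
          have hxv := hside2 x hx hxw
          rw [Walk.support_reverse, List.mem_reverse] at hx
          rcases hpC x (hm2 x hx) with h | rfl | h
          · exact Or.inl ⟨h, hxv⟩
          · exact absurd hxv (hS.disj hu)
          · simp [h]) hwv (sub (Set.pair_comm v u) hS.symm hv hu)
      have hmem : ∀ x, x ∈ (q1.append q2.reverse).support ↔ x ∈ C ∨ x = u ∨ x = v := by
        intro x
        rw [Walk.mem_support_append_iff, Walk.support_reverse, List.mem_reverse, hs1, hs2]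
        constructor
        · rintro ((h | h | rfl) | (h | h | rfl))
          · exact Or.inl h.1
          · simp [h]
          · exact Or.inl hw
          · exact Or.inl h.1
          · simp [h]
          · exact Or.inl hw
        · rintro (h | h | h)
          · by_cases hxw : x = w
            · simp [hxw]
            have hxz : x ≠ z := by
              rintro rfl
              exact hD.disj h hz
            rcases hS.cover x with (h3 | h3) | h3 | h3
            · exact absurd h3 hxw
            · exact absurd h3 hxz
            · exact Or.inl (Or.inl ⟨h, h3⟩)
            · exact Or.inr (Or.inl ⟨h, h3⟩)
          · simp [h]
          · simp [h]
      have hu1 : ∀ x ∈ q1.support, x ≠ w → x ∈ Cu := by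
        intro x hx hxw
        rcases (hs1 x).1 hx with h | rfl | h
        · exact h.2
        · exact hu
        · exact absurd h hxw
      have hv2 : ∀ x ∈ q2.support, x ≠ w → x ∈ Cv := by
        intro x hx hxw
        rcases (hs2 x).1 hx with h | rfl | h
        · exact h.2
        · exact hv
        · exact absurd h hxw
      refine ⟨q1.append q2.reverse, isPath_append hq1 hq2.reverse ?_, hmem, ?_⟩
      · intro x hx hx'
        rw [Walk.support_reverse, List.mem_reverse] at hx'
        by_contra hxw
        exact hS.disj (hu1 x hx hxw) (hv2 x hx' hxw)
      · intro x hx y hy hxy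
        rw [Walk.mem_support_append_iff, Walk.support_reverse, List.mem_reverse] at hx hy
        rw [Walk.edges_append, List.mem_append, Walk.edges_reverse, List.mem_reverse]
        rcases hx with hx | hx <;> rcases hy with hy | hy
        · exact Or.inl (he1 x hx y hy hxy)
        · by_cases hxw : x = w
          · subst hxw
            exact Or.inr (he2 _ (by simp) y hy hxy)
          by_cases hyw : y = w
          · subst hyw
            exact Or.inl (he1 _ hx _ (by simp) hxy)
          exact absurd hxy (hS.not_adj (hu1 x hx hxw) (hv2 y hy hyw))
        · by_cases hxw : x = w
          · subst hxw
            exact Or.inl (he1 _ (by simp) y hy hxy)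
          by_cases hyw : y = w
          · subst hyw
            exact Or.inr (he2 _ hx _ (by simp) hxy)
          exact absurd hxy.symm (hS.not_adj (hu1 y hy hyw) (hv2 x hx hxw))
        · exact Or.inr (he2 x hx y hy hxy)

/-- Each side together with `u` and `v` is an arc that contains all edges between its vertices, and
no edge joins the two sides. So `Z` is the union of two arcs with the same ends. -/
theorem isCycleGraph_of_isSep (h1 : ∀ S C D, IsSep Z S C D → ∀ c, ¬ S ⊆ {c})
    (h2 : ∀ u v C D, u ≠ v → IsSep Z {u, v} C D → ∃ w ∈ C, ∃ z ∈ D, ∃ Cu Cv,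
      IsSep Z {w, z} Cu Cv ∧ u ∈ Cu ∧ v ∈ Cv)
    {u v : W} {C D : Set W} (huv : u ≠ v) (h : IsSep Z {u, v} C D) : IsCycleGraph Z := by
  classical
  have key : ∀ {C D : Set W}, IsSep Z {u, v} C D → ∃ q : Z.Walk u v, q.IsPath ∧
      (∀ x, x ∈ q.support ↔ x ∈ C ∨ x = u ∨ x = v) ∧
        ∀ x ∈ q.support, ∀ y ∈ q.support, Z.Adj x y → s(x, y) ∈ q.edges := by
    intro C D h
    obtain ⟨p, hp⟩ := exists_walk_of_isSep h1 huv h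
    exact exists_arc h2 _ u v C p.bypass p.bypass_isPath rfl
      (fun x hx => hp x (p.support_bypass_subset_support hx)) huv (Or.inr ⟨D, h⟩)
  obtain ⟨q, hq, hqs, hqe⟩ := key h
  obtain ⟨r, hr, hrs, hre⟩ := key h.symm
  obtain ⟨c, hc⟩ := h.left_nonempty
  have hup : u ∈ ({u, v} : Set W) := by simp
  have hvp : v ∈ ({u, v} : Set W) := by simp
  -- The arc `q` passes through a vertex of `C`, so it is not a single edge; this gives the cycle
  -- length at least three.
  have hlen : 2 ≤ q.length := by
    have hcq := (hqs c).2 (Or.inl hc)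
    have hcu : c ≠ u := by rintro rfl; exact h.notMem_left hup hc
    have hcv : c ≠ v := by rintro rfl; exact h.notMem_left hvp hc
    match q, hcq with
    | .nil, _ => exact absurd rfl huv
    | .cons h .nil, hcq =>
      simp at hcq
      rcases hcq with h | h
      · exact absurd h hcu
      · exact absurd h hcv
    | .cons h (.cons h' q), _ => simp
  cases r with
  | nil => exact absurd rfl huv
  | @cons _ d _ hud r =>
    have hdr : ∀ x ∈ r.support, x ∈ D ∨ x = v := by
      intro x hx
      rcases (hrs x).1 (by simp [hx]) with h3 | rfl | h3
      · exact Or.inl h3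
      · exact absurd hx ((Walk.cons_isPath_iff _ _).1 hr).2
      · exact Or.inr h3
    -- The first edge of the second arc is set aside as the closing edge; the rest is a Hamiltonian
    -- path from `u` through `v` to `d`.
    refine isCycleGraph_of_isPath (q.append r.reverse) (isPath_append hq hr.of_cons.reverse ?_)
      ?_ hud.symm ?_ ?_
    · intro x hx hx'
      rw [Walk.support_reverse, List.mem_reverse] at hx'
      rcases hdr x hx' with h3 | h3
      · rcases (hqs x).1 hx with h4 | rfl | h4
        · exact absurd h3 (h.disj h4)
        · exact absurd h3 (h.notMem_right hup)
        · exact h4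
      · exact h3
    · intro x
      rw [Walk.mem_support_append_iff, Walk.support_reverse, List.mem_reverse]
      rcases h.cover x with (h3 | h3) | h3 | h3
      · exact Or.inl ((hqs x).2 (by simp [h3]))
      · exact Or.inl ((hqs x).2 (Or.inr (Or.inr h3)))
      · exact Or.inl ((hqs x).2 (Or.inl h3))
      · have := (hrs x).2 (Or.inl h3)
        rw [Walk.support_cons, List.mem_cons] at this
        rcases this with rfl | h4
        · exact Or.inl (by simp)
        · exact Or.inr h4
    · rw [Walk.length_append]; omega
    · intro x y hxy
      have hall : ∀ x, x ∈ q.support ∨ x ∈ D := by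
        intro x
        rw [hqs]
        rcases h.cover x with (h3 | h3) | h3 | h3
        · simp [h3]
        · simp [Set.mem_singleton_iff.1 h3]
        · simp [h3]
        · simp [h3]
      have hadj : ∀ x y, Z.Adj x y → x ∈ q.support → y ∈ D →
          x ∈ (Walk.cons hud r).support := by
        intro x y hxy hx hy
        rw [hrs]
        rcases (hqs x).1 hx with h3 | h3 | h3
        · exact absurd hxy (h.not_adj h3 hy)
        · simp [h3]
        · simp [h3]
      rw [Walk.edges_append, List.mem_append, Walk.edges_reverse, List.mem_reverse]
      have hfin : s(x, y) ∈ (Walk.cons hud r).edges →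
          (s(x, y) ∈ q.edges ∨ s(x, y) ∈ r.edges) ∨ s(x, y) = s(d, u) := by
        rw [Walk.edges_cons, List.mem_cons]
        rintro (h3 | h3)
        · exact Or.inr (h3.trans Sym2.eq_swap)
        · exact Or.inl (Or.inr h3)
      rcases hall x with hx | hx <;> rcases hall y with hy | hy
      · exact Or.inl (Or.inl (hqe x hx y hy hxy))
      · exact hfin (hre x (hadj x y hxy hx hy) y ((hrs y).2 (Or.inl hy)) hxy)
      · exact hfin (hre x ((hrs x).2 (Or.inl hx)) y (hadj y x hxy.symm hy hx) hxy)
      · exact hfin (hre x ((hrs x).2 (Or.inl hx)) y ((hrs y).2 (Or.inl hy)) hxy)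

end CycleGraphs
end TutteTree

/-! ### Planarity passes to graphs with a subdivision in a planar graph -/

namespace TutteTree
section Planarity
open SimpleGraph

theorem injective_trans {Y : Type*} [TopologicalSpace Y] {x y z : Y} (γ : Path x y) (δ : Path y z)
    (hγ : Function.Injective γ) (hδ : Function.Injective δ)
    (h : Set.range γ ∩ Set.range δ ⊆ {y}) : Function.Injective (γ.trans δ) := by
  have key : ∀ s t : unitInterval, (s : ℝ) ≤ 1 / 2 → ¬ (t : ℝ) ≤ 1 / 2 →
      γ.trans δ s ≠ γ.trans δ t := by
    intro s t hs ht hst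
    rw [Path.trans_apply, Path.trans_apply, dif_pos hs, dif_neg ht] at hst
    have h1 := h ⟨⟨_, rfl⟩, ⟨_, hst.symm⟩⟩
    rw [Set.mem_singleton_iff, hst] at h1
    have h2 := hδ (h1.trans δ.source.symm)
    have h3 := congrArg Subtype.val h2
    simp only [Set.Icc.coe_zero] at h3
    linarith
  intro s t hst
  by_cases hs : (s : ℝ) ≤ 1 / 2 <;> by_cases ht : (t : ℝ) ≤ 1 / 2
  · rw [Path.trans_apply, Path.trans_apply, dif_pos hs, dif_pos ht] at hst
    have h3 := congrArg Subtype.val (hγ hst)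
    exact Subtype.ext (by simp only at h3; linarith)
  · exact absurd hst (key s t hs ht)
  · exact absurd hst.symm (key t s ht hs)
  · rw [Path.trans_apply, Path.trans_apply, dif_neg hs, dif_neg ht] at hst
    have h3 := congrArg Subtype.val (hδ hst)
    exact Subtype.ext (by simp only at h3; linarith)

variable {V : Type*} {X : SimpleGraph V} {pt : V → EuclideanSpace ℝ (Fin 2)}
  {arc : Sym2 V → Set (EuclideanSpace ℝ (Fin 2))}

/-- The arcs of distinct edges meet only at points of common end vertices, and a path visits no
vertex twice, so the concatenated curve is again simple. -/
theorem exists_path_of_walk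
    (h1 : ∀ a b, X.Adj a b → ∃ γ : Path (pt a) (pt b),
      Function.Injective γ ∧ Set.range γ = arc s(a, b))
    (h2 : ∀ e ∈ X.edgeSet, ∀ w, pt w ∈ arc e → w ∈ e)
    (h3 : ∀ e ∈ X.edgeSet, ∀ e' ∈ X.edgeSet, e ≠ e' → arc e ∩ arc e' ⊆ Set.range pt)
    {x y : V} (p : X.Walk x y) (hp : p.IsPath) (hxy : x ≠ y) :
    ∃ γ : Path (pt x) (pt y), Function.Injective γ ∧ Set.range γ = ⋃ e ∈ p.edges, arc e := by
  induction p with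
  | nil => exact absurd rfl hxy
  | @cons a b c hab q ih =>
    obtain ⟨γ, hγ, hγr⟩ := h1 a b hab
    by_cases hbc : b = c
    · subst hbc
      have := hp.of_cons
      rw [Walk.isPath_iff_nil] at this
      cases this
      exact ⟨γ, hγ, by simp [hγr]⟩
    · obtain ⟨δ, hδ, hδr⟩ := ih hp.of_cons hbc
      refine ⟨γ.trans δ, injective_trans γ δ hγ hδ ?_, ?_⟩
      · rintro z ⟨hz, hz'⟩
        rw [hγr] at hz
        rw [hδr, Set.mem_iUnion₂] at hz'
        obtain ⟨e, he, hz'⟩ := hz'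
        have heX := q.edges_subset_edgeSet he
        have haq := ((Walk.cons_isPath_iff _ _).1 hp).2
        have hmem : ∀ w ∈ e, w ∈ q.support := by
          intro w hw
          obtain ⟨w', rfl⟩ := Sym2.mem_iff_exists.1 hw
          exact q.fst_mem_support_of_mem_edges he
        have hne : s(a, b) ≠ e := by
          rintro rfl
          exact haq (hmem a (by simp))
        obtain ⟨w, rfl⟩ := h3 _ hab e heX hne ⟨hz, hz'⟩
        have h5 := hmem w (h2 e heX w hz')
        have h4 := h2 _ hab w hz
        rw [Sym2.mem_iff] at h4
        rcases h4 with rfl | rfl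
        · exact absurd h5 haq
        · rfl
      · rw [Path.trans_range, hγr, hδr, Walk.edges_cons]
        ext z
        simp

/-- Each edge is drawn as the union of the arcs along its path. The union does not depend on the
orientation, since opposite orientations have reversed paths. -/
theorem isPlanar_of_hasSubdivisionIn {W : Type*} {Z : SimpleGraph W}
    (h : HasSubdivisionIn Z X) (hX : IsPlanar X) : IsPlanar Z := by
  obtain ⟨f, p, hf, hp, hsymm, hint, hdisj⟩ := h
  obtain ⟨pt, arc, hpt, h1, h2, h3⟩ := hX
  let arc' : Sym2 W → Set (EuclideanSpace ℝ (Fin 2)) := fun e =>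
    {z | ∃ a b, ∃ h : Z.Adj a b, e = s(a, b) ∧ ∃ e' ∈ (p a b h).edges, z ∈ arc e'}
  have harc : ∀ a b (h : Z.Adj a b), arc' s(a, b) = ⋃ e ∈ (p a b h).edges, arc e := by
    intro a b h
    ext z
    simp only [Set.mem_iUnion₂]
    constructor
    · rintro ⟨c, d, h', he, e', he', hz⟩
      rw [Sym2.eq_iff] at he
      rcases he with ⟨rfl, rfl⟩ | ⟨rfl, rfl⟩
      · exact ⟨e', he', hz⟩
      · rw [hsymm _ _ h, Walk.edges_reverse, List.mem_reverse] at he'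
        exact ⟨e', he', hz⟩
    · rintro ⟨e', he', hz⟩
      exact ⟨a, b, h, rfl, e', he', hz⟩
  have hmem : ∀ {a b} (h : Z.Adj a b) {e w}, e ∈ (p a b h).edges → w ∈ e →
      w ∈ (p a b h).support := by
    intro a b h e w he hw
    obtain ⟨w', rfl⟩ := Sym2.mem_iff_exists.1 hw
    exact (p a b h).fst_mem_support_of_mem_edges he
  refine ⟨pt ∘ f, arc', hpt.comp hf, ?_, ?_, ?_⟩
  · intro a b h
    rw [harc a b h]
    exact exists_path_of_walk h1 h2 h3 (p a b h) (hp a b h) (hf.ne h.ne)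
  · intro e he w hw
    induction e with
    | h a b =>
      rw [harc a b he, Set.mem_iUnion₂] at hw
      obtain ⟨e', he', hw⟩ := hw
      have := hmem he he' (h2 e' ((p a b he).edges_subset_edgeSet he') _ hw)
      rw [Sym2.mem_iff]
      exact hint a b he w this
  · intro e he e' he' hne z hz
    induction e with
    | h a b =>
    induction e' with
    | h c d =>
      rw [harc a b he, harc c d he', Set.mem_inter_iff, Set.mem_iUnion₂, Set.mem_iUnion₂] at hz
      obtain ⟨⟨e1, he1, hz1⟩, ⟨e2, he2, hz2⟩⟩ := hz
      have hE1 := (p a b he).edges_subset_edgeSet he1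
      have hE2 := (p c d he').edges_subset_edgeSet he2
      have hsh : ∀ w, w ∈ e1 → w ∈ e2 → w ∈ Set.range f := fun w hw1 hw2 =>
        hdisj a b he c d he' hne w (hmem he he1 hw1) (hmem he' he2 hw2)
      -- An edge of `X` used by two different edges of `Z` would have both ends among the
      -- representatives. These would be the two ends of both edges of `Z`, which would then
      -- coincide.
      by_cases h12 : e1 = e2
      · subst h12
        exfalso
        induction e1 with
        | h x y =>
          obtain ⟨i, rfl⟩ := hsh x (by simp) (by simp)
          obtain ⟨j, rfl⟩ := hsh y (by simp) (by simp)
          have hij : i ≠ j := by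
            rintro rfl
            exact X.loopless.irrefl _ hE1
          have m1 := hint a b he i (hmem he he1 (by simp))
          have m2 := hint a b he j (hmem he he1 (by simp))
          have m3 := hint c d he' i (hmem he' he2 (by simp))
          have m4 := hint c d he' j (hmem he' he2 (by simp))
          apply hne
          rw [Sym2.eq_iff]
          clear * - hij m1 m2 m3 m4
          grind
      · obtain ⟨w, rfl⟩ := h3 e1 hE1 e2 hE2 h12 ⟨hz1, hz2⟩
        obtain ⟨i, rfl⟩ := hsh w (h2 e1 hE1 w hz1) (h2 e2 hE2 w hz2)
        exact ⟨i, rfl⟩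

end Planarity
end TutteTree

/-! ### Blocks, extension of their subsets to the whole graph, and uncrossed one-vertex separations
-/

namespace TutteTree
section Blocks
open SimpleGraph
variable {V : Type*} {X : SimpleGraph V}

/-- The sets of edges with a single boundary vertex. -/
def OneSep (X : SimpleGraph V) (M : Set (Sym2 V)) : Prop :=
  M ⊆ X.edgeSet ∧ ∃ c, bd X.edgeSet M = {c}

/-- The blocks: the classes of edges not separated by a single vertex. -/
def IsBlock (X : SimpleGraph V) (Y : Set (Sym2 V)) : Prop :=
  ∃ e ∈ X.edgeSet, Y = {f | f ∈ X.edgeSet ∧ ∀ M, OneSep X M → (e ∈ M ↔ f ∈ M)}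

/-- `F` and `F'` do not cross, as subsets of `Y`. -/
def Nested (Y F F' : Set (Sym2 V)) : Prop :=
  F ⊆ F' ∨ F ⊆ Y \ F' ∨ Y \ F ⊆ F' ∨ Y \ F ⊆ Y \ F'

theorem OneSep.compl {M : Set (Sym2 V)} (h : OneSep X M) : OneSep X (X.edgeSet \ M) :=
  ⟨Set.sdiff_subset, by rw [bd_sdiff h.1]; exact h.2⟩

theorem Nested.symm {Y F F' : Set (Sym2 V)} (hF' : F' ⊆ Y) (h : Nested Y F F') :
    Nested Y F' F := by
  unfold Nested at *
  simp only [Set.subset_def, Set.mem_sdiff] at *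
  rcases h with h | h | h | h
  · exact Or.inr (Or.inr (Or.inr fun x hx => ⟨hx.1, fun hx' => hx.2 (h x hx')⟩))
  · exact Or.inr (Or.inl fun x hx => ⟨hF' x hx, fun hx' => (h x hx').2 hx⟩)
  · exact Or.inr (Or.inr (Or.inl fun x hx => by_contra fun hx' => hx.2 (h x ⟨hx.1, hx'⟩)))
  · exact Or.inl fun x hx => by_contra fun hx' => (h x ⟨hF' x hx, hx'⟩).2 hx

theorem Nested.compl_left {Y F F' : Set (Sym2 V)} (hF : F ⊆ Y) (h : Nested Y F F') :
    Nested Y (Y \ F) F' := by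
  unfold Nested at *
  rw [sdiff_sdiff_of_subset hF]
  tauto

theorem Nested.compl_right {Y F F' : Set (Sym2 V)} (hF' : F' ⊆ Y) (h : Nested Y F F') :
    Nested Y F (Y \ F') := by
  unfold Nested at *
  rw [sdiff_sdiff_of_subset hF']
  tauto

namespace IsBlock

variable {Y Y' F F' M W W' : Set (Sym2 V)}

theorem subset (hY : IsBlock X Y) : Y ⊆ X.edgeSet := by
  obtain ⟨e, -, rfl⟩ := hY
  exact fun f hf => hf.1

theorem nonempty (hY : IsBlock X Y) : Y.Nonempty := by
  obtain ⟨e, he, rfl⟩ := hY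
  exact ⟨e, he, fun _ _ => Iff.rfl⟩

theorem subset_or (hY : IsBlock X Y) (hM : OneSep X M) : Y ⊆ M ∨ Y ⊆ X.edgeSet \ M := by
  obtain ⟨e, -, rfl⟩ := hY
  by_cases h : e ∈ M
  · exact Or.inl fun f hf => (hf.2 M hM).1 h
  · exact Or.inr fun f hf => ⟨hf.1, fun h' => h ((hf.2 M hM).2 h')⟩

theorem exists_oneSep (hY : IsBlock X Y) {f : Sym2 V} (hf : f ∈ X.edgeSet) (hfY : f ∉ Y) :
    ∃ M, OneSep X M ∧ f ∈ M ∧ Y ⊆ X.edgeSet \ M := by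
  have hY' := hY
  obtain ⟨e, he, hYe⟩ := hY'
  have heY : e ∈ Y := by
    rw [hYe]
    exact ⟨he, fun _ _ => Iff.rfl⟩
  have : ∃ M, OneSep X M ∧ ¬ (e ∈ M ↔ f ∈ M) := by
    by_contra! h
    rw [hYe] at hfY
    exact hfY ⟨hf, h⟩
  obtain ⟨M, hM, hef⟩ := this
  by_cases h : f ∈ M
  · refine ⟨M, hM, h, (hY.subset_or hM).resolve_left fun h' => hef ⟨fun _ => h, fun _ => h' heY⟩⟩
  · refine ⟨_, hM.compl, ⟨hf, h⟩, (hY.subset_or hM.compl).resolve_left fun h' => ?_⟩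
    exact hef ⟨fun h2 => absurd h2 (h' heY).2, fun h2 => absurd h2 h⟩

theorem exists_oneSep_of_ne (hY : IsBlock X Y) (hY' : IsBlock X Y') (h : Y ≠ Y') :
    ∃ M, OneSep X M ∧ Y ⊆ M ∧ Y' ⊆ X.edgeSet \ M := by
  have key : ∃ f ∈ Y, f ∉ Y' := by
    by_contra! hsub
    apply h
    refine Set.Subset.antisymm hsub fun f hf => ?_
    by_contra hfY
    obtain ⟨M, hM, hfM, hYM⟩ := hY.exists_oneSep (hY'.subset hf) hfY
    obtain ⟨e, he⟩ := hY.nonempty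
    rcases hY'.subset_or hM with h1 | h1
    · exact (hYM he).2 (h1 (hsub e he))
    · exact (h1 hf).2 hfM
  obtain ⟨f, hf, hf'⟩ := key
  obtain ⟨M, hM, hfM, hYM⟩ := hY'.exists_oneSep (hY.subset hf) hf'
  exact ⟨M, hM, (hY.subset_or hM).resolve_right fun h1 => (h1 hf).2 hfM, hYM⟩

/-- A set with one boundary vertex that separates two different blocks has all their common vertices
in its boundary. -/
theorem eq_of_mem_vset (hY : IsBlock X Y) (hY' : IsBlock X Y') {x y : V} (hxy : x ≠ y)
    (hx : x ∈ vset Y) (hy : y ∈ vset Y) (hx' : x ∈ vset Y') (hy' : y ∈ vset Y') : Y = Y' := by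
  by_contra h
  obtain ⟨M, ⟨-, c, hM⟩, h1, h2⟩ := hY.exists_oneSep_of_ne hY' h
  have hx : x ∈ bd X.edgeSet M := ⟨vset_mono h1 hx, vset_mono h2 hx'⟩
  have hy : y ∈ bd X.edgeSet M := ⟨vset_mono h1 hy, vset_mono h2 hy'⟩
  rw [hM] at hx hy
  exact hxy (hx.trans hy.symm)

theorem exists_mem {e : Sym2 V} (he : e ∈ X.edgeSet) : ∃ Y, IsBlock X Y ∧ e ∈ Y :=
  ⟨_, ⟨e, he, rfl⟩, he, fun _ _ => Iff.rfl⟩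

/-- The first edge of a path outside `Y` lies in a set `M` with one boundary vertex and with `Y` on
the other side. That vertex is `w`, which the path never meets again, so the path stays in `M`, and
its end `w'` also belongs to the boundary of `M`. -/
theorem eq_of_reachable (hY : IsBlock X Y) {w w' : V} (hw : w ∈ vset Y) (hw' : w' ∈ vset Y)
    (h : (X.deleteEdges Y).Reachable w w') : w = w' := by
  classical
  obtain ⟨p, hp⟩ := h.exists_isPath
  cases p with
  | nil => rfl
  | @cons _ b _ hab p =>
    exfalso
    rw [deleteEdges_adj] at hab
    obtain ⟨M, hM, heM, hYM⟩ := hY.exists_oneSep hab.1 hab.2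
    obtain ⟨c, hc⟩ := hM.2
    have hwc : w = c := by
      have : w ∈ bd X.edgeSet M := ⟨⟨_, heM, by simp⟩, vset_mono hYM hw⟩
      rwa [hc] at this
    have hwp := ((Walk.cons_isPath_iff _ _).1 hp).2
    let q := p.map (Hom.ofLE (X.deleteEdges_le Y))
    have hq : q.support = p.support := by simp [q, Hom.ofLE]
    have h1 : w' ∈ vset M := by
      refine mem_vset_of_walk (y := w') q ⟨_, heM, by simp [Hom.ofLE]⟩ ?_
      intro z hz _ hz'
      rw [hc] at hz'
      rw [hq] at hz
      rw [Set.mem_singleton_iff.1 hz', ← hwc] at hz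
      exact hwp hz
    have h2 : w' ∈ bd X.edgeSet M := ⟨h1, vset_mono hYM hw'⟩
    rw [hc] at h2
    rw [← Set.mem_singleton_iff.1 h2] at hwc
    subst hwc
    exact hwp (by simp)

/-- With `eq_of_reachable` this shows that each vertex of `X` hangs on the block at exactly one
vertex of it. -/
theorem exists_reachable (hY : IsBlock X Y) (hX : X.Connected) (x : V) :
    ∃ w ∈ vset Y, (X.deleteEdges Y).Reachable x w := by
  obtain ⟨y, hy⟩ := vset_nonempty hY.nonempty
  obtain ⟨p⟩ := hX.preconnected x y
  induction p with
  | nil => exact ⟨_, hy, .rfl⟩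
  | @cons a b c hab p ih =>
    by_cases ha : a ∈ vset Y
    · exact ⟨a, ha, .rfl⟩
    · obtain ⟨w, hw, h⟩ := ih hy
      refine ⟨w, hw, Reachable.trans (Adj.reachable ?_) h⟩
      exact (deleteEdges_adj ..).2 ⟨hab, fun h' => ha ⟨_, h', by simp⟩⟩

theorem mem_of_adj (hY : IsBlock X Y) {x y : V} (hx : x ∈ vset Y) (hy : y ∈ vset Y)
    (h : X.Adj x y) : s(x, y) ∈ Y := by
  by_contra h'
  have hadj : (X.deleteEdges Y).Adj x y := (deleteEdges_adj ..).2 ⟨h, h'⟩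
  exact h.ne (hY.eq_of_reachable hx hy hadj.reachable)

end IsBlock

/-- The edges in `F`, and those that are attached to the block `Y` at a vertex in `W`. -/
def ext (X : SimpleGraph V) (Y F : Set (Sym2 V)) (W : Set V) : Set (Sym2 V) :=
  {e | e ∈ X.edgeSet ∧ (e ∈ F ∨ (e ∉ Y ∧ ∃ w ∈ W, w ∈ vset Y ∧
    ∃ x ∈ e, (X.deleteEdges Y).Reachable x w))}

variable {Y Y' F F' M : Set (Sym2 V)} {W W' : Set V}

theorem ext_subset : ext X Y F W ⊆ X.edgeSet := fun _ h => h.1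

theorem mem_ext_of_mem (hY : IsBlock X Y) {e : Sym2 V} (he : e ∈ Y) :
    e ∈ ext X Y F W ↔ e ∈ F :=
  ⟨fun h => h.2.resolve_right fun h' => h'.1 he, fun h => ⟨hY.subset he, Or.inl h⟩⟩

/-- Because the vertex of attachment is unique, `W` decides independently for each vertex of the
block what happens to the part hanging there. -/
theorem mem_ext_of_reachable (hY : IsBlock X Y) (hF : F ⊆ Y) {e : Sym2 V} (he : e ∈ X.edgeSet)
    (heY : e ∉ Y) {x w : V} (hx : x ∈ e) (hw : w ∈ vset Y)
    (hxw : (X.deleteEdges Y).Reachable x w) : e ∈ ext X Y F W ↔ w ∈ W := by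
  constructor
  · rintro ⟨-, h | ⟨-, w', hw', hw'Y, y, hy, hyw'⟩⟩
    · exact absurd (hF h) heY
    · have hxy : (X.deleteEdges Y).Reachable y x := by
        by_cases hne : y = x
        · exact hne ▸ .rfl
        · have : e = s(y, x) := (Sym2.mem_and_mem_iff hne).1 ⟨hy, hx⟩
          subst this
          exact ((deleteEdges_adj ..).2 ⟨he, heY⟩ : (X.deleteEdges Y).Adj y x).reachable
      rwa [hY.eq_of_reachable hw hw'Y ((hxw.symm.trans hxy.symm).trans hyw')]
  · exact fun h => ⟨he, Or.inr ⟨heY, w, h, hw, x, hx, hxw⟩⟩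

theorem ext_inter (hY : IsBlock X Y) (hF : F ⊆ Y) : ext X Y F W ∩ Y = F := by
  ext e
  constructor
  · rintro ⟨h, he⟩
    exact (mem_ext_of_mem hY he).1 h
  · intro h
    exact ⟨(mem_ext_of_mem hY (hF h)).2 h, hF h⟩

theorem subset_ext (hY : IsBlock X Y) (hF : F ⊆ Y) : F ⊆ ext X Y F W :=
  fun _ h => (mem_ext_of_mem hY (hF h)).2 h

theorem exists_attach (hX : X.Connected) (hY : IsBlock X Y) (e : Sym2 V) :
    ∃ x ∈ e, ∃ w ∈ vset Y, (X.deleteEdges Y).Reachable x w := by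
  induction e with
  | h x y =>
    obtain ⟨w, hw, h⟩ := hY.exists_reachable hX x
    exact ⟨x, by simp, w, hw, h⟩

theorem sdiff_ext (hX : X.Connected) (hY : IsBlock X Y) (hF : F ⊆ Y) :
    X.edgeSet \ ext X Y F W = ext X Y (Y \ F) Wᶜ := by
  ext e
  by_cases heX : e ∈ X.edgeSet
  · by_cases he : e ∈ Y
    · rw [mem_ext_of_mem hY he, Set.mem_sdiff, mem_ext_of_mem hY he, Set.mem_sdiff]
      tauto
    · obtain ⟨x, hx, w, hw, h⟩ := exists_attach hX hY e
      rw [mem_ext_of_reachable hY Set.sdiff_subset heX he hx hw h, Set.mem_sdiff,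
        mem_ext_of_reachable hY hF heX he hx hw h, Set.mem_compl_iff]
      tauto
  · exact ⟨fun h => absurd h.1 heX, fun h => absurd h.1 heX⟩

theorem ext_mono (hF : F ⊆ F') (hW : ∀ w ∈ vset Y, w ∈ W → w ∈ W') :
    ext X Y F W ⊆ ext X Y F' W' := by
  rintro e ⟨he, h | ⟨h, w, hw, hwY, h'⟩⟩
  · exact ⟨he, Or.inl (hF h)⟩
  · exact ⟨he, Or.inr ⟨h, w, hW w hwY hw, hwY, h'⟩⟩

/-- If the part hanging at each vertex off the boundary of `F` follows the side of that vertex, no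
new boundary vertex arises. At the boundary vertices themselves `W` remains arbitrary. -/
theorem bd_ext (hX : X.Connected) (hY : IsBlock X Y) (hF : F ⊆ Y)
    (hW : ∀ w ∈ vset Y, w ∉ bd Y F → (w ∈ W ↔ w ∈ vset F)) :
    bd X.edgeSet (ext X Y F W) = bd Y F := by
  ext x
  constructor
  · rintro ⟨⟨e, he, hxe⟩, ⟨e', he', hxe'⟩⟩
    have heX := he.1
    have heX' := he'.1
    by_contra hxF
    by_cases hxY : x ∈ vset Y
    · have key : ∀ d ∈ X.edgeSet, x ∈ d → (d ∈ ext X Y F W ↔ x ∈ vset F) := by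
        intro d hd hxd
        by_cases hdY : d ∈ Y
        · rw [mem_ext_of_mem hY hdY]
          exact ⟨fun h => ⟨d, h, hxd⟩, fun h => mem_bd_or h hxF hdY hxd⟩
        · rw [mem_ext_of_reachable hY hF hd hdY hxd hxY .rfl]
          exact hW x hxY hxF
      exact he'.2 ((key e' heX' hxe').2 ((key e heX hxe).1 he))
    · obtain ⟨w, hw, h⟩ := hY.exists_reachable hX x
      have key : ∀ d ∈ X.edgeSet, x ∈ d → (d ∈ ext X Y F W ↔ w ∈ W) := fun d hd hxd =>
        mem_ext_of_reachable hY hF hd (fun hdY => hxY ⟨d, hdY, hxd⟩) hxd hw h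
      exact he'.2 ((key e' heX' hxe').2 ((key e heX hxe).1 he))
  · rintro ⟨⟨e, he, hxe⟩, ⟨e', he', hxe'⟩⟩
    exact ⟨⟨e, (mem_ext_of_mem hY (hF he)).2 he, hxe⟩,
      ⟨e', ⟨hY.subset he'.1, fun h => he'.2 ((mem_ext_of_mem hY he'.1).1 h)⟩, hxe'⟩⟩

/-- Blocks are two-connected. -/
theorem IsBlock.not_bd_subset (hX : X.Connected) (hY : IsBlock X Y) (hF : F ⊆ Y)
    (h1 : F.Nonempty) (h2 : (Y \ F).Nonempty) (c : V) : ¬ bd Y F ⊆ {c} := by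
  intro hc
  -- The extension would be a set with one boundary vertex that splits the block, contrary to the
  -- definition of blocks.
  have hbd : bd X.edgeSet (ext X Y F (vset F)) = bd Y F :=
    bd_ext hX hY hF fun w _ _ => Iff.rfl
  obtain ⟨e, he⟩ := h1
  obtain ⟨f, hf⟩ := h2
  have he' := (mem_ext_of_mem (X := X) (F := F) (W := vset F) hY (hF he)).2 he
  have hf' : f ∉ ext X Y F (vset F) := fun h => hf.2 ((mem_ext_of_mem hY hf.1).1 h)
  have hne := bd_nonempty hX ⟨e, he'⟩ ⟨f, hY.subset hf.1, hf'⟩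
  rw [hbd] at hne
  have hM : OneSep X (ext X Y F (vset F)) :=
    ⟨ext_subset, c, by rw [hbd]; exact hne.subset_singleton_iff.1 hc⟩
  rcases hY.subset_or hM with h | h
  · exact hf' (h hf.1)
  · exact (h (hF he)).2 he'

/-- Sets defined by a block are not crossed by sets with one boundary vertex. -/
theorem OneSep.subset_ext_or (hX : X.Connected) (hY : IsBlock X Y) (hF : F ⊆ Y) (hM : OneSep X M)
    (hYM : Y ⊆ X.edgeSet \ M) : M ⊆ ext X Y F W ∨ M ⊆ X.edgeSet \ ext X Y F W := by
  obtain ⟨c, hc⟩ := hM.2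
  obtain ⟨w, hw, hcw⟩ := hY.exists_reachable hX c
  -- All of `M` is joined to its boundary vertex without using edges of `Y`, so all of it hangs at
  -- the same vertex `w` and is included or excluded as a whole.
  have key : ∀ x ∈ vset M, (X.deleteEdges Y).Reachable x c := by
    intro x hx
    obtain ⟨y, hy⟩ := vset_nonempty (hY.nonempty.mono hYM)
    obtain ⟨p⟩ := hX.preconnected x y
    induction p with
    | nil =>
      have : _ ∈ bd X.edgeSet M := ⟨hx, hy⟩
      rw [hc] at this
      exact this ▸ .rfl
    | @cons a b d hab p ih =>
      by_cases hac : a = c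
      · exact hac ▸ .rfl
      · have h1 : s(a, b) ∈ M := mem_bd_or hx (by rw [hc]; exact hac) hab (by simp)
        refine Reachable.trans (Adj.reachable ?_) (ih ⟨_, h1, by simp⟩ hy)
        exact (deleteEdges_adj ..).2 ⟨hab, fun h => (hYM h).2 h1⟩
  have key2 : ∀ e ∈ M, e ∈ ext X Y F W ↔ w ∈ W := by
    intro e he
    obtain ⟨x, hx, -⟩ := exists_attach hX hY e
    exact mem_ext_of_reachable hY hF (hM.1 he) (fun h => (hYM h).2 he) hx hw
      ((key x ⟨e, he, hx⟩).trans hcw)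
  by_cases h : w ∈ W
  · exact Or.inl fun e he => (key2 e he).2 h
  · exact Or.inr fun e he => ⟨hM.1 he, fun h' => h ((key2 e he).1 h')⟩

theorem OneSep.nested_ext (hX : X.Connected) (hY : IsBlock X Y) (hF : F ⊆ Y) (hM : OneSep X M) :
    Nested X.edgeSet M (ext X Y F W) := by
  rcases hY.subset_or hM with h | h
  · have := OneSep.subset_ext_or (W := W) hX hY hF hM.compl (by rwa [sdiff_sdiff_of_subset hM.1])
    exact Or.inr (Or.inr this)
  · rcases OneSep.subset_ext_or (W := W) hX hY hF hM h with h | h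
    · exact Or.inl h
    · exact Or.inr (Or.inl h)

/-- In a block, the two vertices of the boundary of `F` are connected within `F`. -/
theorem IsBlock.reachable_of_bd (hX : X.Connected) (hY : IsBlock X Y) (hF : F ⊆ Y) {u v : V}
    (huv : u ≠ v) (h : bd Y F = {u, v}) : (fromEdgeSet F).Reachable u v := by
  by_contra hno
  -- The part of `F` connected to `u` would have no boundary vertex other than `u`, which
  -- contradicts two-connectedness.
  let K : Set (Sym2 V) := {e | e ∈ F ∧ ∃ x ∈ e, (fromEdgeSet F).Reachable u x}
  have hKF : K ⊆ F := fun e he => he.1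
  have hall : ∀ e ∈ K, ∀ x ∈ e, (fromEdgeSet F).Reachable u x := by
    rintro e ⟨he, y, hy, huy⟩ x hx
    by_cases hxy : y = x
    · exact hxy ▸ huy
    · have : e = s(y, x) := (Sym2.mem_and_mem_iff hxy).1 ⟨hy, hx⟩
      subst this
      exact huy.trans (((fromEdgeSet_adj ..).2 ⟨he, hxy⟩ : (fromEdgeSet F).Adj y x).reachable)
  have hu : u ∈ bd Y F := by simp [h]
  have hv : v ∈ bd Y F := by simp [h]
  obtain ⟨e, he, hue⟩ := hu.1
  obtain ⟨f, hf, -⟩ := hv.2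
  refine hY.not_bd_subset hX (hKF.trans hF) ⟨e, he, u, hue, .rfl⟩
    ⟨f, hf.1, fun h => hf.2 (hKF h)⟩ u ?_
  rintro x ⟨⟨a, ha, hxa⟩, ⟨b, hb, hxb⟩⟩
  have hx := hall a ha x hxa
  have hxF : x ∈ bd Y F := ⟨⟨a, hKF ha, hxa⟩, b, ⟨hb.1, fun h => hb.2 ⟨h, x, hxb, hx⟩⟩, hxb⟩
  rw [h] at hxF
  rcases hxF with rfl | hxv
  · rfl
  · exact absurd (Set.mem_singleton_iff.1 hxv ▸ hx) hno

/-- The edges at the component of `x` after removal of `c`. -/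
def lobe (X : SimpleGraph V) (c x : V) : Set (Sym2 V) :=
  {e | e ∈ X.edgeSet ∧ ∃ y ∈ e, ∃ p : X.Walk x y, c ∉ p.support}

theorem mem_lobe_of_walk {c x y : V} (p : X.Walk x y) (hp : c ∉ p.support) {e : Sym2 V}
    (he : e ∈ X.edgeSet) (hy : y ∈ e) : e ∈ lobe X c x := ⟨he, y, hy, p, hp⟩

theorem exists_walk_of_mem_lobe {c x y : V} {e : Sym2 V} (he : e ∈ lobe X c x) (hy : y ∈ e)
    (hyc : y ≠ c) : ∃ p : X.Walk x y, c ∉ p.support := by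
  obtain ⟨he, z, hz, p, hp⟩ := he
  by_cases hzy : z = y
  · exact hzy ▸ ⟨p, hp⟩
  · have : e = s(z, y) := (Sym2.mem_and_mem_iff hzy).1 ⟨hz, hy⟩
    subst this
    have he : X.Adj z y := he
    refine ⟨p.concat he, ?_⟩
    rw [Walk.support_concat, List.mem_append, List.mem_singleton]
    rintro (h | h)
    · exact hp h
    · exact hyc h.symm

theorem bd_lobe_subset {c x : V} : bd X.edgeSet (lobe X c x) ⊆ {c} := by
  rintro z ⟨⟨e, he, hze⟩, ⟨f, hf, hzf⟩⟩
  by_contra hzc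
  obtain ⟨p, hp⟩ := exists_walk_of_mem_lobe he hze hzc
  exact hf.2 (mem_lobe_of_walk p hp hf.1 hzf)

theorem lobe_subset {c x : V} (hc : bd X.edgeSet M = {c}) (hx : x ∈ vset M) :
    lobe X c x ⊆ M := by
  rintro e ⟨he, y, hy, p, hp⟩
  have hyM := mem_vset_of_walk p hx (by
    intro z hz _ hz'
    rw [hc] at hz'
    exact hp (Set.mem_singleton_iff.1 hz' ▸ hz))
  refine mem_bd_or hyM ?_ he hy
  rw [hc]
  rintro rfl
  exact hp (by simp)

theorem bd_eq_of_subset_singleton (hX : X.Connected) (h1 : F.Nonempty)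
    (h2 : (X.edgeSet \ F).Nonempty) {c : V} (h : bd X.edgeSet F ⊆ {c}) : bd X.edgeSet F = {c} :=
  (bd_nonempty hX h1 h2).subset_singleton_iff.1 h

/-- The vertex `d` is inside the lobe, so the complement of the lobe avoids it. That complement is
connected through `c`, hence lies on the side of `N` that contains `c`. -/
theorem nested_lobe_of_walk {c d x : V} (hX : X.Connected) (hc : bd X.edgeSet (lobe X c x) = {c})
    {N : Set (Sym2 V)} (hd : bd X.edgeSet N = {d}) (q : X.Walk x d)
    (hq : c ∉ q.support) (hcN : c ∈ vset N) : X.edgeSet \ lobe X c x ⊆ N := by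
  have hL : lobe X c x ⊆ X.edgeSet := fun e he => he.1
  have hdL : ∀ e ∈ X.edgeSet, d ∈ e → e ∈ lobe X c x := fun e he hde => mem_lobe_of_walk q hq he hde
  have hcd : c ≠ d := by rintro rfl; exact hq (by simp)
  have key : ∀ {y z : V} (p : X.Walk y z), z = c → y ∈ vset (X.edgeSet \ lobe X c x) →
      ∀ e ∈ X.edgeSet, y ∈ e → e ∈ N := by
    intro y z p
    induction p with
    | nil =>
      rintro rfl _ e he hye
      exact mem_bd_or hcN (by rw [hd]; exact hcd) he hye
    | @cons a b z hab p ih =>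
      intro hz ha e he hae
      by_cases hac : a = c
      · subst hac
        exact mem_bd_or hcN (by rw [hd]; exact hcd) he hae
      · have hab' : s(a, b) ∈ X.edgeSet \ lobe X c x :=
          mem_bd_or (Y := X.edgeSet) ha (by rw [bd_sdiff hL, hc]; exact hac) hab (by simp)
        have h1 := ih hz ⟨_, hab', by simp⟩ s(a, b) hab (by simp)
        refine mem_bd_or ⟨_, h1, by simp⟩ ?_ he hae
        rw [hd]
        rintro rfl
        exact hab'.2 (hdL _ hab (by simp))
  intro e he
  induction e with
  | h y z =>
    obtain ⟨p⟩ := hX.preconnected y c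
    exact key p rfl ⟨_, he, by simp⟩ _ he.1 (by simp)

/-- Let `d` be the boundary vertex of `N`. If `d` can be reached from `x` avoiding `c`, then the
complement of the lobe lies on one side of `N`; otherwise the component of `x` avoids `d`, and the
lobe itself lies on one side. -/
theorem nested_lobe [Nontrivial V] {c x : V} (hX : X.Connected)
    (hc : bd X.edgeSet (lobe X c x) = {c})
    {N : Set (Sym2 V)} (hN : OneSep X N) : Nested X.edgeSet (lobe X c x) N := by
  have hcases : ∀ z : V, z ∈ vset N ∨ z ∈ vset (X.edgeSet \ N) := by
    intro z
    have : z ∈ vset X.edgeSet := by rw [vset_edgeSet hX]; trivial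
    obtain ⟨e, he, hz⟩ := this
    by_cases h : e ∈ N
    · exact Or.inl ⟨e, h, hz⟩
    · exact Or.inr ⟨e, ⟨he, h⟩, hz⟩
  obtain ⟨d, hd⟩ := hN.2
  have hd' : bd X.edgeSet (X.edgeSet \ N) = {d} := by rw [bd_sdiff hN.1, hd]
  by_cases h : ∃ q : X.Walk x d, c ∉ q.support
  · obtain ⟨q, hq⟩ := h
    rcases hcases c with h1 | h1
    · exact Or.inr (Or.inr (Or.inl (nested_lobe_of_walk hX hc hd q hq h1)))
    · exact Or.inr (Or.inr (Or.inr (nested_lobe_of_walk hX hc hd' q hq h1)))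
  · classical
    have key : ∀ N ⊆ X.edgeSet, bd X.edgeSet N = {d} → x ∈ vset N → lobe X c x ⊆ N := by
      rintro N hN hd hx e ⟨he, y, hy, p, hp⟩
      have hdp : d ∉ p.support := fun hdp =>
        h ⟨p.takeUntil d hdp, fun h' => hp (p.support_takeUntil_subset_support hdp h')⟩
      have hyN := mem_vset_of_walk p hx (by
        intro z hz _ hz'
        rw [hd] at hz'
        exact hdp (Set.mem_singleton_iff.1 hz' ▸ hz))
      refine mem_bd_or hyN ?_ he hy
      rw [hd]
      rintro rfl
      exact hdp (by simp)
    rcases hcases x with h1 | h1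
    · exact Or.inl (key N hN.1 hd h1)
    · exact Or.inr (Or.inl (key _ Set.sdiff_subset hd' h1))

/-- Inside a set with one boundary vertex, each further vertex lies in an uncrossed one. -/
theorem OneSep.exists_nested [Nontrivial V] (hX : X.Connected) (hM : OneSep X M) {x : V}
    (hx : x ∈ vset M) (hxb : x ∉ bd X.edgeSet M) :
    ∃ L, OneSep X L ∧ (∀ N, OneSep X N → Nested X.edgeSet L N) ∧ L ⊆ M ∧ x ∈ vset L ∧
      x ∉ vset (X.edgeSet \ L) := by
  obtain ⟨c, hc⟩ := hM.2
  have hxc : c ∉ (Walk.nil : X.Walk x x).support := by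
    rw [hc] at hxb
    simpa using Ne.symm hxb
  have hsub := lobe_subset hc hx
  have hxL : ∀ e ∈ X.edgeSet, x ∈ e → e ∈ lobe X c x := fun e he hxe =>
    mem_lobe_of_walk .nil hxc he hxe
  obtain ⟨e, he, hxe⟩ := hx
  have hcM : c ∈ bd X.edgeSet M := by simp [hc]
  obtain ⟨f, hf, -⟩ := hcM.2
  have hL : bd X.edgeSet (lobe X c x) = {c} :=
    bd_eq_of_subset_singleton hX ⟨e, hxL e (hM.1 he) hxe⟩
      ⟨f, hf.1, fun h => hf.2 (hsub h)⟩ bd_lobe_subset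
  refine ⟨lobe X c x, ⟨fun e he => he.1, c, hL⟩, fun N hN => nested_lobe hX hL hN, hsub,
    ⟨e, hxL e (hM.1 he) hxe, hxe⟩, ?_⟩
  rintro ⟨f, hf, hxf⟩
  exact hf.2 (hxL f hf.1 hxf)

end Blocks
end TutteTree

/-! ### The canonical family: nestedness and finiteness -/

namespace TutteTree
section Family
open SimpleGraph
variable {V : Type*} {X : SimpleGraph V}

/-- The subsets of `Y` with two boundary vertices. -/
def TwoBd (Y F : Set (Sym2 V)) : Prop := F ⊆ Y ∧ ∃ u v, u ≠ v ∧ bd Y F = {u, v}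

/-- The subsets of `Y` with two boundary vertices that are crossed by no other such subset. -/
def Uncrossed (Y F : Set (Sym2 V)) : Prop := TwoBd Y F ∧ ∀ F', TwoBd Y F' → Nested Y F F'

/-- The number of uncrossed subsets of `F` with `w` in their boundary. -/
noncomputable def weight (Y : Set (Sym2 V)) (w : V) (F : Set (Sym2 V)) : ℕ :=
  {F' | Uncrossed Y F' ∧ F' ⊆ F ∧ w ∈ bd Y F'}.ncard

/-- The vertices at which `F` outweighs its complement. -/
def heavy (Y F : Set (Sym2 V)) : Set V := {w | weight Y w (Y \ F) < weight Y w F}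

/-- The vertices at which `F` is not outweighed by its complement. -/
def notLight (Y F : Set (Sym2 V)) : Set V := {w | weight Y w (Y \ F) ≤ weight Y w F}

/-- The two canonical extensions to `X` of a subset of a block. -/
def IsVersion (X : SimpleGraph V) (Y F B : Set (Sym2 V)) : Prop :=
  B = ext X Y F (heavy Y F) ∨ B = ext X Y F (notLight Y F)

/-- Neither `F` nor its complement is a single edge. -/
def Nontriv (Y F : Set (Sym2 V)) : Prop := (∀ e, F ≠ {e}) ∧ ∀ e, Y \ F ≠ {e}

/-- The uncrossed sets with one boundary vertex. -/
def oneFam (X : SimpleGraph V) : Set (Set (Sym2 V)) :=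
  {M | OneSep X M ∧ ∀ N, OneSep X N → Nested X.edgeSet M N}

/-- The canonical extensions of the uncrossed subsets of blocks with two boundary vertices. -/
def twoFam (X : SimpleGraph V) : Set (Set (Sym2 V)) :=
  {B | ∃ Y F, IsBlock X Y ∧ Uncrossed Y F ∧ Nontriv Y F ∧ IsVersion X Y F B}

/-- The edge sets of the canonical separations. -/
def fam (X : SimpleGraph V) : Set (Set (Sym2 V)) := oneFam X ∪ twoFam X

variable {Y Y' F F' B B' M : Set (Sym2 V)} {w : V}

theorem TwoBd.compl (h : TwoBd Y F) : TwoBd Y (Y \ F) :=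
  ⟨Set.sdiff_subset, by rw [bd_sdiff h.1]; exact h.2⟩

theorem TwoBd.nonempty (h : TwoBd Y F) : F.Nonempty := by
  obtain ⟨-, u, v, -, h⟩ := h
  have : u ∈ bd Y F := by simp [h]
  obtain ⟨e, he, -⟩ := this.1
  exact ⟨e, he⟩

theorem Uncrossed.compl (h : Uncrossed Y F) : Uncrossed Y (Y \ F) :=
  ⟨h.1.compl, fun F' hF' => (h.2 F' hF').compl_left h.1.1⟩

theorem Nontriv.compl (hF : F ⊆ Y) (h : Nontriv Y F) : Nontriv Y (Y \ F) :=
  ⟨h.2, by rw [sdiff_sdiff_of_subset hF]; exact h.1⟩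

/-- Strict and weak majority are exchanged by complementation. This is why both versions must belong
to the family. -/
theorem heavy_compl (hF : F ⊆ Y) : heavy Y (Y \ F) = (notLight Y F)ᶜ := by
  ext w
  simp [heavy, notLight, sdiff_sdiff_of_subset hF]

theorem notLight_compl (hF : F ⊆ Y) : notLight Y (Y \ F) = (heavy Y F)ᶜ := by
  ext w
  simp [heavy, notLight, sdiff_sdiff_of_subset hF]

theorem heavy_subset_notLight : heavy Y F ⊆ notLight Y F :=
  fun w h => (le_of_lt h : weight Y w (Y \ F) ≤ weight Y w F)

theorem IsVersion.compl (hX : X.Connected) (hY : IsBlock X Y) (hF : F ⊆ Y)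
    (h : IsVersion X Y F B) : IsVersion X Y (Y \ F) (X.edgeSet \ B) := by
  rcases h with rfl | rfl
  · right
    rw [sdiff_ext hX hY hF, notLight_compl hF]
  · left
    rw [sdiff_ext hX hY hF, heavy_compl hF]

theorem IsVersion.exists_eq (h : IsVersion X Y F B) : ∃ W, B = ext X Y F W := by
  rcases h with h | h
  · exact ⟨_, h⟩
  · exact ⟨_, h⟩

/-- A set of edges is determined by its boundary and its edges there. -/
theorem eq_of_bd_eq (hX : X.Connected) (hB : B ⊆ X.edgeSet) (hB' : B' ⊆ X.edgeSet)
    (hne : (bd X.edgeSet B).Nonempty) (h : bd X.edgeSet B = bd X.edgeSet B')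
    (ht : ∀ e ∈ X.edgeSet, ∀ x ∈ bd X.edgeSet B, x ∈ e → (e ∈ B ↔ e ∈ B')) : B = B' := by
  obtain ⟨c, hc⟩ := hne
  have hside : ∀ {B : Set (Sym2 V)} {y : V}, y ∉ bd X.edgeSet B → ∀ e ∈ X.edgeSet,
      ∀ f ∈ X.edgeSet, y ∈ e → y ∈ f → e ∈ B → f ∈ B := fun hy e _ f hf hye hyf heB =>
    mem_bd_or ⟨e, heB, hye⟩ hy hf hyf
  have key : ∀ {y z : V} (_ : X.Walk y z), z = c → ∀ e ∈ X.edgeSet, y ∈ e → (e ∈ B ↔ e ∈ B') := by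
    intro y z p
    induction p with
    | nil =>
      rintro rfl e he hye
      exact ht e he _ hc hye
    | @cons a b z hab p ih =>
      rintro hz e he hae
      by_cases ha : a ∈ bd X.edgeSet B
      · exact ht e he a ha hae
      · have ha' := ha
        rw [h] at ha'
        have h1 := ih hz s(a, b) hab (by simp)
        have hm : a ∈ s(a, b) := by simp
        constructor
        · intro heB
          exact hside ha' _ hab _ he hm hae (h1.1 (hside ha _ he _ hab hae hm heB))
        · intro heB
          exact hside ha _ hab _ he hm hae (h1.2 (hside ha' _ he _ hab hae hm heB))
  ext e
  induction e with
  | h x y =>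
    obtain ⟨p⟩ := hX.preconnected x c
    constructor
    · intro he
      exact (key p rfl _ (hB he) (by simp)).1 he
    · intro he
      exact (key p rfl _ (hB' he) (by simp)).2 he

/-- By `eq_of_bd_eq`, such a set is determined by its boundary and by its trace on the finitely many
edges that meet `K`. -/
theorem finite_of_bd_subset (hX : X.Connected) (hlf : ∀ v, (X.neighborSet v).Finite) {K : Set V}
    (hK : K.Finite) :
    {B | B ⊆ X.edgeSet ∧ (bd X.edgeSet B).Nonempty ∧ bd X.edgeSet B ⊆ K}.Finite := by
  let D : Set (Sym2 V) := {e | e ∈ X.edgeSet ∧ ∃ x ∈ K, x ∈ e}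
  have hD : D.Finite := by
    refine (hK.biUnion fun x _ => (hlf x).image fun y => s(x, y)).subset ?_
    rintro e ⟨he, x, hx, hxe⟩
    obtain ⟨y, rfl⟩ := Sym2.mem_iff_exists.1 hxe
    exact Set.mem_biUnion hx ⟨y, he, rfl⟩
  refine Set.Finite.of_finite_image (f := fun B => (bd X.edgeSet B, B ∩ D))
    ((hK.powerset.prod hD.powerset).subset ?_) ?_
  · rintro _ ⟨B, hB, rfl⟩
    exact ⟨hB.2.2, Set.inter_subset_right⟩
  · rintro B hB B' hB' h
    rw [Prod.mk.injEq] at h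
    refine eq_of_bd_eq hX hB.1 hB'.1 hB.2.1 h.1 fun e he x hx hxe => ?_
    have heD : e ∈ D := ⟨he, x, hB.2.2 hx, hxe⟩
    have := Set.ext_iff.1 h.2 e
    simpa [heD] using this

/-- The boundaries at a given vertex, of sets with two boundary vertices in a block, lie in a finite
set. -/
theorem exists_finite_of_twoBd (hX : X.Connected) (hlf : ∀ v, (X.neighborSet v).Finite) (u : V) :
    ∃ K : Set V, K.Finite ∧ u ∈ K ∧ ∀ Y F, IsBlock X Y → TwoBd Y F → u ∈ bd Y F → bd Y F ⊆ K := by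
  classical
  -- For each pair of neighbours of `u` one walk avoiding `u` is fixed, if there is one. The other
  -- boundary vertex will be shown to lie on one of these walks.
  let S : V → V → Set V := fun a b =>
    if h : ∃ p : X.Walk a b, u ∉ p.support then {x | x ∈ h.choose.support} else ∅
  have hS : ∀ a b, (S a b).Finite := by
    intro a b
    by_cases h : ∃ p : X.Walk a b, u ∉ p.support
    · simp only [S, dif_pos h]
      exact List.finite_toSet _
    · simp only [S, dif_neg h]
      exact Set.finite_empty
  refine ⟨{u} ∪ ⋃ a ∈ X.neighborSet u, ⋃ b ∈ X.neighborSet u, S a b,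
    (Set.finite_singleton u).union ((hlf u).biUnion fun a _ => (hlf u).biUnion fun b _ => hS a b),
    by simp, ?_⟩
  intro Y F hY hF hu
  obtain ⟨hFY, u', v, huv, hbd⟩ := hF
  obtain ⟨v, huv, hbd⟩ : ∃ v, u ≠ v ∧ bd Y F = {u, v} := by
    have hu' := hu
    rw [hbd] at hu'
    rcases hu' with rfl | hu'
    · exact ⟨v, huv, hbd⟩
    · rw [Set.mem_singleton_iff] at hu'
      subst hu'
      exact ⟨u', huv.symm, by rw [hbd, Set.pair_comm]⟩
  obtain ⟨a, ha⟩ := mem_vset_iff.1 hu.1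
  obtain ⟨b, hb⟩ := mem_vset_iff.1 hu.2
  have haX : X.Adj u a := hY.subset (hFY ha)
  have hbX : X.Adj u b := hY.subset hb.1
  -- Otherwise the lobe of `a` at `u` would contain one of two edges of the block at `u` but not the
  -- other.
  have hex : ∃ p : X.Walk a b, u ∉ p.support := by
    by_contra hno
    have h1 : s(u, a) ∈ lobe X u a := mem_lobe_of_walk .nil (by simpa using haX.ne) haX (by simp)
    have h2 : s(u, b) ∉ lobe X u a := fun h => hno (exists_walk_of_mem_lobe h (by simp) hbX.ne')
    have h3 : OneSep X (lobe X u a) := ⟨fun e he => he.1, u,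
      bd_eq_of_subset_singleton hX ⟨_, h1⟩ ⟨_, hbX, h2⟩ bd_lobe_subset⟩
    rcases hY.subset_or h3 with h | h
    · exact h2 (h hb.1)
    · exact (h (hFY ha)).2 h1
  have hv : v ∈ S a b := by
    simp only [S, dif_pos hex]
    have hp := hex.choose_spec
    generalize hex.choose = p at hp
    -- A walk that avoids both boundary vertices cannot lead from the extension of `F` to its
    -- complement, but `a` and `b` lie on different sides.
    by_contra hvp
    change v ∉ p.support at hvp
    have hbe : bd X.edgeSet (ext X Y F (vset F)) = {u, v} := by
      rw [bd_ext hX hY hFY fun _ _ _ => Iff.rfl, hbd]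
    have hno : ∀ z ∈ p.support, z ∉ bd X.edgeSet (ext X Y F (vset F)) := by
      intro z hz hz'
      rw [hbe] at hz'
      rcases hz' with rfl | hz'
      · exact hp hz
      · exact hvp (Set.mem_singleton_iff.1 hz' ▸ hz)
    have h1 := mem_vset_of_walk p ⟨_, subset_ext hY hFY ha, by simp⟩
      fun z hz _ => hno z hz
    refine hno b (by simp) ⟨h1, s(u, b), ⟨hbX, fun h => ?_⟩, by simp⟩
    exact hb.2 ((mem_ext_of_mem hY hb.1).1 h)
  rw [hbd]
  rintro x (rfl | hx)
  · exact Or.inl rfl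
  · rw [Set.mem_singleton_iff] at hx
    subst hx
    exact Or.inr (Set.mem_biUnion haX (Set.mem_biUnion hbX hv))

theorem finite_twoBd (hX : X.Connected) (hlf : ∀ v, (X.neighborSet v).Finite) (hY : IsBlock X Y)
    (w : V) : {F | TwoBd Y F ∧ w ∈ bd Y F}.Finite := by
  obtain ⟨K, hK, -, hKw⟩ := exists_finite_of_twoBd hX hlf w
  refine Set.Finite.of_finite_image (f := fun F => ext X Y F (vset F))
    ((finite_of_bd_subset hX hlf hK).subset ?_) ?_
  · rintro _ ⟨F, ⟨hF, hw⟩, rfl⟩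
    have hbd : bd X.edgeSet (ext X Y F (vset F)) = bd Y F :=
      bd_ext hX hY hF.1 fun _ _ _ => Iff.rfl
    exact ⟨ext_subset, by rw [hbd]; exact ⟨w, hw⟩, by rw [hbd]; exact hKw Y F hY hF hw⟩
  · rintro F ⟨hF, -⟩ F' ⟨hF', -⟩ h
    rw [← ext_inter (W := vset F) hY hF.1, ← ext_inter (W := vset F') hY hF'.1]
    exact congrArg (· ∩ Y) h

theorem finite_weight (hX : X.Connected) (hlf : ∀ v, (X.neighborSet v).Finite) (hY : IsBlock X Y)
    (w : V) (F : Set (Sym2 V)) : {F' | Uncrossed Y F' ∧ F' ⊆ F ∧ w ∈ bd Y F'}.Finite :=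
  (finite_twoBd hX hlf hY w).subset fun _ h => ⟨h.1.1, h.2.2⟩

/-- Single edges count in the weights, so each side of `F` that touches a vertex has positive weight
there. -/
theorem uncrossed_singleton (hX : X.Connected) (hY : IsBlock X Y) {e f : Sym2 V} (he : e ∈ Y)
    (hf : f ∈ Y) (hef : e ≠ f) : Uncrossed Y {e} ∧ ∀ x ∈ e, x ∈ bd Y {e} := by
  have hsub : ({e} : Set (Sym2 V)) ⊆ Y := Set.singleton_subset_iff.2 he
  have hnot := hY.not_bd_subset hX hsub ⟨e, rfl⟩ ⟨f, hf, hef.symm⟩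
  have hbd : ∀ x ∈ bd Y {e}, x ∈ e := by
    rintro x ⟨⟨d, rfl, hx⟩, -⟩
    exact hx
  have hne : ∀ F', Nested Y {e} F' := by
    intro F'
    by_cases h : e ∈ F'
    · exact Or.inl (Set.singleton_subset_iff.2 h)
    · exact Or.inr (Or.inl (Set.singleton_subset_iff.2 ⟨he, h⟩))
  induction e with
  | h a b =>
    have hab : a ≠ b := (hY.subset he : X.Adj a b).ne
    have hmem : ∀ x ∈ s(a, b), x ∈ bd Y {s(a, b)} := by
      intro x hx
      by_contra hxb
      rw [Sym2.mem_iff] at hx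
      rcases hx with rfl | rfl
      · refine hnot b fun y hy => ?_
        rcases Sym2.mem_iff.1 (hbd y hy) with rfl | rfl
        · exact absurd hy hxb
        · rfl
      · refine hnot a fun y hy => ?_
        rcases Sym2.mem_iff.1 (hbd y hy) with rfl | rfl
        · rfl
        · exact absurd hy hxb
    refine ⟨⟨⟨hsub, a, b, hab, ?_⟩, fun F' _ => hne F'⟩, hmem⟩
    ext x
    rw [Set.mem_insert_iff, Set.mem_singleton_iff, ← Sym2.mem_iff]
    exact ⟨hbd x, hmem x⟩

theorem weight_mono (hX : X.Connected) (hlf : ∀ v, (X.neighborSet v).Finite) (hY : IsBlock X Y)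
    (h : F ⊆ F') : weight Y w F ≤ weight Y w F' :=
  Set.ncard_le_ncard (fun _ hD => ⟨hD.1, hD.2.1.trans h, hD.2.2⟩) (finite_weight hX hlf hY w F')

theorem weight_eq_zero (hw : w ∉ vset F) : weight Y w F = 0 := by
  have : {F' | Uncrossed Y F' ∧ F' ⊆ F ∧ w ∈ bd Y F'} = ∅ := by
    refine Set.eq_empty_of_forall_notMem fun D hD => hw (vset_mono hD.2.1 hD.2.2.1)
  rw [weight, this, Set.ncard_empty]

theorem weight_pos (hX : X.Connected) (hlf : ∀ v, (X.neighborSet v).Finite) (hY : IsBlock X Y)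
    (hF : F ⊆ Y) (hne : (Y \ F).Nonempty) (hw : w ∈ vset F) : 0 < weight Y w F := by
  obtain ⟨e, he, hwe⟩ := hw
  obtain ⟨f, hf⟩ := hne
  obtain ⟨h1, h2⟩ := uncrossed_singleton hX hY (hF he) hf.1 (by rintro rfl; exact hf.2 he)
  rw [weight, Set.ncard_pos (finite_weight hX hlf hY w F)]
  exact ⟨{e}, h1, Set.singleton_subset_iff.2 he, h2 w hwe⟩

theorem weight_lt_of_mem (hX : X.Connected) (hlf : ∀ v, (X.neighborSet v).Finite)
    (hY : IsBlock X Y) (hF : TwoBd Y F) (h1 : w ∈ vset F) (h2 : w ∉ bd Y F) :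
    weight Y w (Y \ F) < weight Y w F := by
  rw [weight_eq_zero fun h => h2 ⟨h1, h⟩]
  exact weight_pos hX hlf hY hF.1 hF.compl.nonempty h1

theorem mem_vset_sdiff_of_notMem (hw : w ∈ vset Y) (h : w ∉ vset F) : w ∈ vset (Y \ F) := by
  obtain ⟨e, he, hwe⟩ := hw
  exact ⟨e, ⟨he, fun h' => h ⟨e, h', hwe⟩⟩, hwe⟩

theorem weight_lt_of_notMem (hX : X.Connected) (hlf : ∀ v, (X.neighborSet v).Finite)
    (hY : IsBlock X Y) (hF : TwoBd Y F) (hw : w ∈ vset Y) (h1 : w ∉ vset F) :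
    weight Y w F < weight Y w (Y \ F) := by
  have := weight_lt_of_mem hX hlf hY hF.compl (w := w) (mem_vset_sdiff_of_notMem hw h1)
    (by rw [bd_sdiff hF.1]; exact fun h => h1 h.1)
  rwa [sdiff_sdiff_of_subset hF.1] at this

/-- At a vertex off the boundary of `F` one side has weight zero and the other has positive weight.
Both versions therefore follow the side of the vertex, as `bd_ext` requires. -/
theorem IsVersion.bd_eq (hX : X.Connected) (hlf : ∀ v, (X.neighborSet v).Finite)
    (hY : IsBlock X Y) (hF : TwoBd Y F) (h : IsVersion X Y F B) :
    bd X.edgeSet B = bd Y F := by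
  have key : ∀ w ∈ vset Y, w ∉ bd Y F →
      (w ∈ heavy Y F ↔ w ∈ vset F) ∧ (w ∈ notLight Y F ↔ w ∈ vset F) := by
    intro w hw hwF
    by_cases h : w ∈ vset F
    · have := weight_lt_of_mem hX hlf hY hF h hwF
      exact ⟨⟨fun _ => h, fun _ => this⟩, ⟨fun _ => h, fun _ => this.le⟩⟩
    · have := weight_lt_of_notMem hX hlf hY hF hw h
      refine ⟨⟨fun h' => absurd this (lt_asymm h'), fun h' => absurd h' h⟩,
        ⟨fun h' => absurd this (not_lt_of_ge h'), fun h' => absurd h' h⟩⟩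
  rcases h with rfl | rfl
  · exact bd_ext hX hY hF.1 fun w hw hwF => (key w hw hwF).1
  · exact bd_ext hX hY hF.1 fun w hw hwF => (key w hw hwF).2

/-- Enlarging `F` cannot decrease its own weight or increase that of the complement, and at a
boundary vertex of either set one of these changes is strict: `F'` itself is newly counted, or the
complement of `F` no longer is. So a tie becomes a strict majority. Off both boundaries the side of
the vertex decides. -/
theorem notLight_subset_heavy (hX : X.Connected) (hlf : ∀ v, (X.neighborSet v).Finite)
    (hY : IsBlock X Y) (hF : Uncrossed Y F) (hF' : Uncrossed Y F') (h : F ⊆ F') (hne : F ≠ F')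
    (hw : w ∈ vset Y) (hwF : w ∈ notLight Y F) : w ∈ heavy Y F' := by
  have h1 : weight Y w F ≤ weight Y w F' := weight_mono hX hlf hY h
  have h2 : weight Y w (Y \ F') ≤ weight Y w (Y \ F) :=
    weight_mono hX hlf hY (Set.sdiff_subset_sdiff_right h)
  have h3 : weight Y w (Y \ F) ≤ weight Y w F := hwF
  change weight Y w (Y \ F') < weight Y w F'
  by_cases h4 : w ∈ bd Y F'
  · have : weight Y w F < weight Y w F' := by
      refine Set.ncard_lt_ncard ⟨fun _ hD => ⟨hD.1, hD.2.1.trans h, hD.2.2⟩, fun hsub => ?_⟩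
        (finite_weight hX hlf hY w F')
      exact hne (h.antisymm (hsub ⟨hF', le_rfl, h4⟩).2.1)
    omega
  by_cases h5 : w ∈ bd Y F
  · have : weight Y w (Y \ F') < weight Y w (Y \ F) := by
      refine Set.ncard_lt_ncard ⟨fun _ hD => ⟨hD.1,
        hD.2.1.trans (Set.sdiff_subset_sdiff_right h), hD.2.2⟩, fun hsub => ?_⟩
        (finite_weight hX hlf hY w (Y \ F))
      have h6 : Y \ F ⊆ Y \ F' :=
        (hsub ⟨hF.compl, le_rfl, by rwa [bd_sdiff hF.1.1]⟩).2.1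
      refine hne (h.antisymm fun e he => ?_)
      by_contra heF
      exact (h6 ⟨hF'.1.1 he, heF⟩).2 he
    omega
  by_cases h6 : w ∈ vset F
  · exact weight_lt_of_mem hX hlf hY hF'.1 (vset_mono h h6) h4
  · have := weight_lt_of_notMem hX hlf hY hF.1 hw h6
    omega

/-- Both inclusions are needed in the conclusion because `F` and `F'` may coincide; then the two
versions are ordered by `heavy_subset_notLight`. -/
theorem IsVersion.subset_or (hX : X.Connected) (hlf : ∀ v, (X.neighborSet v).Finite)
    (hY : IsBlock X Y) (hF : Uncrossed Y F) (hF' : Uncrossed Y F') (hB : IsVersion X Y F B)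
    (hB' : IsVersion X Y F' B') (h : F ⊆ F') : B ⊆ B' ∨ B' ⊆ B := by
  by_cases hne : F = F'
  · subst hne
    rcases hB with rfl | rfl <;> rcases hB' with rfl | rfl
    · exact Or.inl le_rfl
    · exact Or.inl (ext_mono le_rfl fun w _ hw => heavy_subset_notLight hw)
    · exact Or.inr (ext_mono le_rfl fun w _ hw => heavy_subset_notLight hw)
    · exact Or.inl le_rfl
  · have key := fun w (hw : w ∈ vset Y) => notLight_subset_heavy hX hlf hY hF hF' h hne hw
    left
    rcases hB with rfl | rfl <;> rcases hB' with rfl | rfl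
    · exact ext_mono h fun w hw hw' => key w hw (heavy_subset_notLight hw')
    · exact ext_mono h fun w hw hw' =>
        heavy_subset_notLight (key w hw (heavy_subset_notLight hw'))
    · exact ext_mono h fun w hw hw' => key w hw hw'
    · exact ext_mono h fun w hw hw' => heavy_subset_notLight (key w hw hw')

theorem Nested.of_subset_or (h : B ⊆ B' ∨ B' ⊆ B) : Nested Y B B' := by
  rcases h with h | h
  · exact Or.inl h
  · exact Or.inr (Or.inr (Or.inr fun e he => ⟨he.1, fun h' => he.2 (h h')⟩))

theorem IsVersion.nested (hX : X.Connected) (hlf : ∀ v, (X.neighborSet v).Finite)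
    (hY : IsBlock X Y) (hF : Uncrossed Y F) (hF' : Uncrossed Y F') (hB : IsVersion X Y F B)
    (hB' : IsVersion X Y F' B') : Nested X.edgeSet B B' := by
  have hBX : B ⊆ X.edgeSet := by
    obtain ⟨W, rfl⟩ := hB.exists_eq
    exact ext_subset
  have hBX' : B' ⊆ X.edgeSet := by
    obtain ⟨W, rfl⟩ := hB'.exists_eq
    exact ext_subset
  have hBc := hB.compl hX hY hF.1.1
  have hBc' := hB'.compl hX hY hF'.1.1
  rcases hF.2 F' hF'.1 with h | h | h | h
  · exact .of_subset_or (hB.subset_or hX hlf hY hF hF' hB' h)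
  · have := (Nested.of_subset_or (Y := X.edgeSet)
      (hB.subset_or hX hlf hY hF hF'.compl hBc' h)).compl_right Set.sdiff_subset
    rwa [sdiff_sdiff_of_subset hBX'] at this
  · have := (Nested.of_subset_or (Y := X.edgeSet)
      (hBc.subset_or hX hlf hY hF.compl hF' hB' h)).compl_left Set.sdiff_subset
    rwa [sdiff_sdiff_of_subset hBX] at this
  · have := ((Nested.of_subset_or (Y := X.edgeSet)
      (hBc.subset_or hX hlf hY hF.compl hF'.compl hBc' h)).compl_right
        Set.sdiff_subset).compl_left Set.sdiff_subset
    rwa [sdiff_sdiff_of_subset hBX, sdiff_sdiff_of_subset hBX'] at this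

/-- Some `M` with one boundary vertex separates the two blocks. It is not crossed by either
extension, so `M` is contained in one side of one of them, and its complement in one side of the
other. -/
theorem nested_of_ne (hX : X.Connected) (hY : IsBlock X Y) (hY' : IsBlock X Y') (hne : Y ≠ Y')
    (hF : F ⊆ Y) (hF' : F' ⊆ Y') {W W' : Set V} :
    Nested X.edgeSet (ext X Y F W) (ext X Y' F' W') := by
  obtain ⟨M, hM, h1, h2⟩ := hY.exists_oneSep_of_ne hY' hne
  have h3 := OneSep.subset_ext_or (W := W') hX hY' hF' hM h2
  have h4 := OneSep.subset_ext_or (W := W) hX hY hF hM.compl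
    (by rwa [sdiff_sdiff_of_subset hM.1])
  have h5 : ∀ {B B' : Set (Sym2 V)}, B ⊆ X.edgeSet → X.edgeSet \ M ⊆ X.edgeSet \ B → M ⊆ B' →
      B ⊆ B' := fun hB h h' e he => h' (by
        by_contra heM
        exact (h ⟨hB he, heM⟩).2 he)
  have hsub : ext X Y F W ⊆ X.edgeSet := ext_subset
  rcases h4 with h4 | h4
  · have h4' : X.edgeSet \ M ⊆ X.edgeSet \ (X.edgeSet \ ext X Y F W) := by
      rwa [sdiff_sdiff_of_subset hsub]
    rcases h3 with h3 | h3
    · exact Or.inr (Or.inr (Or.inl (h5 Set.sdiff_subset h4' h3)))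
    · exact Or.inr (Or.inr (Or.inr (h5 Set.sdiff_subset h4' h3)))
  · rcases h3 with h3 | h3
    · exact Or.inl (h5 hsub h4 h3)
    · exact Or.inr (Or.inl (h5 hsub h4 h3))

theorem fam_subset (hB : B ∈ fam X) : B ⊆ X.edgeSet := by
  rcases hB with hB | ⟨Y, F, -, -, -, hB⟩
  · exact hB.1.1
  · obtain ⟨W, rfl⟩ := hB.exists_eq
    exact ext_subset

theorem fam_compl (hX : X.Connected) (hB : B ∈ fam X) : X.edgeSet \ B ∈ fam X := by
  rcases hB with hB | ⟨Y, F, hY, hF, hn, hB⟩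
  · exact Or.inl ⟨hB.1.compl, fun N hN => (hB.2 N hN).compl_left hB.1.1⟩
  · exact Or.inr ⟨Y, Y \ F, hY, hF.compl, hn.compl hF.1.1, hB.compl hX hY hF.1.1⟩

theorem fam_nested (hX : X.Connected) (hlf : ∀ v, (X.neighborSet v).Finite) (hB : B ∈ fam X)
    (hB' : B' ∈ fam X) : Nested X.edgeSet B B' := by
  have hsub := fam_subset hB
  have hsub' := fam_subset hB'
  rcases hB with hB | ⟨Y, F, hY, hF, hn, hB⟩ <;> rcases hB' with hB' | ⟨Y', F', hY', hF', hn', hB'⟩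
  · exact hB.2 B' hB'.1
  · obtain ⟨W, rfl⟩ := hB'.exists_eq
    exact hB.1.nested_ext hX hY' hF'.1.1
  · obtain ⟨W, rfl⟩ := hB.exists_eq
    exact (hB'.1.nested_ext hX hY hF.1.1).symm hsub
  · by_cases hne : Y = Y'
    · subst hne
      exact hB.nested hX hlf hY hF hF' hB'
    · obtain ⟨W, rfl⟩ := hB.exists_eq
      obtain ⟨W', rfl⟩ := hB'.exists_eq
      exact nested_of_ne hX hY hY' hne hF.1.1 hF'.1.1

theorem fam_bd (hX : X.Connected) (hlf : ∀ v, (X.neighborSet v).Finite) (hB : B ∈ fam X) :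
    (∃ c, bd X.edgeSet B = {c}) ∨ ∃ u v, u ≠ v ∧ bd X.edgeSet B = {u, v} := by
  rcases hB with hB | ⟨Y, F, hY, hF, hn, hB⟩
  · exact Or.inl hB.1.2
  · right
    rw [hB.bd_eq hX hlf hY hF.1]
    exact hF.1.2

theorem fam_bd_nonempty (hX : X.Connected) (hlf : ∀ v, (X.neighborSet v).Finite)
    (hB : B ∈ fam X) : (bd X.edgeSet B).Nonempty := by
  rcases fam_bd hX hlf hB with ⟨c, h⟩ | ⟨u, v, -, h⟩ <;> simp [h]

theorem fam_nonempty (hX : X.Connected) (hlf : ∀ v, (X.neighborSet v).Finite) (hB : B ∈ fam X) :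
    B.Nonempty := by
  obtain ⟨x, ⟨e, he, -⟩, -⟩ := fam_bd_nonempty hX hlf hB
  exact ⟨e, he⟩

theorem finite_fam_at (hX : X.Connected) (hlf : ∀ v, (X.neighborSet v).Finite) (u : V) :
    {B | B ∈ fam X ∧ u ∈ bd X.edgeSet B}.Finite := by
  obtain ⟨K, hK, huK, hKu⟩ := exists_finite_of_twoBd hX hlf u
  refine (finite_of_bd_subset hX hlf hK).subset ?_
  rintro B ⟨hB, hu⟩
  refine ⟨fam_subset hB, ⟨u, hu⟩, ?_⟩
  rcases hB with hB | ⟨Y, F, hY, hF, hn, hB⟩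
  · obtain ⟨c, hc⟩ := hB.1.2
    rw [hc] at hu ⊢
    rw [← Set.mem_singleton_iff.1 hu]
    exact Set.singleton_subset_iff.2 huK
  · rw [hB.bd_eq hX hlf hY hF.1] at hu ⊢
    exact hKu Y F hY hF.1 hu

/-- Fix a walk from a vertex of `B` to a vertex of the complement of `B'`. Each `C` in between has a
boundary vertex on it, and only finitely many members have a given boundary vertex. -/
theorem finite_fam_interval (hX : X.Connected) (hlf : ∀ v, (X.neighborSet v).Finite)
    (hB : B ∈ fam X) (hB' : B' ∈ fam X) :
    {C | C ∈ fam X ∧ B ⊆ C ∧ C ⊆ B'}.Finite := by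
  obtain ⟨x, hx⟩ := vset_nonempty (fam_nonempty hX hlf hB)
  obtain ⟨y, hy⟩ := vset_nonempty (fam_nonempty hX hlf (fam_compl hX hB'))
  obtain ⟨p⟩ := hX.preconnected x y
  have hfin : (⋃ u ∈ {u | u ∈ p.support}, {B | B ∈ fam X ∧ u ∈ bd X.edgeSet B}).Finite :=
    (List.finite_toSet _).biUnion fun u _ => finite_fam_at hX hlf u
  refine hfin.subset ?_
  rintro C ⟨hC, h1, h2⟩
  by_contra hno
  have hno' : ∀ z ∈ p.support, z ∉ bd X.edgeSet C := fun z hz hz' =>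
    hno (Set.mem_biUnion (show z ∈ {u | u ∈ p.support} from hz) ⟨hC, hz'⟩)
  refine hno' y (by simp) ⟨mem_vset_of_walk p (vset_mono h1 hx)
    fun z hz _ => hno' z hz, ?_⟩
  exact vset_mono (Set.sdiff_subset_sdiff_right h2) hy

end Family
end TutteTree

/-! ### Invariance of the canonical family under automorphisms -/

namespace TutteTree
section Equivariance
open SimpleGraph
variable {V : Type*} {X : SimpleGraph V}

/-- The action of an automorphism on sets of edges. -/
def act (g : X ≃g X) (F : Set (Sym2 V)) : Set (Sym2 V) := Sym2.map g '' F

variable {g : X ≃g X} {Y F F' B M : Set (Sym2 V)} {w : V}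

theorem map_injective (g : X ≃g X) : Function.Injective (Sym2.map g) :=
  Sym2.map.injective g.injective

theorem act_symm_act (g : X ≃g X) (F : Set (Sym2 V)) : act g.symm (act g F) = F := by
  rw [act, act, ← Set.image_comp, ← Sym2.map_comp]
  have : (g.symm : V → V) ∘ g = id := by
    ext x
    simp
  rw [this, Sym2.map_id, Set.image_id]

theorem act_act_symm (g : X ≃g X) (F : Set (Sym2 V)) : act g (act g.symm F) = F :=
  act_symm_act g.symm F

theorem act_subset_act : act g F ⊆ act g F' ↔ F ⊆ F' :=
  Set.image_subset_image_iff (map_injective g)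

theorem act_injective (g : X ≃g X) : Function.Injective (act g) :=
  (map_injective g).image_injective

theorem act_sdiff : act g (F \ F') = act g F \ act g F' :=
  Set.image_sdiff (map_injective g) F F'

theorem map_mem_act {e : Sym2 V} : Sym2.map g e ∈ act g F ↔ e ∈ F :=
  (map_injective g).mem_set_image

theorem act_edgeSet (g : X ≃g X) : act g X.edgeSet = X.edgeSet := by
  have h : ∀ g : X ≃g X, act g X.edgeSet ⊆ X.edgeSet := by
    rintro g _ ⟨e, he, rfl⟩
    induction e with
    | h x y => exact g.map_adj_iff.2 he
  refine (h g).antisymm ?_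
  rw [← act_act_symm g X.edgeSet, act_subset_act, act_act_symm]
  exact h g.symm

theorem vset_act : vset (act g F) = g '' vset F := by
  ext x
  constructor
  · rintro ⟨_, ⟨e, he, rfl⟩, hx⟩
    obtain ⟨z, hz, rfl⟩ := Sym2.mem_map.1 hx
    exact ⟨z, ⟨e, he, hz⟩, rfl⟩
  · rintro ⟨z, ⟨e, he, hz⟩, rfl⟩
    exact ⟨_, ⟨e, he, rfl⟩, Sym2.mem_map.2 ⟨z, hz, rfl⟩⟩

theorem bd_act : bd (act g Y) (act g F) = g '' bd Y F := by
  rw [bd, ← act_sdiff, vset_act, vset_act, bd, Set.image_inter g.injective]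

theorem OneSep.act (h : OneSep X M) (g : X ≃g X) : OneSep X (act g M) := by
  obtain ⟨h, c, hc⟩ := h
  refine ⟨?_, g c, ?_⟩
  · rw [← act_edgeSet g, act_subset_act]
    exact h
  · rw [← act_edgeSet g, bd_act, hc, Set.image_singleton]

theorem Nested.act (h : Nested Y F F') (g : X ≃g X) :
    Nested (act g Y) (act g F) (act g F') := by
  simpa only [Nested, ← act_sdiff, act_subset_act] using h

theorem IsBlock.act (h : IsBlock X Y) (g : X ≃g X) : IsBlock X (act g Y) := by
  obtain ⟨e, he, rfl⟩ := h
  refine ⟨Sym2.map g e, ?_, ?_⟩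
  · rw [← act_edgeSet g]
    exact map_mem_act.2 he
  · ext f
    constructor
    · rintro ⟨f, ⟨hf, hef⟩, rfl⟩
      refine ⟨?_, fun M hM => ?_⟩
      · rw [← act_edgeSet g]
        exact map_mem_act.2 hf
      · rw [← act_act_symm g M, map_mem_act, map_mem_act]
        exact hef _ (hM.act g.symm)
    · rintro ⟨hf, hef⟩
      rw [← act_edgeSet g] at hf
      obtain ⟨f, hf, rfl⟩ := hf
      refine map_mem_act.2 ⟨hf, fun M hM => ?_⟩
      have := hef _ (hM.act g)
      rwa [map_mem_act, map_mem_act] at this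

theorem TwoBd.act (h : TwoBd Y F) (g : X ≃g X) : TwoBd (act g Y) (act g F) := by
  obtain ⟨h, u, v, huv, hbd⟩ := h
  exact ⟨act_subset_act.2 h, g u, g v, g.injective.ne huv, by rw [bd_act, hbd, Set.image_pair]⟩

theorem Uncrossed.act (h : Uncrossed Y F) (g : X ≃g X) : Uncrossed (act g Y) (act g F) := by
  refine ⟨h.1.act g, fun F' hF' => ?_⟩
  rw [← act_act_symm g F']
  refine (h.2 _ ?_).act g
  have := hF'.act g.symm
  rwa [act_symm_act] at this

theorem uncrossed_act_iff : Uncrossed (act g Y) (act g F) ↔ Uncrossed Y F := by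
  refine ⟨fun h => ?_, fun h => h.act g⟩
  have := h.act g.symm
  rwa [act_symm_act, act_symm_act] at this

theorem weight_act : weight (act g Y) (g w) (act g F) = weight Y w F := by
  have : {F' | Uncrossed (act g Y) F' ∧ F' ⊆ act g F ∧ g w ∈ bd (act g Y) F'} =
      act g '' {F' | Uncrossed Y F' ∧ F' ⊆ F ∧ w ∈ bd Y F'} := by
    ext F'
    constructor
    · rintro ⟨h1, h2, h3⟩
      refine ⟨act g.symm F', ?_, act_act_symm g F'⟩
      rw [← act_act_symm g F'] at h1 h2 h3
      rw [bd_act, g.injective.mem_set_image] at h3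
      exact ⟨uncrossed_act_iff.1 h1, act_subset_act.1 h2, h3⟩
    · rintro ⟨F', ⟨h1, h2, h3⟩, rfl⟩
      exact ⟨h1.act g, act_subset_act.2 h2, by rw [bd_act, g.injective.mem_set_image]; exact h3⟩
  rw [weight, this, Set.ncard_image_of_injective _ (act_injective g), weight]

theorem heavy_act : heavy (act g Y) (act g F) = g '' heavy Y F := by
  ext x
  obtain ⟨w, rfl⟩ := g.surjective x
  rw [g.injective.mem_set_image]
  simp only [heavy, Set.mem_ofPred_eq, ← act_sdiff, weight_act]

theorem notLight_act : notLight (act g Y) (act g F) = g '' notLight Y F := by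
  ext x
  obtain ⟨w, rfl⟩ := g.surjective x
  rw [g.injective.mem_set_image]
  simp only [notLight, Set.mem_ofPred_eq, ← act_sdiff, weight_act]

theorem reachable_deleteEdges_act {x y : V} (g : X ≃g X) (h : (X.deleteEdges Y).Reachable x y) :
    (X.deleteEdges (act g Y)).Reachable (g x) (g y) := by
  let f : X.deleteEdges Y →g X.deleteEdges (act g Y) :=
    ⟨g, fun {a b} hab => by
      rw [deleteEdges_adj] at hab ⊢
      refine ⟨g.map_adj_iff.2 hab.1, fun h => hab.2 ?_⟩
      rw [← Sym2.map_mk] at h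
      exact map_mem_act.1 h⟩
  exact h.map f

theorem act_ext_subset (g : X ≃g X) (W : Set V) :
    act g (ext X Y F W) ⊆ ext X (act g Y) (act g F) (g '' W) := by
  rintro _ ⟨e, ⟨heX, he⟩, rfl⟩
  refine ⟨?_, ?_⟩
  · rw [← act_edgeSet g]
    exact map_mem_act.2 heX
  · rcases he with he | ⟨he, w, hw, hwY, x, hx, hxw⟩
    · exact Or.inl (map_mem_act.2 he)
    · refine Or.inr ⟨fun h => he (map_mem_act.1 h), g w, ⟨w, hw, rfl⟩, ?_, g x,
        Sym2.mem_map.2 ⟨x, hx, rfl⟩, reachable_deleteEdges_act g hxw⟩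
      rw [vset_act]
      exact ⟨w, hwY, rfl⟩

theorem act_ext (g : X ≃g X) (W : Set V) :
    act g (ext X Y F W) = ext X (act g Y) (act g F) (g '' W) := by
  refine (act_ext_subset g W).antisymm ?_
  have h := act_ext_subset (Y := act g Y) (F := act g F) g.symm (g '' W)
  have hW : (g.symm : V → V) '' (g '' W) = W := by
    rw [← Set.image_comp]
    have : (g.symm : V → V) ∘ g = id := by
      ext x
      simp
    rw [this, Set.image_id]
  rw [act_symm_act, act_symm_act, hW, ← act_subset_act (g := g), act_act_symm] at h
  exact h

theorem IsVersion.act (h : IsVersion X Y F B) (g : X ≃g X) :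
    IsVersion X (act g Y) (act g F) (act g B) := by
  rcases h with rfl | rfl
  · left
    rw [heavy_act, act_ext]
  · right
    rw [notLight_act, act_ext]

theorem Nontriv.act (h : Nontriv Y F) (g : X ≃g X) : Nontriv (act g Y) (act g F) := by
  have key : ∀ F : Set (Sym2 V), (∀ e, F ≠ {e}) → ∀ e, TutteTree.act g F ≠ {e} := by
    intro F hF e he
    apply hF (Sym2.map g.symm e)
    rw [← act_symm_act g F, he, TutteTree.act, Set.image_singleton]
  refine ⟨key F h.1, ?_⟩
  rw [← act_sdiff]
  exact key _ h.2

theorem act_mem_fam (h : B ∈ fam X) (g : X ≃g X) : act g B ∈ fam X := by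
  rcases h with h | ⟨Y, F, hY, hF, hn, hB⟩
  · refine Or.inl ⟨h.1.act g, fun N hN => ?_⟩
    have := (h.2 _ (hN.act g.symm)).act g
    rwa [act_act_symm, act_edgeSet] at this
  · exact Or.inr ⟨act g Y, act g F, hY.act g, hF.act g, hn.act g, hB.act g⟩

/-- Every member can be moved so that its boundary meets a finite set of representatives of the
vertices, and finitely many members do so. -/
theorem exists_finite_orbits (hX : X.Connected) (hlf : ∀ v, (X.neighborSet v).Finite)
    (hfin : IsAutFinite X) :
    ∃ S ⊆ fam X, S.Finite ∧ ∀ A ∈ fam X, ∃ B ∈ S, ∃ g : X ≃g X, act g B = A := by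
  obtain ⟨K, hK, hKg⟩ := hfin
  refine ⟨⋃ u ∈ K, {B | B ∈ fam X ∧ u ∈ bd X.edgeSet B}, ?_,
    hK.biUnion fun u _ => finite_fam_at hX hlf u, ?_⟩
  · exact Set.iUnion₂_subset fun u _ B hB => hB.1
  · intro A hA
    obtain ⟨x, hx⟩ := fam_bd_nonempty hX hlf hA
    obtain ⟨w, hw, g, rfl⟩ := hKg x
    refine ⟨act g.symm A, Set.mem_biUnion hw ⟨act_mem_fam hA g.symm, ?_⟩, g, act_act_symm g A⟩
    rw [← act_edgeSet g.symm, bd_act]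
    exact ⟨g w, hx, by simp⟩

end Equivariance
end TutteTree

/-! ### Crossing subsets of a two-connected set of edges -/

namespace TutteTree
section Crossing
open SimpleGraph
variable {V : Type*}

/-- The set of edges `Y` is two-connected. -/
def TwoConn (Y : Set (Sym2 V)) : Prop :=
  ∀ F ⊆ Y, F.Nonempty → (Y \ F).Nonempty → ∀ c, ¬ bd Y F ⊆ {c}

/-- `F` and `R` cross, as subsets of `Y`. -/
structure Crossing (Y F R : Set (Sym2 V)) : Prop where
  left : F ⊆ Y
  right : R ⊆ Y
  inter : (F ∩ R).Nonempty
  inter_compl : (F ∩ (Y \ R)).Nonempty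
  compl_inter : ((Y \ F) ∩ R).Nonempty
  compl_inter_compl : ((Y \ F) ∩ (Y \ R)).Nonempty

variable {Y F R S : Set (Sym2 V)} {u v t x : V}

theorem Crossing.symm (h : Crossing Y F R) : Crossing Y R F where
  left := h.right
  right := h.left
  inter := by rw [Set.inter_comm]; exact h.inter
  inter_compl := by rw [Set.inter_comm]; exact h.compl_inter
  compl_inter := by rw [Set.inter_comm]; exact h.inter_compl
  compl_inter_compl := by rw [Set.inter_comm]; exact h.compl_inter_compl

theorem Crossing.compl_left (h : Crossing Y F R) : Crossing Y (Y \ F) R where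
  left := Set.sdiff_subset
  right := h.right
  inter := h.compl_inter
  inter_compl := h.compl_inter_compl
  compl_inter := by rw [sdiff_sdiff_of_subset h.left]; exact h.inter
  compl_inter_compl := by rw [sdiff_sdiff_of_subset h.left]; exact h.inter_compl

theorem Crossing.compl_right (h : Crossing Y F R) : Crossing Y F (Y \ R) :=
  h.symm.compl_left.symm

theorem crossing_of_not_nested (hF : F ⊆ Y) (hR : R ⊆ Y) (h : ¬ Nested Y F R) :
    Crossing Y F R := by
  simp only [Nested, not_or, Set.not_subset] at h
  obtain ⟨⟨a, ha, ha'⟩, ⟨b, hb, hb'⟩, ⟨c, hc, hc'⟩, ⟨d, hd, hd'⟩⟩ := h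
  exact ⟨hF, hR, ⟨b, hb, by_contra fun h => hb' ⟨hF hb, h⟩⟩, ⟨a, ha, hF ha, ha'⟩,
    ⟨d, hd, by_contra fun h => hd' ⟨hd.1, h⟩⟩, ⟨c, hc, hc.1, hc'⟩⟩

theorem bd_inter_subset : bd Y (F ∩ R) ⊆
    {x | (x ∈ bd Y F ∧ x ∈ vset R) ∨ (x ∈ bd Y R ∧ x ∈ vset F)} := by
  rintro x ⟨⟨e, he, hxe⟩, ⟨f, hf, hxf⟩⟩
  by_cases hfF : f ∈ F
  · exact Or.inr ⟨⟨⟨e, he.2, hxe⟩, f, ⟨hf.1, fun h => hf.2 ⟨hfF, h⟩⟩, hxf⟩, e, he.1, hxe⟩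
  · exact Or.inl ⟨⟨⟨e, he.1, hxe⟩, f, ⟨hf.1, hfF⟩, hxf⟩, e, he.2, hxe⟩

/-- The boundary of each corner has at least two vertices. -/
theorem TwoConn.exists_corner (hY : TwoConn Y) (h : Crossing Y F R) (c : V) :
    ∃ x, x ≠ c ∧ ((x ∈ bd Y F ∧ x ∈ vset R) ∨ (x ∈ bd Y R ∧ x ∈ vset F)) := by
  by_contra! hno
  obtain ⟨e, he⟩ := h.inter_compl
  refine hY (F ∩ R) (fun e he => h.left he.1) h.inter ⟨e, he.2.1, fun h' => he.2.2 h'.2⟩ c ?_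
  intro x hx
  by_contra hxc
  rcases bd_inter_subset hx with hx | hx
  · exact (hno x hxc).1 hx.1 hx.2
  · exact (hno x hxc).2 hx.1 hx.2

theorem notMem_or (hx : x ∉ bd Y F) : x ∉ vset F ∨ x ∉ vset (Y \ F) := by
  by_contra! h
  exact hx h

/-- If the other boundary vertices `v` and `t` were different, each would be off the boundary of the
other set. After suitable complementations there would be a corner avoiding both, whose only
possible boundary vertex is `u`. -/
theorem TwoConn.eq_of_common (hY : TwoConn Y) (h : Crossing Y F R) (hF : bd Y F = {u, v})
    (hR : bd Y R = {u, t}) : bd Y R = {u, v} := by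
  by_cases hvt : v = t
  · rw [hR, hvt]
  by_cases hvu : v = u
  · obtain ⟨e, he⟩ := h.inter
    obtain ⟨f, hf⟩ := h.compl_inter
    exact absurd (by rw [hF, hvu]; simp) (hY F h.left ⟨e, he.1⟩ ⟨f, hf.1⟩ u)
  by_cases htu : t = u
  · obtain ⟨e, he⟩ := h.inter
    obtain ⟨f, hf⟩ := h.inter_compl
    exact absurd (by rw [hR, htu]; simp) (hY R h.right ⟨e, he.2⟩ ⟨f, hf.2⟩ u)
  exfalso
  have key : ∀ {F R : Set (Sym2 V)}, Crossing Y F R → bd Y F = {u, v} → bd Y R = {u, t} →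
      v ∉ vset R → t ∉ vset F → False := by
    intro F R h hF hR h1 h2
    obtain ⟨x, hxu, ⟨h3, h4⟩ | ⟨h3, h4⟩⟩ := hY.exists_corner h u
    · rw [hF] at h3
      rcases h3 with h3 | h3
      · exact hxu h3
      · exact h1 (Set.mem_singleton_iff.1 h3 ▸ h4)
    · rw [hR] at h3
      rcases h3 with h3 | h3
      · exact hxu h3
      · exact h2 (Set.mem_singleton_iff.1 h3 ▸ h4)
  have hv : v ∉ bd Y R := by rw [hR]; simp [hvu, hvt]
  have ht : t ∉ bd Y F := by rw [hF]; simp [htu, Ne.symm hvt]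
  have hF' : bd Y (Y \ F) = {u, v} := by rw [bd_sdiff h.left, hF]
  have hR' : bd Y (Y \ R) = {u, t} := by rw [bd_sdiff h.right, hR]
  rcases notMem_or hv with h1 | h1 <;> rcases notMem_or ht with h2 | h2
  · exact key h hF hR h1 h2
  · exact key h.compl_left hF' hR h1 h2
  · exact key h.compl_right hF hR' h1 h2
  · exact key h.compl_left.compl_right hF' hR' h1 h2

/-- If `R` avoids `u` and `v`, then its two corners with `F` and with the complement of `F` have
their boundaries in `{w, z}`. Each needs a boundary vertex other than `z`, so `w` meets both `F` and
its complement. -/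
theorem TwoConn.opposite (hY : TwoConn Y) {w z : V} (h : Crossing Y F R) (hF : bd Y F = {u, v})
    (hR : bd Y R = {w, z}) (hw : w ∉ bd Y F) :
    ¬ (u ∉ vset R ∧ v ∉ vset R) := by
  rintro ⟨h1, h2⟩
  have key : ∀ {F : Set (Sym2 V)}, Crossing Y F R → bd Y F = {u, v} → w ∈ vset F := by
    intro F h hF
    obtain ⟨x, hxz, ⟨h3, h4⟩ | ⟨h3, h4⟩⟩ := hY.exists_corner h z
    · rw [hF] at h3
      rcases h3 with rfl | h3
      · exact absurd h4 h1
      · exact absurd (Set.mem_singleton_iff.1 h3 ▸ h4) h2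
    · rw [hR] at h3
      rcases h3 with rfl | h3
      · exact h4
      · exact absurd h3 hxz
  exact hw ⟨key h hF, key h.compl_left (by rw [bd_sdiff h.left, hF])⟩

theorem TwoConn.opposite' (hY : TwoConn Y) {w z : V} (h : Crossing Y F R) (hF : bd Y F = {u, v})
    (hR : bd Y R = {w, z}) (hu : u ∉ bd Y R) (hv : v ∉ bd Y R) (hw : w ∉ bd Y F) :
    (u ∉ vset (Y \ R) ∧ v ∉ vset R) ∨ (u ∉ vset R ∧ v ∉ vset (Y \ R)) := by
  have h1 := hY.opposite h hF hR hw
  have hR' : bd Y (Y \ R) = {w, z} := by rw [bd_sdiff h.right, hR]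
  have h2 := hY.opposite h.compl_right hF hR' hw
  have h3 := notMem_or hu
  have h4 := notMem_or hv
  tauto

/-- If two subsets of a two-connected set cross, then they have the same boundary, or each separates
the two boundary vertices of the other. -/
theorem TwoConn.cases (hY : TwoConn Y) (h : Crossing Y F R) (hF : bd Y F = {u, v})
    (hR : TwoBd Y R) : bd Y R = {u, v} ∨ ∃ w z, bd Y R = {w, z} ∧
      w ∉ vset (Y \ F) ∧ z ∉ vset F ∧
      ((u ∉ vset (Y \ R) ∧ v ∉ vset R) ∨ (u ∉ vset R ∧ v ∉ vset (Y \ R))) := by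
  obtain ⟨-, w, z, -, hR⟩ := hR
  by_cases hu : u ∈ bd Y R
  · left
    have hu' := hu
    rw [hR] at hu'
    rcases hu' with rfl | hu'
    · exact hY.eq_of_common h hF hR
    · rw [Set.mem_singleton_iff] at hu'
      subst hu'
      exact hY.eq_of_common h hF (by rw [hR, Set.pair_comm])
  by_cases hv : v ∈ bd Y R
  · left
    rw [Set.pair_comm]
    have hv' := hv
    rw [Set.pair_comm] at hF
    rw [hR] at hv'
    rcases hv' with rfl | hv'
    · exact hY.eq_of_common h hF hR
    · rw [Set.mem_singleton_iff] at hv'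
      subst hv'
      exact hY.eq_of_common h hF (by rw [hR, Set.pair_comm])
  right
  have hwR : w ∈ bd Y R := by simp [hR]
  have hzR : z ∈ bd Y R := by simp [hR]
  have hw : w ∉ bd Y F := by
    rw [hF]
    rintro (rfl | hw)
    · exact hu hwR
    · exact hv (Set.mem_singleton_iff.1 hw ▸ hwR)
  have hz : z ∉ bd Y F := by
    rw [hF]
    rintro (rfl | hz)
    · exact hu hzR
    · exact hv (Set.mem_singleton_iff.1 hz ▸ hzR)
  have h1 := hY.opposite' h hF hR hu hv hw
  rcases hY.opposite' h.symm hR hF hw hz hu with h2 | h2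
  · exact ⟨w, z, hR, h2.1, h2.2, h1⟩
  · exact ⟨z, w, by rw [hR, Set.pair_comm], h2.2, h2.1, h1⟩

/-- The edges in `Y` at the component of `x` after removal of `u` and `v`. -/
def bridge (Y : Set (Sym2 V)) (u v x : V) : Set (Sym2 V) :=
  {e | e ∈ Y ∧ ∃ y ∈ e, ∃ p : (fromEdgeSet Y).Walk x y, u ∉ p.support ∧ v ∉ p.support}

theorem bridge_subset : bridge Y u v x ⊆ Y := fun _ h => h.1

theorem mem_bridge (hu : x ≠ u) (hv : x ≠ v) {e : Sym2 V} (he : e ∈ Y) (hx : x ∈ e) :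
    e ∈ bridge Y u v x :=
  ⟨he, x, hx, .nil, by simpa using hu.symm, by simpa using hv.symm⟩

theorem bd_bridge_subset : bd Y (bridge Y u v x) ⊆ {u, v} := by
  rintro z ⟨⟨e, ⟨he, y, hy, p, hpu, hpv⟩, hze⟩, ⟨f, hf, hzf⟩⟩
  by_contra hz
  rw [Set.mem_insert_iff, Set.mem_singleton_iff, not_or] at hz
  by_cases hyz : y = z
  · subst hyz
    exact hf.2 ⟨hf.1, y, hzf, p, hpu, hpv⟩
  · have hee : e = s(y, z) := (Sym2.mem_and_mem_iff hyz).1 ⟨hy, hze⟩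
    subst hee
    have hadj : (fromEdgeSet Y).Adj y z := (fromEdgeSet_adj ..).2 ⟨he, hyz⟩
    refine hf.2 ⟨hf.1, z, hzf, p.concat hadj, ?_, ?_⟩ <;>
      rw [Walk.support_concat, List.mem_append, List.mem_singleton] <;> rintro (h | h)
    · exact hpu h
    · exact hz.1 h.symm
    · exact hpv h
    · exact hz.2 h.symm

theorem bridge_subset_of_bd (hS : bd Y S = {u, v}) (hx : x ∈ vset S) :
    bridge Y u v x ⊆ S := by
  rintro e ⟨he, y, hy, p, hpu, hpv⟩
  have hsupp : ∀ z ∈ p.support, z ∉ bd Y S := by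
    rw [hS]
    rintro z hz (rfl | hz')
    · exact hpu hz
    · exact hpv (Set.mem_singleton_iff.1 hz' ▸ hz)
  suffices h : y ∈ vset S from mem_bd_or h (hsupp y (by simp)) he hy
  clear hy hpu hpv
  induction p with
  | nil => exact hx
  | @cons a b c hab p ih =>
    have h1 := mem_bd_or hx (hsupp a (by simp)) ((fromEdgeSet_adj ..).1 hab).1
      (by simp : a ∈ s(a, b))
    exact ih ⟨_, h1, by simp⟩ fun z hz => hsupp z (by simp [hz])

theorem TwoConn.bd_eq (hY : TwoConn Y) (hF : F ⊆ Y) (h1 : F.Nonempty) (h2 : (Y \ F).Nonempty)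
    (h : bd Y F ⊆ {u, v}) : bd Y F = {u, v} := by
  have key : ∀ {u v : V}, bd Y F ⊆ {u, v} → u ∈ bd Y F := by
    intro u v h
    by_contra hu
    refine hY F hF h1 h2 v fun x hx => ?_
    rcases h hx with rfl | hxv
    · exact absurd hx hu
    · exact hxv
  refine h.antisymm ?_
  rintro x (rfl | hx)
  · exact key h
  · rw [Set.mem_singleton_iff] at hx
    subst hx
    exact key (by rw [Set.pair_comm]; exact h)

/-- The set `S` connects `u` to `v` without meeting the boundary of `R`; if `R` separated them, `S ∩
R` would have `u` as its only possible boundary vertex. -/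
theorem TwoConn.not_separated (hY : TwoConn Y) {w z : V} (hS : S ⊆ Y) (hbS : bd Y S = {u, v})
    (hbR : bd Y R = {w, z}) (hw : w ∉ vset S) (hz : z ∉ vset S) (hu : u ∉ vset (Y \ R))
    (hv : v ∉ vset R) : False := by
  have huS : u ∈ bd Y S := by simp [hbS]
  have hvS : v ∈ bd Y S := by simp [hbS]
  obtain ⟨e, he, hue⟩ := huS.1
  obtain ⟨f, hf, hvf⟩ := hvS.1
  refine hY (S ∩ R) (fun _ h => hS h.1)
    ⟨e, he, by_contra fun h => hu ⟨e, ⟨hS he, h⟩, hue⟩⟩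
    ⟨f, hS hf, fun h => hv ⟨f, h.2, hvf⟩⟩ u ?_
  intro x hx
  rcases bd_inter_subset hx with ⟨h1, h2⟩ | ⟨h1, h2⟩
  · rw [hbS] at h1
    rcases h1 with h1 | h1
    · exact h1
    · exact absurd (Set.mem_singleton_iff.1 h1 ▸ h2) hv
  · rw [hbR] at h1
    rcases h1 with rfl | h1
    · exact absurd h2 hw
    · exact absurd (Set.mem_singleton_iff.1 h1 ▸ h2) hz

/-- If two crossing sets have the same boundary, then the bridges are not crossed. -/
theorem TwoConn.uncrossed_bridge (hY : TwoConn Y) (h : Crossing Y F R) (hne : u ≠ v)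
    (hF : bd Y F = {u, v}) (hR : bd Y R = {u, v}) (hxF : x ∈ vset F)
    (hxu : x ≠ u) (hxv : x ≠ v) : Uncrossed Y (bridge Y u v x) := by
  have hβF : bridge Y u v x ⊆ F := bridge_subset_of_bd hF hxF
  obtain ⟨e1, he1⟩ := h.compl_inter
  obtain ⟨e2, he2⟩ := h.compl_inter_compl
  obtain ⟨e3, he3⟩ := h.inter
  have hβne : (bridge Y u v x).Nonempty := by
    obtain ⟨e, he, hxe⟩ := hxF
    exact ⟨e, mem_bridge hxu hxv (h.left he) hxe⟩
  have hβne' : (Y \ bridge Y u v x).Nonempty := ⟨e1, he1.1.1, fun h' => he1.1.2 (hβF h')⟩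
  have hbβ : bd Y (bridge Y u v x) = {u, v} :=
    hY.bd_eq bridge_subset hβne hβne' bd_bridge_subset
  refine ⟨⟨bridge_subset, u, v, hne, hbβ⟩, fun Q hQ => ?_⟩
  by_contra hnot
  have hcross := crossing_of_not_nested bridge_subset hQ.1 hnot
  have hbQ' : bd Y (Y \ Q) = bd Y Q := bd_sdiff hQ.1
  -- If `Q` has the same boundary, the bridge lies entirely on one side of it. Otherwise one
  -- boundary vertex `z` of `Q` is not in the bridge, while the other, `w`, meets only the bridge.
  rcases hY.cases hcross hbβ hQ with hbQ | ⟨w, z, hbQ, hw, hz, hsep⟩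
  · obtain ⟨e, he, hxe⟩ := hxF
    by_cases heQ : e ∈ Q
    · obtain ⟨f, hf⟩ := hcross.inter_compl
      exact hf.2.2 (bridge_subset_of_bd hbQ ⟨e, heQ, hxe⟩ hf.1)
    · obtain ⟨f, hf⟩ := hcross.inter
      exact (bridge_subset_of_bd (hbQ'.trans hbQ) ⟨e, ⟨h.left he, heQ⟩, hxe⟩ hf.1).2 hf.2
  · have hcorner : ∀ {R : Set (Sym2 V)}, bd Y R = {u, v} → bd Y ((Y \ F) ∩ R) ⊆ {u, v} := by
      intro R hR y hy
      rcases bd_inter_subset hy with h1 | h1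
      · rw [bd_sdiff h.left, hF] at h1
        exact h1.1
      · rw [hR] at h1
        exact h1.1
    have hR' : bd Y (Y \ R) = {u, v} := by rw [bd_sdiff h.right, hR]
    -- The complement of `F` has two corners with `R` and its complement, each with boundary `{u,
    -- v}` and neither meeting `w`. At least one also misses `z`, since a vertex of both would be
    -- `u` or `v`. That corner joins `u` and `v`, which `Q` separates.
    have key : ∀ {R : Set (Sym2 V)}, bd Y R = {u, v} → ((Y \ F) ∩ R).Nonempty →
        z ∉ vset ((Y \ F) ∩ R) → False := by
      intro R hR hne hzR
      have hb : bd Y ((Y \ F) ∩ R) = {u, v} :=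
        hY.bd_eq (fun _ h' => h'.1.1) hne ⟨e3, h.left he3.1, fun h' => h'.1.2 he3.1⟩ (hcorner hR)
      have hwR : w ∉ vset ((Y \ F) ∩ R) := fun h' =>
        hw (vset_mono (show (Y \ F) ∩ R ⊆ Y \ bridge Y u v x from
          fun e he => ⟨he.1.1, fun heβ => he.1.2 (hβF heβ)⟩) h')
      rcases hsep with ⟨h1, h2⟩ | ⟨h1, h2⟩
      · exact hY.not_separated (fun _ h' => h'.1.1) hb hbQ hwR hzR h1 h2
      · exact hY.not_separated (fun _ h' => h'.1.1) (hb.trans (Set.pair_comm u v)) hbQ hwR hzR h2 h1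
    by_cases hz1 : z ∈ vset ((Y \ F) ∩ R)
    · by_cases hz2 : z ∈ vset ((Y \ F) ∩ (Y \ R))
      · have hzb : z ∈ bd Y R :=
          ⟨vset_mono Set.inter_subset_right hz1, vset_mono Set.inter_subset_right hz2⟩
        rw [hR, ← hbβ] at hzb
        exact hz hzb.1
      · exact key hR' ⟨e2, he2⟩ hz2
    · exact key hR ⟨e1, he1⟩ hz1

/-- A set of edges with an interior vertex and two boundary vertices is not a single edge. -/
theorem ne_singleton_of_interior (hne : u ≠ v) (hF : bd Y F = {u, v}) (hxF : x ∈ vset F)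
    (hx : x ∉ bd Y F) (e : Sym2 V) : F ≠ {e} := by
  rintro rfl
  have key : ∀ {y : V}, y ∈ vset ({e} : Set (Sym2 V)) → y ∈ e := by
    rintro y ⟨_, rfl, hy⟩
    exact hy
  have hu : u ∈ bd Y {e} := by simp [hF]
  have hv : v ∈ bd Y {e} := by simp [hF]
  have h1 := (Sym2.mem_and_mem_iff hne).1 ⟨key hu.1, key hv.1⟩
  have h2 := key hxF
  rw [h1, Sym2.mem_iff] at h2
  rcases h2 with rfl | rfl
  · exact hx hu
  · exact hx hv

end Crossing
end TutteTree

/-! ### Torsos are cycles or 3-connected -/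

namespace TutteTree
section Torsos
open SimpleGraph
variable {V W : Type*} {X : SimpleGraph V} {𝒜 : Set (Set (Sym2 V))} {Z : SimpleGraph W} {f : W → V}

/-- The properties of the family of the edges of the structure tree that start at a given node. -/
structure IsStar (X : SimpleGraph V) (𝒜 : Set (Set (Sym2 V))) : Prop where
  mem_fam : ∀ {A}, A ∈ 𝒜 → A ∈ fam X
  disj : ∀ {A B}, A ∈ 𝒜 → B ∈ 𝒜 → A ≠ B → A ⊆ X.edgeSet \ B
  position : ∀ {B}, B ∈ fam X → ∃ A ∈ 𝒜, B ⊆ A ∨ X.edgeSet \ B ⊆ A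

/-- The graph `Z` is obtained from the part of `X` outside the members of `𝒜` by adding their
virtual edges. -/
structure IsTorso (X : SimpleGraph V) (𝒜 : Set (Set (Sym2 V))) (Z : SimpleGraph W) (f : W → V) :
    Prop extends IsStar X 𝒜 where
  injective : Function.Injective f
  mem_range : ∀ x, x ∈ Set.range f ↔ ∀ A ∈ 𝒜, x ∈ vset (X.edgeSet \ A)
  adj_iff : ∀ a b, Z.Adj a b ↔ a ≠ b ∧ ((s(f a, f b) ∈ X.edgeSet ∧ ∀ A ∈ 𝒜, s(f a, f b) ∉ A) ∨
    ∃ A ∈ 𝒜, bd X.edgeSet A = {f a, f b})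

theorem IsBlock.twoConn {Y : Set (Sym2 V)} (hX : X.Connected) (hY : IsBlock X Y) : TwoConn Y :=
  fun _ hF h1 h2 c => hY.not_bd_subset hX hF h1 h2 c

theorem mem_vset_sdiff [Nontrivial V] (hX : X.Connected) {F : Set (Sym2 V)} {x : V}
    (h : x ∉ vset F) : x ∈ vset (X.edgeSet \ F) :=
  mem_vset_sdiff_of_notMem (by rw [vset_edgeSet hX]; trivial) h

theorem mem_vset_of_notMem_sdiff [Nontrivial V] (hX : X.Connected) {F : Set (Sym2 V)} {x : V}
    (h : x ∉ vset (X.edgeSet \ F)) : x ∈ vset F := by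
  by_contra h'
  exact h (mem_vset_sdiff hX h')

namespace IsTorso

theorem bd_subset_range (T : IsTorso X 𝒜 Z f) {A : Set (Sym2 V)} (hA : A ∈ 𝒜) {x : V}
    (hx : x ∈ bd X.edgeSet A) : x ∈ Set.range f := by
  rw [T.mem_range]
  intro B hB
  by_cases hAB : A = B
  · exact hAB ▸ hx.2
  · exact vset_mono (T.disj hA hB hAB) hx.1

theorem mem_bd (T : IsTorso X 𝒜 Z f) {A : Set (Sym2 V)} (hA : A ∈ 𝒜) {a : W}
    (ha : f a ∈ vset A) : f a ∈ bd X.edgeSet A :=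
  ⟨ha, (T.mem_range _).1 ⟨a, rfl⟩ A hA⟩

theorem sdiff_subset_comm {A B : Set (Sym2 V)} {Y : Set (Sym2 V)} (h : Y \ B ⊆ A) : Y \ A ⊆ B :=
  fun _ he => by_contra fun h' => he.2 (h ⟨he.1, h'⟩)

/-- No single vertex of `X` separates vertices of `Z`. -/
theorem not_oneSep [Nontrivial V] (hX : X.Connected) (T : IsTorso X 𝒜 Z f) {M : Set (Sym2 V)}
    (hM : OneSep X M) {a b : W} (ha : f a ∉ vset (X.edgeSet \ M)) (hb : f b ∉ vset M) : False := by
  -- The set `M` may be crossed and thus missing from the family. The uncrossed `L` inside it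
  -- belongs to the family and still separates the two vertices.
  obtain ⟨L, h1, h2, h3, h4, h5⟩ := hM.exists_nested hX (mem_vset_of_notMem_sdiff hX ha)
    fun h => ha h.2
  obtain ⟨A, hA, h6 | h6⟩ := T.position (Or.inl ⟨h1, h2⟩)
  · have := T.mem_bd hA (vset_mono h6 h4)
    exact h5 (vset_mono (Set.sdiff_subset_sdiff_right h6) this.2)
  · have hb' : f b ∈ vset (X.edgeSet \ L) := mem_vset_sdiff hX fun h => hb (vset_mono h3 h)
    have := T.mem_bd hA (vset_mono h6 hb')
    exact hb (vset_mono ((sdiff_subset_comm h6).trans h3) this.2)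

/-- A separation of `Z` comes from one of `X`. -/
theorem exists_separation (hX : X.Connected) (hlf : ∀ v, (X.neighborSet v).Finite)
    (T : IsTorso X 𝒜 Z f) {S C D : Set W} (h : IsSep Z S C D) :
    ∃ P ⊆ X.edgeSet, (∀ A ∈ 𝒜, A ⊆ P ∨ A ⊆ X.edgeSet \ P) ∧
      (∀ c ∈ C, f c ∉ vset (X.edgeSet \ P)) ∧ (∀ d ∈ D, f d ∉ vset P) ∧
      bd X.edgeSet P ⊆ f '' S := by
  -- Whole members of `𝒜` are put on one side according to whether their boundary meets `C`. A
  -- member with boundary vertices in both `C` and `D` would have a virtual edge between them.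
  let P : Set (Sym2 V) := {e | e ∈ X.edgeSet ∧ ((∃ A ∈ 𝒜, e ∈ A ∧ ∃ c ∈ C, f c ∈ bd X.edgeSet A) ∨
    ((∀ A ∈ 𝒜, e ∉ A) ∧ ∃ c ∈ C, f c ∈ e))}
  have hcoarse : ∀ A ∈ 𝒜, A ⊆ P ∨ A ⊆ X.edgeSet \ P := by
    intro A hA
    have hAX := fam_subset (T.mem_fam hA)
    by_cases hc : ∃ c ∈ C, f c ∈ bd X.edgeSet A
    · exact Or.inl fun e he => ⟨hAX he, Or.inl ⟨A, hA, he, hc⟩⟩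
    · refine Or.inr fun e he => ⟨hAX he, ?_⟩
      rintro ⟨-, ⟨B, hB, heB, hc'⟩ | ⟨hno, -⟩⟩
      · by_cases hAB : A = B
        · exact hc (hAB ▸ hc')
        · exact (T.disj hA hB hAB he).2 heB
      · exact hno A hA he
  have hC : ∀ c ∈ C, f c ∉ vset (X.edgeSet \ P) := by
    rintro c hc ⟨e, he, hce⟩
    apply he.2
    refine ⟨he.1, ?_⟩
    by_cases hA : ∃ A ∈ 𝒜, e ∈ A
    · obtain ⟨A, hA, heA⟩ := hA
      exact Or.inl ⟨A, hA, heA, c, hc, T.mem_bd hA ⟨e, heA, hce⟩⟩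
    · push Not at hA
      exact Or.inr ⟨hA, c, hc, hce⟩
  have hD : ∀ d ∈ D, f d ∉ vset P := by
    rintro d hd ⟨e, ⟨heX, he⟩, hde⟩
    have hfne : ∀ c ∈ C, f c ≠ f d := by
      intro c hc hcd
      exact h.disj hc (T.injective hcd ▸ hd)
    rcases he with ⟨A, hA, heA, c, hc, hcA⟩ | ⟨hno, c, hc, hce⟩
    · refine h.not_adj hc hd
        ((T.adj_iff c d).2 ⟨fun h' => hfne c hc (h' ▸ rfl), Or.inr ⟨A, hA, ?_⟩⟩)
      have hdA := T.mem_bd hA ⟨e, heA, hde⟩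
      rcases fam_bd hX hlf (T.mem_fam hA) with ⟨x, hx⟩ | ⟨x, y, -, hxy⟩
      · rw [hx] at hcA hdA
        exact absurd (hcA.trans hdA.symm) (hfne c hc)
      · have hne := hfne c hc
        rw [hxy] at hcA hdA ⊢
        rcases hcA with h1 | h1 <;> rcases hdA with h2 | h2
        · exact absurd (h1.trans h2.symm) hne
        · rw [h1, Set.mem_singleton_iff.1 h2]
        · rw [Set.mem_singleton_iff.1 h1, h2, Set.pair_comm]
        · exact absurd (h1.trans h2.symm) hne
    · have hee : e = s(f c, f d) := (Sym2.mem_and_mem_iff (hfne c hc)).1 ⟨hce, hde⟩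
      subst hee
      exact h.not_adj hc hd ((T.adj_iff c d).2 ⟨fun h' => hfne c hc (h' ▸ rfl), Or.inl ⟨heX, hno⟩⟩)
  refine ⟨P, fun e he => he.1, hcoarse, hC, hD, ?_⟩
  intro x hx
  by_cases hxr : x ∈ Set.range f
  · obtain ⟨w, rfl⟩ := hxr
    rcases h.cover w with h1 | h1 | h1
    · exact ⟨w, h1, rfl⟩
    · exact absurd hx.2 (hC w h1)
    · exact absurd hx.1 (hD w h1)
  · rw [T.mem_range] at hxr
    push Not at hxr
    obtain ⟨A, hA, hxA⟩ := hxr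
    obtain ⟨⟨e, he, hxe⟩, ⟨e', he', hxe'⟩⟩ := hx
    have heA : e ∈ A := by_contra fun h' => hxA ⟨e, ⟨he.1, h'⟩, hxe⟩
    have heA' : e' ∈ A := by_contra fun h' => hxA ⟨e', ⟨he'.1, h'⟩, hxe'⟩
    rcases hcoarse A hA with h1 | h1
    · exact absurd (h1 heA') he'.2
    · exact absurd he (h1 heA).2

theorem not_subset_singleton [Nontrivial V] (hX : X.Connected)
    (hlf : ∀ v, (X.neighborSet v).Finite) (T : IsTorso X 𝒜 Z f) {S C D : Set W}
    (h : IsSep Z S C D) (s : W) : ¬ S ⊆ {s} := by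
  intro hS
  obtain ⟨P, hP, -, hC, hD, hbd⟩ := T.exists_separation hX hlf h
  obtain ⟨c, hc⟩ := h.left_nonempty
  obtain ⟨d, hd⟩ := h.right_nonempty
  obtain ⟨e, he, -⟩ := mem_vset_of_notMem_sdiff hX (hC c hc)
  obtain ⟨e', he', -⟩ := mem_vset_sdiff hX (hD d hd)
  have hsub : bd X.edgeSet P ⊆ {f s} := by
    intro x hx
    obtain ⟨w, hw, rfl⟩ := hbd hx
    rw [Set.mem_singleton_iff.1 (hS hw)]
    rfl
  exact T.not_oneSep hX ⟨hP, f s, bd_eq_of_subset_singleton hX ⟨e, he⟩ ⟨e', he'⟩ hsub⟩ (hC c hc)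
    (hD d hd)

end IsTorso

/-- With these parameters the extension consists of everything that hangs on the block at `p`,
without the block itself. -/
theorem mem_attached {Y : Set (Sym2 V)} (hY : IsBlock X Y) {p x w : V} {e : Sym2 V}
    (he : e ∈ X.edgeSet)
    (heY : e ∉ Y) (hx : x ∈ e) (hw : w ∈ vset Y) (hxw : (X.deleteEdges Y).Reachable x w) :
    e ∈ ext X Y ∅ {p} ↔ w = p :=
  mem_ext_of_reachable hY (Set.empty_subset Y) he heY hx hw hxw

theorem notMem_attached {Y : Set (Sym2 V)} (hY : IsBlock X Y) {p : V} {e : Sym2 V} (he : e ∈ Y) :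
    e ∉ ext X Y ∅ {p} := fun h => (mem_ext_of_mem hY he).1 h

theorem bd_attached_subset {Y : Set (Sym2 V)} (hX : X.Connected) (hY : IsBlock X Y) (p : V) :
    bd X.edgeSet (ext X Y ∅ {p}) ⊆ {p} := by
  rintro x ⟨⟨e, he, hxe⟩, ⟨e', he', hxe'⟩⟩
  have heX := he.1
  have heY : e ∉ Y := fun h => notMem_attached hY h he
  by_cases hxY : x ∈ vset Y
  · exact (mem_attached hY heX heY hxe hxY .rfl).1 he
  · obtain ⟨w, hw, h⟩ := hY.exists_reachable hX x
    have h1 := (mem_attached hY heX heY hxe hw h).1 he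
    exact absurd ((mem_attached hY he'.1 (fun h' => hxY ⟨e', h', hxe'⟩) hxe' hw h).2 h1) he'.2

namespace IsTorso

/-- Both ends of an edge of the torso, real or virtual, lie in a common block. A torso vertex
outside that block would be separated from one of these ends by its vertex of attachment. -/
theorem exists_block [Nontrivial V] [Nontrivial W] (hX : X.Connected)
    (hlf : ∀ v, (X.neighborSet v).Finite) (T : IsTorso X 𝒜 Z f) :
    ∃ Y, IsBlock X Y ∧ ∀ w, f w ∈ vset Y := by
  obtain ⟨a, b, hab⟩ : ∃ a b, Z.Adj a b := by
    by_contra! hno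
    obtain ⟨a, b, hab⟩ := exists_pair_ne W
    -- A torso without edges would be separated by the empty set.
    refine T.not_subset_singleton hX hlf (S := ∅) (C := {a}) (D := {a}ᶜ)
      ⟨fun x => ?_, by simp, by simp, fun h h' => h' h, fun _ _ => hno _ _, by simp,
        ⟨b, hab.symm⟩⟩ a (by simp)
    right
    exact em _
  have hY : ∃ Y, IsBlock X Y ∧ f a ∈ vset Y ∧ f b ∈ vset Y := by
    rcases ((T.adj_iff a b).1 hab).2 with ⟨h1, -⟩ | ⟨A, hA, h1⟩
    · obtain ⟨Y, hY, he⟩ := IsBlock.exists_mem h1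
      exact ⟨Y, hY, ⟨_, he, by simp⟩, ⟨_, he, by simp⟩⟩
    · rcases T.mem_fam hA with hA' | ⟨Y, F, hY, hF, -, hB⟩
      · obtain ⟨c, hc⟩ := hA'.1.2
        have ha : f a ∈ bd X.edgeSet A := by simp [h1]
        have hb : f b ∈ bd X.edgeSet A := by simp [h1]
        rw [hc] at ha hb
        exact absurd (T.injective (ha.trans hb.symm)) hab.ne
      · rw [hB.bd_eq hX hlf hY hF.1] at h1
        have ha : f a ∈ bd Y F := by simp [h1]
        have hb : f b ∈ bd Y F := by simp [h1]
        exact ⟨Y, hY, vset_mono hF.1.1 ha.1, vset_mono hF.1.1 hb.1⟩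
  obtain ⟨Y, hY, haY, hbY⟩ := hY
  refine ⟨Y, hY, fun w => ?_⟩
  by_contra hw
  obtain ⟨p, hp, hwp⟩ := hY.exists_reachable hX (f w)
  obtain ⟨d, hd, hdp⟩ : ∃ d, f d ∈ vset Y ∧ f d ≠ p := by
    by_cases h : f a = p
    · exact ⟨b, hbY, fun h' => hab.ne (T.injective (h.trans h'.symm))⟩
    · exact ⟨a, haY, h⟩
  have hw1 : f w ∉ vset (X.edgeSet \ ext X Y ∅ {p}) := by
    rintro ⟨e, he, hwe⟩
    exact he.2 ((mem_attached hY he.1 (fun h => hw ⟨e, h, hwe⟩) hwe hp hwp).2 rfl)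
  have hd1 : f d ∉ vset (ext X Y ∅ {p}) := by
    rintro ⟨e, he, hde⟩
    have heY : e ∉ Y := fun h => notMem_attached hY h he
    exact hdp ((mem_attached hY he.1 heY hde hd .rfl).1 he)
  obtain ⟨e, he, -⟩ := mem_vset_of_notMem_sdiff hX hw1
  obtain ⟨e', he', -⟩ := mem_vset_sdiff hX hd1
  exact T.not_oneSep hX ⟨ext_subset, p, bd_eq_of_subset_singleton hX ⟨e, he⟩ ⟨e', he'⟩
    (bd_attached_subset hX hY p)⟩ hw1 hd1

/-- Such a set has vertices off its boundary on both sides, so it is nontrivial and its versions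
belong to the family. A member one of whose sides lies in an edge starting at the node has no torso
vertex off its boundary on that side. -/
theorem not_uncrossed (hX : X.Connected) (hlf : ∀ v, (X.neighborSet v).Finite)
    (T : IsTorso X 𝒜 Z f) {Y G : Set (Sym2 V)} (hY : IsBlock X Y) (hG : Uncrossed Y G) {a d : W}
    (ha : f a ∈ vset G) (ha' : f a ∉ bd Y G) (hd : f d ∈ vset Y) (hd' : f d ∉ vset G) : False := by
  obtain ⟨u, v, huv, hbd⟩ := hG.1.2
  have hbd' : bd Y (Y \ G) = {u, v} := by rw [bd_sdiff hG.1.1, hbd]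
  have hd2 := mem_vset_sdiff_of_notMem hd hd'
  have hn : Nontriv Y G := ⟨ne_singleton_of_interior huv hbd ha ha',
    ne_singleton_of_interior huv hbd' hd2 (by rw [bd_sdiff hG.1.1]; exact fun h => hd' h.1)⟩
  have hB : IsVersion X Y G (ext X Y G (heavy Y G)) := Or.inl rfl
  have hBbd := hB.bd_eq hX hlf hY hG.1
  obtain ⟨A, hA, h6 | h6⟩ := T.position (Or.inr ⟨Y, G, hY, hG, hn, hB⟩)
  · have haB := vset_mono (subset_ext (X := X) (W := heavy Y G) hY hG.1.1) ha
    have := T.mem_bd hA (vset_mono h6 haB)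
    apply ha'
    rw [← hBbd]
    exact ⟨haB, vset_mono (Set.sdiff_subset_sdiff_right h6) this.2⟩
  · have hdB : f d ∈ vset (X.edgeSet \ ext X Y G (heavy Y G)) := by
      obtain ⟨e, he, hde⟩ := hd2
      exact ⟨e, ⟨hY.subset he.1, fun h => he.2 ((mem_ext_of_mem hY he.1).1 h)⟩, hde⟩
    have := T.mem_bd hA (vset_mono h6 hdB)
    have h7 : f d ∈ bd X.edgeSet (ext X Y G (heavy Y G)) :=
      ⟨vset_mono (sdiff_subset_comm h6) this.2, hdB⟩
    rw [hBbd] at h7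
    exact hd' h7.1

/-- A member of the family that meets a block in a proper part comes from that block. -/
theorem exists_of_split (hX : X.Connected) {Y A : Set (Sym2 V)} (hY : IsBlock X Y)
    (hA : A ∈ fam X) (h1 : ¬ Y ⊆ A) (h2 : ¬ Y ⊆ X.edgeSet \ A) : Uncrossed Y (A ∩ Y) := by
  rcases hA with hA | ⟨Y', F', hY', hF', -, hB⟩
  · rcases hY.subset_or hA.1 with h | h
    · exact absurd h h1
    · exact absurd h h2
  · obtain ⟨K, rfl⟩ := hB.exists_eq
    by_cases hne : Y = Y'
    · subst hne
      rwa [ext_inter hY hF'.1.1]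
    · obtain ⟨M, hM, h3, h4⟩ := hY.exists_oneSep_of_ne hY' hne
      rcases OneSep.subset_ext_or (W := K) hX hY' hF'.1.1 hM h4 with h | h
      · exact absurd (h3.trans h) h1
      · exact absurd (h3.trans h) h2

/-- The boundary vertices of a crossing set belong to `Z`. -/
theorem mem_range_of_crossing (hX : X.Connected) (T : IsTorso X 𝒜 Z f) {Y P R : Set (Sym2 V)}
    (hY : IsBlock X Y) (hcoarse : ∀ A ∈ 𝒜, A ⊆ P ∨ A ⊆ X.edgeSet \ P)
    (hR : TwoBd Y R) (hc : Crossing Y (P ∩ Y) R) {y : V} (hy : y ∈ bd Y R) :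
    y ∈ Set.range f := by
  rw [T.mem_range]
  by_contra! hno
  obtain ⟨A, hA, hyA⟩ := hno
  have hmem : ∀ e ∈ Y, y ∈ e → e ∈ A := fun e he hye =>
    by_contra fun h => hyA ⟨e, ⟨hY.subset he, h⟩, hye⟩
  have hnot : ∀ S ⊆ A, (P ∩ Y ∩ S).Nonempty → ((Y \ (P ∩ Y)) ∩ S).Nonempty → False := by
    rintro S hS ⟨e, he⟩ ⟨e', he'⟩
    rcases hcoarse A hA with h | h
    · exact he'.1.2 ⟨h (hS he'.2), he'.1.1⟩
    · exact (h (hS he.2)).2 he.1.1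
  have hyY : y ∈ vset Y := vset_mono hR.1 hy.1
  have hU := exists_of_split hX hY (T.mem_fam hA)
    (fun h => hnot Y h (by
      obtain ⟨e, he⟩ := hc.inter
      exact ⟨e, he.1, hc.left he.1⟩) (by
      obtain ⟨e, he⟩ := hc.compl_inter
      exact ⟨e, he.1, he.1.1⟩))
    (fun h => hyA (vset_mono h hyY))
  obtain ⟨⟨e, he, hye⟩, ⟨e', he', hye'⟩⟩ := hy
  -- Since `A` contains all edges of the block at the boundary vertex `y` of `R`, its trace lies in
  -- neither side of `R`. So `A` contains one side of `R`, which meets both sides of `P`, although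
  -- `A` is on one side of `P`.
  rcases hU.2 R hR with h | h | h | h
  · exact he'.2 (h ⟨hmem e' he'.1 hye', he'.1⟩)
  · exact (h ⟨hmem e (hR.1 he) hye, hR.1 he⟩).2 he
  · refine hnot (Y \ R) (fun d hd => ?_) hc.inter_compl hc.compl_inter_compl
    exact (sdiff_subset_comm h hd).1
  · refine hnot R (fun d hd => ?_) hc.inter hc.compl_inter
    by_contra hdA
    exact (h ⟨hR.1 hd, fun h' => hdA h'.1⟩).2 hd

/-- A real edge between the two sides would lie in the block, hence in `R` or in its complement. A
virtual edge between them would come from an uncrossed subset of the same block, whose boundary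
vertices `R` cannot separate. -/
theorem isSep_of_twoBd (hX : X.Connected) (hlf : ∀ v, (X.neighborSet v).Finite)
    (T : IsTorso X 𝒜 Z f) {Y R : Set (Sym2 V)} (hY : IsBlock X Y) (hZY : ∀ w, f w ∈ vset Y)
    (hR : TwoBd Y R) {w z u v : W} (hwz : bd Y R = {f w, f z}) (hu : f u ∉ vset (Y \ R))
    (hv : f v ∉ vset R) :
    IsSep Z {w, z} {x | f x ∉ vset (Y \ R)} {x | f x ∉ vset R} where
  cover x := by
    by_cases h1 : f x ∈ vset R
    · by_cases h2 : f x ∈ vset (Y \ R)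
      · have : f x ∈ bd Y R := ⟨h1, h2⟩
        rw [hwz] at this
        left
        rcases this with h | h
        · exact Or.inl (T.injective h)
        · exact Or.inr (T.injective h)
      · exact Or.inr (Or.inl h2)
    · exact Or.inr (Or.inr h1)
  notMem_left := by
    rintro x hx hx'
    have : f x ∈ bd Y R := by
      rw [hwz]
      rcases hx with rfl | rfl <;> simp
    exact hx' this.2
  notMem_right := by
    rintro x hx hx'
    have : f x ∈ bd Y R := by
      rw [hwz]
      rcases hx with rfl | rfl <;> simp
    exact hx' this.1
  disj := fun {x} h1 h2 => h1 (mem_vset_sdiff_of_notMem (hZY x) h2)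
  not_adj := by
    intro x y hx hy hxy
    change f x ∉ _ at hx
    change f y ∉ _ at hy
    obtain ⟨hne, ⟨h1, -⟩ | ⟨A, hA, h1⟩⟩ := (T.adj_iff x y).1 hxy
    · have h2 : s(f x, f y) ∈ Y := hY.mem_of_adj (hZY x) (hZY y) h1
      by_cases h3 : s(f x, f y) ∈ R
      · exact hy ⟨_, h3, by simp⟩
      · exact hx ⟨_, ⟨h2, h3⟩, by simp⟩
    · rcases T.mem_fam hA with hA' | ⟨Y', F', hY', hF', -, hB⟩
      · obtain ⟨c, hc⟩ := hA'.1.2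
        have hx' : f x ∈ bd X.edgeSet A := by simp [h1]
        have hy' : f y ∈ bd X.edgeSet A := by simp [h1]
        rw [hc] at hx' hy'
        exact hne (T.injective (hx'.trans hy'.symm))
      · rw [hB.bd_eq hX hlf hY' hF'.1] at h1
        have hx' : f x ∈ bd Y' F' := by simp [h1]
        have hy' : f y ∈ bd Y' F' := by simp [h1]
        obtain rfl := hY.eq_of_mem_vset hY' (T.injective.ne hne) (hZY x) (hZY y)
          (vset_mono hF'.1.1 hx'.1) (vset_mono hF'.1.1 hy'.1)
        rcases hF'.2 R hR with h | h | h | h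
        · exact hy (vset_mono h hy'.1)
        · exact hx (vset_mono h hx'.1)
        · exact hy (vset_mono h hy'.2)
        · exact hx (vset_mono h hx'.2)
  left_nonempty := ⟨u, hu⟩
  right_nonempty := ⟨v, hv⟩

/-- Every separation of order two of `Z` is crossed by another one. -/
theorem exists_crossing [Nontrivial V] (hX : X.Connected) (hlf : ∀ v, (X.neighborSet v).Finite)
    (T : IsTorso X 𝒜 Z f) {u v : W} {C D : Set W} (huv : u ≠ v) (h : IsSep Z {u, v} C D) :
    ∃ w ∈ C, ∃ z ∈ D, ∃ Cu Cv, IsSep Z {w, z} Cu Cv ∧ u ∈ Cu ∧ v ∈ Cv := by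
  have : Nontrivial W := ⟨u, v, huv⟩
  obtain ⟨Y, hY, hZY⟩ := T.exists_block hX hlf
  have hY2 := hY.twoConn hX
  obtain ⟨P, hP, hcoarse, hC, hD, hbdP⟩ := T.exists_separation hX hlf h
  have hsub : P ∩ Y ⊆ Y := Set.inter_subset_right
  have hsd : Y \ (P ∩ Y) ⊆ X.edgeSet \ P := fun e he =>
    ⟨hY.subset he.1, fun h => he.2 ⟨h, he.1⟩⟩
  have hC1 : ∀ c ∈ C, f c ∉ vset (Y \ (P ∩ Y)) := fun c hc h' => hC c hc (vset_mono hsd h')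
  have hD1 : ∀ d ∈ D, f d ∉ vset (P ∩ Y) := fun d hd h' =>
    hD d hd (vset_mono Set.inter_subset_left h')
  have hD2 : ∀ d ∈ D, f d ∈ vset (Y \ (P ∩ Y)) := fun d hd =>
    mem_vset_sdiff_of_notMem (hZY d) (hD1 d hd)
  have hC2 : ∀ c ∈ C, f c ∈ vset (P ∩ Y) := fun c hc => by
    by_contra h'
    exact hC1 c hc (mem_vset_sdiff_of_notMem (hZY c) h')
  obtain ⟨c, hc⟩ := h.left_nonempty
  obtain ⟨d, hd⟩ := h.right_nonempty
  have hFne : (P ∩ Y).Nonempty := by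
    obtain ⟨e, he, -⟩ := hC2 c hc
    exact ⟨e, he⟩
  have hFne' : (Y \ (P ∩ Y)).Nonempty := by
    obtain ⟨e, he, -⟩ := hD2 d hd
    exact ⟨e, he⟩
  have hbd : bd Y (P ∩ Y) = {f u, f v} := by
    refine hY2.bd_eq hsub hFne hFne' fun x hx => ?_
    have : x ∈ bd X.edgeSet P := ⟨vset_mono Set.inter_subset_left hx.1, vset_mono hsd hx.2⟩
    obtain ⟨w, rfl | rfl, rfl⟩ := hbdP this <;> simp
  have hfuv := T.injective.ne huv
  have hF : TwoBd Y (P ∩ Y) := ⟨hsub, f u, f v, hfuv, hbd⟩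
  have hcb : f c ∉ bd Y (P ∩ Y) := fun h' => hC1 c hc h'.2
  -- The trace of the lifted separation is crossed, because no uncrossed set separates `f c` from `f
  -- d`.
  have hnot : ¬ Uncrossed Y (P ∩ Y) := fun hU =>
    T.not_uncrossed hX hlf hY hU (hC2 c hc) hcb (hZY d) (hD1 d hd)
  obtain ⟨R, hR, hnest⟩ : ∃ R, TwoBd Y R ∧ ¬ Nested Y (P ∩ Y) R := by
    by_contra! h'
    exact hnot ⟨hF, h'⟩
  have hcross := crossing_of_not_nested hsub hR.1 hnest
  -- If the crossing set has the same boundary, the bridge of `f c` is uncrossed and still separates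
  -- it from `f d`, which is impossible.
  rcases hY2.cases hcross hbd hR with hbR | ⟨w, z, hbR, hw, hz, hsep⟩
  · exfalso
    have hcu : f c ≠ f u := by rintro h'; rw [h', hbd] at hcb; simp at hcb
    have hcv : f c ≠ f v := by rintro h'; rw [h', hbd] at hcb; simp at hcb
    have hU := hY2.uncrossed_bridge hcross hfuv hbd hbR (hC2 c hc) hcu hcv
    obtain ⟨e, he, hce⟩ := hC2 c hc
    refine T.not_uncrossed hX hlf hY hU (a := c) (d := d)
      ⟨e, mem_bridge hcu hcv he.2 hce, hce⟩ ?_ (hZY d)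
      fun h' => hD1 d hd (vset_mono (bridge_subset_of_bd hbd (hC2 c hc)) h')
    intro h'
    rcases bd_bridge_subset h' with h' | h'
    · exact hcu h'
    · exact hcv h'
  · obtain ⟨w, rfl⟩ := T.mem_range_of_crossing hX hY hcoarse hR hcross (y := w) (by simp [hbR])
    obtain ⟨z, rfl⟩ := T.mem_range_of_crossing hX hY hcoarse hR hcross (y := z) (by simp [hbR])
    have hub : f u ∈ bd Y (P ∩ Y) := by simp [hbd]
    have hvb : f v ∈ bd Y (P ∩ Y) := by simp [hbd]
    refine ⟨w, ?_, z, ?_, ?_⟩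
    · rcases h.cover w with (rfl | h1) | h1 | h1
      · exact absurd hub.2 hw
      · exact absurd (Set.mem_singleton_iff.1 h1 ▸ hvb.2) hw
      · exact h1
      · exact absurd (hD2 w h1) hw
    · rcases h.cover z with (rfl | h1) | h1 | h1
      · exact absurd hub.1 hz
      · exact absurd (Set.mem_singleton_iff.1 h1 ▸ hvb.1) hz
      · exact absurd (hC2 z h1) hz
      · exact h1
    · rcases hsep with ⟨h1, h2⟩ | ⟨h1, h2⟩
      · exact ⟨_, _, T.isSep_of_twoBd hX hlf hY hZY hR hbR h1 h2, h1, h2⟩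
      · exact ⟨_, _, (T.isSep_of_twoBd hX hlf hY hZY hR hbR h2 h1).symm, h1, h2⟩

/-- A torso with at least two vertices is a cycle or three-connected. -/
theorem isCycleGraph_or [Nontrivial V] [Nontrivial W] (hX : X.Connected)
    (hlf : ∀ v, (X.neighborSet v).Finite) (T : IsTorso X 𝒜 Z f) :
    IsCycleGraph Z ∨ IsThreeConnected Z := by
  by_cases h : IsThreeConnected Z
  · exact Or.inr h
  left
  rw [IsThreeConnected, not_and] at h
  have h' := h ‹_›
  push Not at h'
  obtain ⟨S, hS, hpre⟩ := h'
  obtain ⟨C, D, hSep⟩ := exists_isSep hpre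
  have h1 : ∀ S C D, IsSep Z S C D → ∀ c, ¬ S ⊆ {c} := fun S C D h c =>
    T.not_subset_singleton hX hlf h c
  have h2 : S.encard = 2 := by
    refine le_antisymm hS (not_lt.1 fun hlt => ?_)
    have hle : S.encard ≤ 1 := Order.le_of_lt_add_one (by rwa [one_add_one_eq_two])
    rw [Set.encard_le_one_iff_subsingleton] at hle
    rcases S.eq_empty_or_nonempty with rfl | ⟨s, hs⟩
    · obtain ⟨c, -⟩ := hSep.left_nonempty
      exact h1 _ _ _ hSep c (by simp)
    · exact h1 _ _ _ hSep s fun x hx => hle hx hs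
  obtain ⟨u, v, huv, rfl⟩ := Set.encard_eq_two.1 h2
  exact isCycleGraph_of_isSep h1 (fun u v C D huv h => T.exists_crossing hX hlf huv h) huv hSep

end IsTorso
end Torsos
end TutteTree

/-! ### A subdivision of the torso inside the graph -/

namespace TutteTree
section TorsoSubdivision
open SimpleGraph
variable {V W : Type*} {X : SimpleGraph V} {𝒜 : Set (Set (Sym2 V))} {Z : SimpleGraph W} {f : W → V}

/-- The two vertices of the boundary of a canonical separation are joined by a path within it. -/
theorem exists_path_of_mem_fam (hX : X.Connected) (hlf : ∀ v, (X.neighborSet v).Finite)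
    {A : Set (Sym2 V)} (hA : A ∈ fam X) {u v : V} (huv : u ≠ v) (h : bd X.edgeSet A = {u, v}) :
    ∃ p : X.Walk u v, p.IsPath ∧ ∀ x ∈ p.support, x ∈ vset A := by
  rcases hA with hA | ⟨Y, F, hY, hF, -, hA⟩
  · obtain ⟨c, hc⟩ := hA.1.2
    rw [h] at hc
    have h1 : u = c := hc.subset (by simp)
    have h2 : v = c := hc.subset (by simp)
    exact absurd (h1.trans h2.symm) huv
  rw [hA.bd_eq hX hlf hY hF.1] at h
  obtain ⟨W, rfl⟩ := hA.exists_eq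
  obtain ⟨p, hp⟩ := (hY.reachable_of_bd hX hF.1.1 huv h).exists_isPath
  have hle : fromEdgeSet F ≤ X := fun x y hxy => hY.subset (hF.1.1 hxy.1)
  refine ⟨p.mapLe hle, hp.mapLe hle, ?_⟩
  have key : ∀ {a b : V} (p : (fromEdgeSet F).Walk a b), a ∈ vset F →
      ∀ x ∈ p.support, x ∈ vset F := by
    intro a b p
    induction p with
    | nil => simp
    | @cons a b c hab p ih =>
      intro ha x hx
      rw [Walk.support_cons, List.mem_cons] at hx
      rcases hx with rfl | hx
      · exact ha
      · exact ih ⟨s(a, b), hab.1, by simp⟩ x hx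
  intro x hx
  rw [Walk.support_mapLe_eq_support] at hx
  exact vset_mono (subset_ext hY hF.1.1) (key p (h.superset (by simp) : u ∈ bd Y F).1 x hx)

namespace IsTorso

theorem exists_path (hX : X.Connected) (hlf : ∀ v, (X.neighborSet v).Finite)
    (T : IsTorso X 𝒜 Z f) {a b : W} (h : Z.Adj a b) :
    ∃ p : X.Walk (f a) (f b), p.IsPath ∧ ((∀ x ∈ p.support, x = f a ∨ x = f b) ∨
      ∃ A ∈ 𝒜, bd X.edgeSet A = {f a, f b} ∧ ∀ x ∈ p.support, x ∈ vset A) := by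
  obtain ⟨hne, ⟨h1, -⟩ | ⟨A, hA, h1⟩⟩ := (T.adj_iff a b).1 h
  · have hadj : X.Adj (f a) (f b) := h1
    exact ⟨hadj.toWalk, by simp [hadj.ne], Or.inl fun x hx => by simpa using hx⟩
  · obtain ⟨p, hp, hpA⟩ := exists_path_of_mem_fam hX hlf (T.mem_fam hA) (T.injective.ne hne) h1
    exact ⟨p, hp, Or.inr ⟨A, hA, h1, hpA⟩⟩

/-- Paths for two different virtual edges run in different members of `𝒜`. These have no common
edge, so a common vertex is a boundary vertex and belongs to the torso. -/
theorem hasSubdivisionIn (hX : X.Connected) (hlf : ∀ v, (X.neighborSet v).Finite)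
    (T : IsTorso X 𝒜 Z f) : HasSubdivisionIn Z X := by
  classical
  -- The order serves only to choose one path for each unordered pair, so that opposite orientations
  -- get reversed paths.
  let : LinearOrder W := linearOrderOfSTO WellOrderingRel
  choose q hq hq' using fun (a b : W) (h : Z.Adj a b) => T.exists_path hX hlf h
  let p : ∀ a b, Z.Adj a b → X.Walk (f a) (f b) := fun a b h =>
    if a < b then q a b h else (q b a h.symm).reverse
  have hp : ∀ a b h, (p a b h).IsPath ∧ ((∀ x ∈ (p a b h).support, x = f a ∨ x = f b) ∨
      ∃ A ∈ 𝒜, bd X.edgeSet A = {f a, f b} ∧ ∀ x ∈ (p a b h).support, x ∈ vset A) := by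
    intro a b h
    by_cases hab : a < b
    · simp only [p, if_pos hab]
      exact ⟨hq a b h, hq' a b h⟩
    · simp only [p, if_neg hab, Walk.isPath_reverse_iff, Walk.support_reverse, List.mem_reverse]
      refine ⟨hq b a h.symm, ?_⟩
      rw [Set.pair_comm]
      simpa only [or_comm] using hq' b a h.symm
  refine ⟨f, p, T.injective, fun a b h => (hp a b h).1, ?_, ?_, ?_⟩
  · intro a b h
    rcases lt_or_gt_of_ne h.ne with hab | hab
    · simp only [p, if_pos hab, if_neg hab.asymm]
    · simp only [p, if_pos hab, if_neg hab.asymm, Walk.reverse_reverse]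
  · intro a b h c hc
    rcases (hp a b h).2 with h1 | ⟨A, hA, hbd, h1⟩
    · exact (h1 _ hc).imp (T.injective ·) (T.injective ·)
    · have := T.mem_bd hA (h1 _ hc)
      rw [hbd] at this
      exact this.imp (T.injective ·) (T.injective ·)
  · intro a b h c d h' hne x hx hx'
    rcases (hp a b h).2 with h1 | ⟨A, hA, hbd, h1⟩
    · rcases h1 x hx with rfl | rfl <;> simp
    rcases (hp c d h').2 with h2 | ⟨B, hB, hbd', h2⟩
    · rcases h2 x hx' with rfl | rfl <;> simp
    refine T.bd_subset_range hA ⟨h1 x hx, vset_mono (T.disj hB hA ?_) (h2 x hx')⟩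
    rintro rfl
    rw [hbd] at hbd'
    apply hne
    rcases Set.pair_eq_pair_iff.1 hbd' with ⟨h3, h4⟩ | ⟨h3, h4⟩
    · rw [T.injective h3, T.injective h4]
    · rw [T.injective h3, T.injective h4, Sym2.eq_swap]

end IsTorso
end TorsoSubdivision
end TutteTree

/-! ### Back to subgraphs: the canonical family and its nodes -/

namespace TutteTree
section StructureTree
open SimpleGraph
variable {V : Type*} {X : SimpleGraph V} {A B : Set (Sym2 V)}

/-- The canonical family of separations. -/
def canonical (X : SimpleGraph V) : Set X.Subgraph := ofEdges X '' fam X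

theorem opp_mem_canonical [Nontrivial V] (hX : X.Connected) {S : X.Subgraph}
    (hS : S ∈ canonical X) : opp S ∈ canonical X := by
  obtain ⟨A, hA, rfl⟩ := hS
  exact ⟨_, fam_compl hX hA, (opp_ofEdges (vset_edgeSet hX) (fam_subset hA)).symm⟩

theorem translate_mem_canonical (g : X ≃g X) {S : X.Subgraph} (hS : S ∈ canonical X) :
    translate g S ∈ canonical X := by
  obtain ⟨A, hA, rfl⟩ := hS
  exact ⟨_, act_mem_fam hA g, (translate_ofEdges g (fam_subset hA)).symm⟩

theorem isTreeSet_canonical [Nontrivial V] (hX : X.Connected)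
    (hlf : ∀ v, (X.neighborSet v).Finite) : IsTreeSet (canonical X) where
  opp_mem := opp_mem_canonical hX
  opp_opp := by
    rintro _ ⟨A, hA, rfl⟩
    rw [opp_ofEdges (vset_edgeSet hX) (fam_subset hA), opp_ofEdges (vset_edgeSet hX)
      Set.sdiff_subset, sdiff_sdiff_of_subset (fam_subset hA)]
  anti := by
    rintro _ _ ⟨A, hA, rfl⟩ ⟨B, hB, rfl⟩ h
    rw [ofEdges_le (fam_subset hA) (fam_subset hB)] at h
    rw [opp_ofEdges (vset_edgeSet hX) (fam_subset hA), opp_ofEdges (vset_edgeSet hX)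
      (fam_subset hB), ofEdges_le Set.sdiff_subset Set.sdiff_subset]
    exact Set.sdiff_subset_sdiff_right h
  nested := by
    rintro _ _ ⟨A, hA, rfl⟩ ⟨B, hB, rfl⟩
    have hA' := fam_subset hA
    have hB' := fam_subset hB
    rw [opp_ofEdges (vset_edgeSet hX) hA', opp_ofEdges (vset_edgeSet hX) hB', ofEdges_le hA' hB',
      ofEdges_le hA' Set.sdiff_subset, ofEdges_le Set.sdiff_subset hB',
      ofEdges_le Set.sdiff_subset Set.sdiff_subset]
    exact fam_nested hX hlf hA hB
  not_le_opp := by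
    rintro _ _ ⟨A, hA, rfl⟩ ⟨B, hB, rfl⟩ h h'
    have hA' := fam_subset hA
    have hB' := fam_subset hB
    rw [ofEdges_le hA' hB'] at h
    rw [opp_ofEdges (vset_edgeSet hX) hB', ofEdges_le hA' Set.sdiff_subset] at h'
    obtain ⟨e, he⟩ := fam_nonempty hX hlf hA
    exact (h' he).2 (h he)
  finite_interval := by
    rintro _ _ ⟨A, hA, rfl⟩ ⟨B, hB, rfl⟩ -
    refine ((finite_fam_interval hX hlf hA hB).image (ofEdges X)).subset ?_
    rintro _ ⟨⟨C, hC, rfl⟩, h1, h2⟩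
    rw [ofEdges_le (fam_subset hA) (fam_subset hC)] at h1
    rw [ofEdges_le (fam_subset hC) (fam_subset hB)] at h2
    exact ⟨C, ⟨hC, h1, h2⟩, rfl⟩

/-- If an extension, or its complement, were a single edge, then so would be its nonempty trace on
the block, which `Nontriv` excludes. -/
theorem canonical_subset_separations (hX : X.Connected)
    (hlf : ∀ v, (X.neighborSet v).Finite) : canonical X ⊆ separations X := by
  rintro _ ⟨A, hA, rfl⟩
  have hsub := fam_subset hA
  have hadj : ∀ x ∈ bd X.edgeSet A, ∃ z, (ofEdges X A).Adj x z := fun x hx => by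
    obtain ⟨z, hz⟩ := mem_vset_iff.1 hx.1
    exact ⟨z, (ofEdges_adj hsub).2 hz⟩
  rcases hA with hA | ⟨Y, F, hY, hF, hn, hA⟩
  · obtain ⟨c, hc⟩ := hA.1.2
    exact Or.inl ⟨c, by rw [hinge_ofEdges hsub, hc], hadj c (by simp [hc])⟩
  · right
    have hbd := hA.bd_eq hX hlf hY hF.1
    obtain ⟨u, v, huv, huvF⟩ := hF.1.2
    rw [← hbd] at huvF
    obtain ⟨W, rfl⟩ := hA.exists_eq
    have hFA := ext_inter (W := W) hY hF.1.1
    refine ⟨⟨u, v, huv, by rw [hinge_ofEdges hsub, huvF], hadj u (by simp [huvF]),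
      hadj v (by simp [huvF])⟩, fun a b hab => ⟨fun h => ?_, fun h => ?_⟩⟩
    · refine hn.1 s(a, b) ((Set.subset_singleton_iff_eq.1 ?_).resolve_left hF.1.nonempty.ne_empty)
      have h' := congrArg Subgraph.edgeSet h
      rw [ofEdges_edgeSet hsub, edgeSet_subgraphOfAdj] at h'
      rw [← hFA, h']
      exact Set.inter_subset_left
    · refine hn.2 s(a, b)
        ((Set.subset_singleton_iff_eq.1 ?_).resolve_left hF.1.compl.nonempty.ne_empty)
      intro e he
      by_contra hne
      refine he.2 (hFA.subset ⟨?_, he.1⟩)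
      have heX := hY.subset he.1
      rw [← ofEdges_edgeSet hsub, h]
      induction e with
      | h x y => exact ⟨heX, hne⟩

theorem exists_finite_orbits_canonical (hX : X.Connected) (hlf : ∀ v, (X.neighborSet v).Finite)
    (hfin : IsAutFinite X) :
    ∃ F ⊆ canonical X, F.Finite ∧
      ∀ S ∈ canonical X, ∃ S' ∈ F, ∃ g : X ≃g X, translate g S' = S := by
  obtain ⟨K, hK, hKf, hKg⟩ := exists_finite_orbits hX hlf hfin
  refine ⟨ofEdges X '' K, Set.image_mono hK, hKf.image _, ?_⟩
  rintro _ ⟨A, hA, rfl⟩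
  obtain ⟨B, hB, g, rfl⟩ := hKg A hA
  exact ⟨_, ⟨B, hB, rfl⟩, g, translate_ofEdges g (fam_subset (hK hB))⟩

theorem sup_opp (hX : vset X.edgeSet = Set.univ) (hA : A ⊆ X.edgeSet) :
    ofEdges X A ⊔ opp (ofEdges X A) = ⊤ := by
  rw [opp_ofEdges hX hA]
  ext x y
  · rw [Subgraph.verts_sup, ofEdges_verts hA, ofEdges_verts Set.sdiff_subset, ← vset_union,
      Set.union_sdiff_cancel hA, hX, Subgraph.verts_top]
  · rw [Subgraph.sup_adj, ofEdges_adj hA, ofEdges_adj Set.sdiff_subset, Subgraph.top_adj,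
      ← Set.mem_union, Set.union_sdiff_cancel hA, mem_edgeSet]

theorem verts_inf_opp (hX : vset X.edgeSet = Set.univ) (hA : A ⊆ X.edgeSet) :
    (ofEdges X A ⊓ opp (ofEdges X A)).verts = bd X.edgeSet A := by
  rw [opp_ofEdges hX hA, Subgraph.verts_inf, ofEdges_verts hA, ofEdges_verts Set.sdiff_subset, bd]

theorem edgeSet_inf_opp (S : X.Subgraph) : (S ⊓ opp S).edgeSet = ∅ := by
  rw [Set.eq_empty_iff_forall_notMem]
  intro e
  induction e with
  | h x y => exact fun h => h.2.2 h.1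

/-- The boundary of a set with one boundary vertex is a cut-point. -/
theorem isCutPoint_of_bd (hA : A ⊆ X.edgeSet) {c : V} (hc : bd X.edgeSet A = {c}) :
    IsCutPoint X c := by
  have hcA : c ∈ bd X.edgeSet A := by simp [hc]
  obtain ⟨x, hx⟩ := mem_vset_iff.1 hcA.1
  obtain ⟨y, hy⟩ := mem_vset_iff.1 hcA.2
  have hxc : x ≠ c := (X.ne_of_adj (hA hx)).symm
  have hyc : y ≠ c := (X.ne_of_adj hy.1).symm
  intro h
  obtain ⟨p⟩ := h ⟨x, hxc⟩ ⟨y, hyc⟩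
  have hy' : y ∈ vset A := by
    let q : X.Walk x y := p.map (Embedding.induce _).toHom
    have hq : ∀ z ∈ q.support, z ≠ c := by
      intro z hz
      obtain ⟨z, -, rfl⟩ := List.mem_map.1 (Walk.support_map _ p ▸ hz)
      exact z.2
    exact mem_vset_of_walk q ⟨_, hx, by simp⟩ fun z hz _ hzc =>
      hq z hz (hc ▸ hzc : z ∈ ({c} : Set V))
  have : y ∈ bd X.edgeSet A := ⟨hy', _, hy, by simp⟩
  rw [hc] at this
  exact hyc this

theorem isTorso_vertexGraph [Nontrivial V] (hX : X.Connected)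
    (hlf : ∀ v, (X.neighborSet v).Finite) {v : Set X.Subgraph} (hv : IsNode (canonical X) v) :
    IsTorso X {A | A ∈ fam X ∧ ofEdges X A ∈ v} (vertexGraph v) Subtype.val := by
  have hE := isTreeSet_canonical hX hlf
  have hΩ := vset_edgeSet hX
  have hall : ∀ P : X.Subgraph → Prop, (∀ S ∈ v, P S) ↔
      ∀ A ∈ {A | A ∈ fam X ∧ ofEdges X A ∈ v}, P (ofEdges X A) := by
    refine fun P => ⟨fun h A hA => h _ hA.2, fun h S hS => ?_⟩
    obtain ⟨A, hA, rfl⟩ := IsTreeSet.subset_of_isNode hv hS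
    exact h A ⟨hA, hS⟩
  refine
    { mem_fam := fun hA => hA.1
      disj := fun {A B} hA hB hne => ?_
      position := fun {B} hB => ?_
      injective := Subtype.val_injective
      mem_range := fun x => ?_
      adj_iff := fun a b => ?_ }
  · have := hE.le_opp_of_mem_node hv hA.2 hB.2
      fun h => hne (ofEdges_injOn (fam_subset hA.1) (fam_subset hB.1) h)
    rwa [opp_ofEdges hΩ (fam_subset hB.1), ofEdges_le (fam_subset hA.1) Set.sdiff_subset] at this
  · obtain ⟨S, hS, h⟩ := hE.position hv ⟨B, hB, rfl⟩
    obtain ⟨A, hA, rfl⟩ := IsTreeSet.subset_of_isNode hv hS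
    rw [opp_ofEdges hΩ (fam_subset hB), ofEdges_le (fam_subset hB) (fam_subset hA),
      ofEdges_le Set.sdiff_subset (fam_subset hA)] at h
    exact ⟨A, ⟨hA, hS⟩, h⟩
  · rw [Subtype.range_coe, mem_core, hall (fun S => x ∈ (opp S).verts)]
    refine forall₂_congr fun A hA => ?_
    rw [opp_ofEdges hΩ (fam_subset hA.1), ofEdges_verts Set.sdiff_subset]
  · rw [vertexGraph_adj, hall (fun S => ¬ S.Adj a b)]
    refine and_congr Iff.rfl (or_congr ?_ ?_)
    · exact and_congr Iff.rfl
        (forall₂_congr fun A hA => not_congr (ofEdges_adj (fam_subset hA.1)))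
    · constructor
      · rintro ⟨S, hS, h⟩
        obtain ⟨A, hA, rfl⟩ := IsTreeSet.subset_of_isNode hv hS
        exact ⟨A, ⟨hA, hS⟩, by rw [← hinge_ofEdges (fam_subset hA), h]⟩
      · rintro ⟨A, hA, h⟩
        exact ⟨_, hA.2, by rw [hinge_ofEdges (fam_subset hA.1), h]⟩

/-- The hinges of the members at a node are nonempty and contained in the core. If the core has at
most one vertex, all hinges therefore equal it; the empty node cannot occur here, since its core is
all of `X`. A larger core is covered by the results on torsos. -/
theorem vertexGraph_cases [Nontrivial V] (hX : X.Connected)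
    (hlf : ∀ v, (X.neighborSet v).Finite) {v : Set X.Subgraph} (hv : IsNode (canonical X) v) :
    (∃ c, IsCutPointNode v c) ∨ IsCycleGraph (vertexGraph v) ∨
      (IsThreeConnected (vertexGraph v) ∧ HasSubdivisionIn (vertexGraph v) X ∧
        (IsPlanar X → IsPlanar (vertexGraph v))) := by
  have T := isTorso_vertexGraph hX hlf hv
  rcases subsingleton_or_nontrivial (core v).verts with hs | hs
  · left
    rw [Set.subsingleton_coe] at hs
    rcases v.eq_empty_or_nonempty with rfl | ⟨S, hS⟩
    · obtain ⟨x, y, hxy⟩ := exists_pair_ne V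
      exact absurd (hs (x := x) (mem_core.2 (by simp)) (y := y) (mem_core.2 (by simp))) hxy
    · have hbd : ∀ S ∈ v, ∃ A ∈ fam X, ofEdges X A = S ∧ hinge S = bd X.edgeSet A ∧
          (hinge S).Nonempty ∧ hinge S ⊆ (core v).verts := by
        intro S hS
        obtain ⟨A, hA, rfl⟩ := IsTreeSet.subset_of_isNode hv hS
        have h := hinge_ofEdges (fam_subset hA)
        refine ⟨A, hA, rfl, h, h ▸ fam_bd_nonempty hX hlf hA, fun x hx => ?_⟩
        have := T.bd_subset_range ⟨hA, hS⟩ (h ▸ hx)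
        rwa [Subtype.range_coe] at this
      obtain ⟨A, hA, -, h1, ⟨c, hc⟩, h2⟩ := hbd S hS
      have hcore : (core v).verts = {c} := hs.eq_singleton_of_mem (h2 hc)
      have hall : ∀ S ∈ v, hinge S = {c} := by
        intro S hS
        obtain ⟨-, -, -, -, h3, h4⟩ := hbd S hS
        rw [hcore] at h4
        exact h3.subset_singleton_iff.1 h4
      exact ⟨c, isCutPoint_of_bd (fam_subset hA) (h1 ▸ hall S hS), hall, hcore⟩
  · right
    refine (T.isCycleGraph_or hX hlf).imp_right fun h => ?_
    have hsub := T.hasSubdivisionIn hX hlf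
    exact ⟨h, hsub, isPlanar_of_hasSubdivisionIn hsub⟩

end StructureTree
end TutteTree

/-! ### The theorem -/

theorem theorem3p7 {V : Type*} [Nontrivial V] (X : SimpleGraph V) (hconn : X.Connected)
    (hlf : ∀ v, (X.neighborSet v).Finite) (hfin : TutteTree.IsAutFinite X) :
    ∃ E : Set X.Subgraph,
      -- a `G`-finite `G`-set of separations, closed under the involution
      E ⊆ TutteTree.separations X ∧
      (∀ g : X ≃g X, ∀ A ∈ E, TutteTree.translate g A ∈ E) ∧
      (∀ A ∈ E, TutteTree.opp A ∈ E) ∧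
      (∃ F ⊆ E, F.Finite ∧ ∀ A ∈ E, ∃ B ∈ F, ∃ g : X ≃g X, TutteTree.translate g B = A) ∧
      -- it is nested
      (∀ A ∈ E, ∀ B ∈ E, A ≤ B ∨ A ≤ TutteTree.opp B ∨ TutteTree.opp A ≤ B ∨
        TutteTree.opp A ≤ TutteTree.opp B) ∧
      -- it satisfies the finite interval condition
      (∀ A ∈ E, ∀ B ∈ E, A ≤ B → {C | C ∈ E ∧ A ≤ C ∧ C ≤ B}.Finite) ∧
      -- `T` is a tree on which `G` acts
      (TutteTree.structureTree E).IsTree ∧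
      (∃ ρ : (X ≃g X) →* (TutteTree.structureTree E ≃g TutteTree.structureTree E),
        ∀ g v, (ρ g v).1 = TutteTree.translate g '' v.1) ∧
      -- its oriented edges are the elements of `E`, and each gives a decomposition of `X`
      (∃ Φ : E ≃ (TutteTree.structureTree E).Dart,
        ∀ A : E, A.1 ∈ (Φ A).fst.1 ∧ TutteTree.opp A.1 ∈ (Φ A).snd.1) ∧
      (∀ A ∈ E, A ⊔ TutteTree.opp A = ⊤ ∧ (A ⊓ TutteTree.opp A).edgeSet = ∅ ∧
        ((A ⊓ TutteTree.opp A).verts.ncard = 1 ∨ (A ⊓ TutteTree.opp A).verts.ncard = 2)) ∧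
      -- the vertices of `T`
      (∀ v : TutteTree.Node E,
        -- the stabilizer of `v` acts on the graph associated with `v`
        (∀ g : X ≃g X, TutteTree.translate g '' v.1 = v.1 →
          ∃ ψ : TutteTree.vertexGraph v.1 ≃g TutteTree.vertexGraph v.1,
            ∀ z, (ψ z : V) = g (z : V)) ∧
        ((∃ c, TutteTree.IsCutPointNode v.1 c) ∨
          TutteTree.IsCycleGraph (TutteTree.vertexGraph v.1) ∨
          (TutteTree.IsThreeConnected (TutteTree.vertexGraph v.1) ∧
            TutteTree.HasSubdivisionIn (TutteTree.vertexGraph v.1) X ∧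
            (TutteTree.IsPlanar X → TutteTree.IsPlanar (TutteTree.vertexGraph v.1))))) := by
  have hE := TutteTree.isTreeSet_canonical hconn hlf
  have htr : ∀ g : X ≃g X, ∀ A ∈ TutteTree.canonical X, TutteTree.translate g A ∈
    TutteTree.canonical X := fun g _ hA => TutteTree.translate_mem_canonical g hA
  refine ⟨TutteTree.canonical X, TutteTree.canonical_subset_separations hconn hlf, htr,
    fun A hA => hE.opp_mem hA, TutteTree.exists_finite_orbits_canonical hconn hlf hfin,
    fun A hA B hB => hE.nested hA hB, fun A hA B hB => hE.finite_interval hA hB, hE.isTree,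
    TutteTree.exists_monoidHom htr, hE.exists_equiv_dart, ?_, fun v =>
      ⟨fun g hg => TutteTree.exists_vertexGraph_iso hg,
        TutteTree.vertexGraph_cases hconn hlf v.2⟩⟩
  rintro _ ⟨A, hA, rfl⟩
  have hΩ := TutteTree.vset_edgeSet hconn
  have hA' := TutteTree.fam_subset hA
  refine ⟨TutteTree.sup_opp hΩ hA', TutteTree.edgeSet_inf_opp _, ?_⟩
  rw [TutteTree.verts_inf_opp hΩ hA']
  rcases TutteTree.fam_bd hconn hlf hA with ⟨c, h⟩ | ⟨u, v, huv, h⟩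
  · exact Or.inl (by rw [h, Set.ncard_singleton])
  · exact Or.inr (by rw [h, Set.ncard_pair huv])
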